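/- Let $X$ be a locally compact Hausdorff space with a "real" structure, that is, a continuous involution $\mathfrak r$, and let $C_0(X)$ carry the conjugate-linear involution $\mathfrak r(f)(x)=\overline{f(\mathfrak r(x))}$. Let $E\twoheadrightarrow X$ be a $\mathbb Z/2$-equivariant real vector bundle of finite (locally constant) rank with an invariant continuous Euclidean inner product. Let $\mathrm{Cl}_E$ be the bundle over $X$ of complex Clifford algebras of the fibres of $E$, generated by self-adjoint odd elements $v\in E_x$ with $v^2=\|v\|^2$; the "real" structure on $C_0(X,\mathrm{Cl}_E)$ is induced by the conjugate-linear maps $\mathrm{Cl}_{E_x}\to\mathrm{Cl}_{E_{\mathfrak r(x)}}$ that extend the $\mathbb Z/2$-action on $E$. For $a,b\in\mathbb N$, let $\mathrm{Cl}_{a,b}$ be the complex Clifford algebra of $\mathbb R^{a+b}$, with anticommuting odd self-adjoint unitary generators $\gamma_1,\dots,\gamma_{a+b}$ and the "real" structure for which $\gamma_1,\dots,\gamma_a,i\gamma_{a+1},\dots,i\gamma_{a+b}$ are real. A *$\mathrm{KR}$-orientation* of $E$ with parameters $(a,b)$ is a $\mathbb Z/2$-graded, "real", $C_0(X)$-linear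 Morita equivalence between $C_0(X,\mathrm{Cl}_E)$ and $C_0(X)\otimes\mathrm{Cl}_{a,b}$, that is, a full Hilbert bimodule $M$ over these two $\mathrm C^*$-algebras with a compatible $\mathbb Z/2$-grading and "real" structure, such that the left and right multiplication actions of $C_0(X)$ on $M$ agree. Let $M_1$ and $M_2$ be two $\mathrm{KR}$-orientations of $E$ with the same parameters $(a,b)$. Then there is a $\mathbb Z/2$-graded "real" (Hermitian) complex line bundle $L\twoheadrightarrow X$ such that $$L\mathbin{\hat\otimes}_X M_1\cong M_2$$ as $\mathbb Z/2$-graded "real" Hilbert bimodules over $C_0(X,\mathrm{Cl}_E)$ and $C_0(X)\otimes\mathrm{Cl}_{a,b}$. Here $L\mathbin{\hat\otimes}_X M_1$ is the graded tensor product $C_0(X,L)\mathbin{\hat\otimes}_{C_0(X)}M_1$, whose left action is given by the sign rule $f\cdot(l\otimes m)=(-1)^{|f|\,|l|}\,l\otimes fm$ for homogeneous $f$ and $l$. The line bundle $L$ is unique up to isomorphism of $\mathbb Z/2$-graded "real" complex line bundles: if $L'$ is another such line bundle with $L'\mathbin{\hat\otimes}_X M_1\cong M_2$, then $L\cong L'$.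 -/

import Mathlib

noncomputable section

namespace KR

open scoped TensorProduct

section Clifford

/-- The quadratic form `v ↦ ⟪v, v⟫ = ‖v‖ ^ 2` of a Euclidean vector space. -/
abbrev normForm (V : Type*) [NormedAddCommGroup V] [InnerProductSpace ℝ V] : QuadraticForm ℝ V :=
  LinearMap.BilinMap.toQuadraticMap (innerₗ V)

/-- The complex Clifford algebra of a Euclidean vector space `V`, that is, the complexification of
the real Clifford algebra with `v ^ 2 = ‖v‖ ^ 2`. -/
def Cl (V : Type*) [NormedAddCommGroup V] [InnerProductSpace ℝ V] : Type _ :=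
  ℂ ⊗[ℝ] CliffordAlgebra (normForm V)

namespace Cl

variable {V : Type*} [NormedAddCommGroup V] [InnerProductSpace ℝ V]
  {W : Type*} [NormedAddCommGroup W] [InnerProductSpace ℝ W]

instance : Ring (Cl V) := inferInstanceAs (Ring (ℂ ⊗[ℝ] CliffordAlgebra (normForm V)))

instance : Algebra ℂ (Cl V) := inferInstanceAs (Algebra ℂ (ℂ ⊗[ℝ] CliffordAlgebra (normForm V)))

/-- The elementary tensor `z ⊗ c` in the complexified Clifford algebra. -/
def mk (z : ℂ) (c : CliffordAlgebra (normForm V)) : Cl V := z ⊗ₜ[ℝ] c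

/-- The canonical inclusion of `V` into its Clifford algebra. -/
def γ (v : V) : Cl V := mk 1 (CliffordAlgebra.ι (normForm V) v)

lemma mk_mul_mk (z w : ℂ) (c d : CliffordAlgebra (normForm V)) :
    mk z c * mk w d = mk (z * w) (c * d) := Algebra.TensorProduct.tmul_mul_tmul z w c d

lemma one_def : (1 : Cl V) = mk 1 1 := rfl

lemma algebraMap_def (z : ℂ) : algebraMap ℂ (Cl V) z = mk z 1 := rfl

lemma γ_mul_self (v : V) : γ v * γ v = algebraMap ℂ (Cl V) ((‖v‖ ^ 2 : ℝ) : ℂ) := by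
  rw [γ, mk_mul_mk, CliffordAlgebra.ι_sq_scalar, Algebra.algebraMap_eq_smul_one, algebraMap_def, mk,
    mk, TensorProduct.tmul_smul, TensorProduct.smul_tmul']
  simp
  rfl

lemma γ_anticomm {v w : V} (h : inner ℝ v w = 0) : γ v * γ w = - (γ w * γ v) := by
  have : CliffordAlgebra.ι (normForm V) v * CliffordAlgebra.ι (normForm V) w
      = - (CliffordAlgebra.ι (normForm V) w * CliffordAlgebra.ι (normForm V) v) := by
    apply CliffordAlgebra.ι_mul_ι_comm_of_isOrtho
    rw [QuadraticMap.isOrtho_def]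
    simp [inner_add_right, h, real_inner_comm v w]
  rw [γ, γ, mk_mul_mk, this, mk_mul_mk, mk, mk, TensorProduct.tmul_neg]
  rfl

@[elab_as_elim]
lemma induction {p : Cl V → Prop} (x : Cl V) (hmk : ∀ z c, p (mk z c))
    (hadd : ∀ x y, p x → p y → p (x + y)) : p x :=
  TensorProduct.induction_on (motive := p) x
    (by simpa [mk] using hmk 0 0) (fun z c => hmk z c) (fun x y => hadd x y)

/-- The isometry of quadratic forms underlying a linear isometry. -/
def isom (u : V ≃ₗᵢ[ℝ] W) : (normForm V) →qᵢ (normForm W) where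
  toLinearMap := u.toLinearEquiv.toLinearMap
  map_app' v := by simp

/-- The complex-linear algebra homomorphism of Clifford algebras induced by an isometry. -/
def map (u : V ≃ₗᵢ[ℝ] W) : Cl V →ₐ[ℂ] Cl W :=
  Algebra.TensorProduct.map (AlgHom.id ℂ ℂ) (CliffordAlgebra.map (isom u))

/-- The conjugate-linear ring homomorphism of Clifford algebras induced by an isometry. -/
def conjMap (u : V ≃ₗᵢ[ℝ] W) : Cl V →+* Cl W :=
  (Algebra.TensorProduct.map (Complex.conjAe : ℂ →ₐ[ℝ] ℂ)
    (CliffordAlgebra.map (isom u))).toRingHom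

/-- The grading automorphism of the Clifford algebra: `γ v ↦ - γ v`. -/
def grade : Cl V →ₐ[ℂ] Cl V :=
  Algebra.TensorProduct.map (AlgHom.id ℂ ℂ) (CliffordAlgebra.involute)

lemma map_mk (u : V ≃ₗᵢ[ℝ] W) (z : ℂ) (c) :
    map u (mk z c) = mk z (CliffordAlgebra.map (isom u) c) := rfl

lemma conjMap_mk (u : V ≃ₗᵢ[ℝ] W) (z : ℂ) (c) :
    conjMap u (mk z c) = mk (starRingEnd ℂ z) (CliffordAlgebra.map (isom u) c) := rfl

lemma grade_mk (z : ℂ) (c : CliffordAlgebra (normForm V)) :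
    grade (mk z c) = mk z (CliffordAlgebra.involute c) := rfl

lemma map_γ (u : V ≃ₗᵢ[ℝ] W) (v : V) : map u (γ v) = γ (u v) := by
  rw [γ, map_mk, CliffordAlgebra.map_apply_ι]; rfl

lemma conjMap_γ (u : V ≃ₗᵢ[ℝ] W) (v : V) : conjMap u (γ v) = γ (u v) := by
  rw [γ, conjMap_mk, CliffordAlgebra.map_apply_ι, map_one]; rfl

lemma grade_γ (v : V) : grade (γ v) = - γ v := by
  rw [γ, grade_mk, CliffordAlgebra.involute_ι, mk, mk, TensorProduct.tmul_neg]
  rfl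

lemma conjMap_smul (u : V ≃ₗᵢ[ℝ] W) (z : ℂ) (x : Cl V) :
    conjMap u (z • x) = starRingEnd ℂ z • conjMap u x := by
  rw [Algebra.smul_def, map_mul, algebraMap_def, conjMap_mk, map_one, ← algebraMap_def,
    ← Algebra.smul_def]

/-- The involution: the conjugate-linear antiautomorphism with `star (γ v) = γ v`. -/
instance : Star (Cl V) :=
  ⟨fun x => TensorProduct.map (Complex.conjAe.toLinearMap : ℂ →ₗ[ℝ] ℂ)
    (CliffordAlgebra.reverse (Q := normForm V)) x⟩

lemma star_mk (z : ℂ) (c : CliffordAlgebra (normForm V)) :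
    star (mk z c) = mk (starRingEnd ℂ z) (CliffordAlgebra.reverse c) := rfl

lemma star_add' (x y : Cl V) : star (x + y) = star x + star y :=
  (TensorProduct.map (Complex.conjAe.toLinearMap : ℂ →ₗ[ℝ] ℂ)
    (CliffordAlgebra.reverse (Q := normForm V))).map_add x y

instance : StarRing (Cl V) where
  star_involutive x := by
    induction x using Cl.induction with
    | hmk z c => simp [star_mk]
    | hadd x y hx hy => rw [star_add', star_add', hx, hy]
  star_mul x y := by
    induction x using Cl.induction with
    | hadd x x' hx hx' => rw [add_mul, star_add', hx, hx', star_add', mul_add]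
    | hmk z c =>
      induction y using Cl.induction with
      | hadd y y' hy hy' => rw [mul_add, star_add', hy, hy', star_add', add_mul]
      | hmk w d =>
        rw [mk_mul_mk, star_mk, star_mk, star_mk, mk_mul_mk, map_mul,
          CliffordAlgebra.reverse.map_mul, mul_comm]
  star_add := star_add'

instance : StarModule ℂ (Cl V) where
  star_smul z x := by
    rw [Algebra.smul_def, star_mul, algebraMap_def, star_mk, CliffordAlgebra.reverse.map_one,
      ← algebraMap_def, ← Algebra.commutes, ← Algebra.smul_def]
    rfl

@[simp] lemma star_γ (v : V) : star (γ v) = γ v := by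
  rw [γ, star_mk, CliffordAlgebra.reverse_ι, map_one]

lemma adjoin_γ : Algebra.adjoin ℂ (Set.range (γ : V → Cl V)) = ⊤ := by
  rw [eq_top_iff]
  rintro x -
  induction x using Cl.induction with
  | hadd x y hx hy => exact add_mem hx hy
  | hmk z c =>
    have h1 : ∀ c : CliffordAlgebra (normForm V),
        mk 1 c ∈ Algebra.adjoin ℂ (Set.range (γ : V → Cl V)) := by
      intro c
      induction c using CliffordAlgebra.induction with
      | algebraMap r =>
        have : mk 1 (algebraMap ℝ (CliffordAlgebra (normForm V)) r)
            = algebraMap ℂ (Cl V) (r : ℂ) := by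
          rw [Algebra.algebraMap_eq_smul_one, algebraMap_def, mk, mk, TensorProduct.tmul_smul,
            TensorProduct.smul_tmul']
          simp
          rfl
        rw [this]
        exact Subalgebra.algebraMap_mem _ _
      | ι v => exact Algebra.subset_adjoin ⟨v, rfl⟩
      | mul a b ha hb => simpa [mk_mul_mk] using mul_mem ha hb
      | add a b ha hb =>
        have : mk 1 (a + b) = mk 1 a + mk 1 b := TensorProduct.tmul_add _ _ _
        rw [this]; exact add_mem ha hb
    have : mk z c = z • mk 1 c := by
      rw [Algebra.smul_def, algebraMap_def, mk_mul_mk, mul_one, one_mul]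
    rw [this]
    exact Subalgebra.smul_mem _ (h1 c) z

@[ext]
lemma algHom_ext {A : Type*} [Semiring A] [Algebra ℂ A] {f g : Cl V →ₐ[ℂ] A}
    (h : ∀ v, f (γ v) = g (γ v)) : f = g :=
  AlgHom.ext_of_adjoin_eq_top adjoin_γ (by rintro _ ⟨v, rfl⟩; exact h v)

lemma map_star (u : V ≃ₗᵢ[ℝ] W) (x : Cl V) : map u (star x) = star (map u x) := by
  induction x using Cl.induction with
  | hadd x y hx hy => simp [hx, hy]
  | hmk z c =>
    rw [star_mk, map_mk, map_mk, star_mk]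
    congr 1
    induction c using CliffordAlgebra.induction with
    | algebraMap r => simp
    | ι v => simp
    | mul a b ha hb => simp [ha, hb]
    | add a b ha hb => simp [ha, hb]

lemma map_refl : map (LinearIsometryEquiv.refl ℝ V) = AlgHom.id ℂ (Cl V) := by
  ext v; simp [map_γ]

lemma map_trans {U : Type*} [NormedAddCommGroup U] [InnerProductSpace ℝ U]
    (u : V ≃ₗᵢ[ℝ] W) (w : W ≃ₗᵢ[ℝ] U) : (map w).comp (map u) = map (u.trans w) := by
  ext v; simp [map_γ]

lemma map_map {U : Type*} [NormedAddCommGroup U] [InnerProductSpace ℝ U]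
    (u : V ≃ₗᵢ[ℝ] W) (w : W ≃ₗᵢ[ℝ] U) (x : Cl V) : map w (map u x) = map (u.trans w) x := by
  rw [← map_trans]; rfl

/-- The isomorphism of Clifford algebras induced by an isometry. -/
def mapEquiv (u : V ≃ₗᵢ[ℝ] W) : Cl V ≃ₐ[ℂ] Cl W :=
  AlgEquiv.ofAlgHom (map u) (map u.symm) (by rw [map_trans]; simp [map_refl])
    (by rw [map_trans]; simp [map_refl])

/-! ### The C⋆-norm -/

section Gen

variable {ι : Type*} [DecidableEq ι] {e : ι → V}

/-- The subalgebra generated by the vectors `e i`, `i ∈ s`. -/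
def gen (e : ι → V) (s : Finset ι) : Subalgebra ℂ (Cl V) :=
  Algebra.adjoin ℂ ((fun i => γ (e i)) '' (s : Set ι))

lemma gen_mono {s t : Finset ι} (h : s ⊆ t) : gen e s ≤ gen e t :=
  Algebra.adjoin_mono (Set.image_mono (by simpa using h))

lemma γ_mem_gen {s : Finset ι} {i : ι} (h : i ∈ s) : γ (e i) ∈ gen e s :=
  Algebra.subset_adjoin ⟨i, by simpa using h, rfl⟩

lemma star_mem_gen {s : Finset ι} {x : Cl V} (hx : x ∈ gen e s) : star x ∈ gen e s := by
  induction hx using Algebra.adjoin_induction with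
  | mem x hx =>
    obtain ⟨i, hi, rfl⟩ := hx
    rw [star_γ]; exact γ_mem_gen (by simpa using hi)
  | algebraMap r =>
    rw [← algebraMap_star_comm]; exact Subalgebra.algebraMap_mem _ _
  | add x y _ _ hx hy => rw [star_add]; exact add_mem hx hy
  | mul x y _ _ hx hy => rw [star_mul]; exact mul_mem hy hx

lemma grade_mem_gen {s : Finset ι} {x : Cl V} (hx : x ∈ gen e s) : grade x ∈ gen e s := by
  induction hx using Algebra.adjoin_induction with
  | mem x hx =>
    obtain ⟨i, hi, rfl⟩ := hx
    rw [grade_γ]; exact neg_mem (γ_mem_gen (by simpa using hi))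
  | algebraMap r => rw [AlgHom.commutes]; exact Subalgebra.algebraMap_mem _ _
  | add x y _ _ hx hy => rw [map_add]; exact add_mem hx hy
  | mul x y _ _ hx hy => rw [map_mul]; exact mul_mem hx hy

lemma gen_mul_γ {s : Finset ι} {v : V} (hv : ∀ i ∈ s, inner ℝ v (e i) = 0) {x : Cl V}
    (hx : x ∈ gen e s) : x * γ v = γ v * grade x := by
  induction hx using Algebra.adjoin_induction with
  | mem x hx =>
    obtain ⟨i, hi, rfl⟩ := hx
    rw [grade_γ, mul_neg, γ_anticomm (hv i (by simpa using hi)), neg_neg]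
  | algebraMap r => rw [AlgHom.commutes, Algebra.commutes]
  | add x y _ _ hx hy => rw [map_add, add_mul, mul_add, hx, hy]
  | mul x y _ _ hx hy => rw [map_mul, mul_assoc, hy, ← mul_assoc, hx, mul_assoc]

lemma exists_of_mem_gen_insert (he : Orthonormal ℝ e) {s : Finset ι} {k : ι} (hk : k ∉ s)
    {x : Cl V} (hx : x ∈ gen e (insert k s)) :
    ∃ a ∈ gen e s, ∃ b ∈ gen e s, x = a + γ (e k) * b := by
  have ho : ∀ i ∈ s, inner ℝ (e k) (e i) = 0 := fun i hi =>
    he.2 (by rintro rfl; exact hk hi)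
  have hsq : γ (e k) * γ (e k) = 1 := by rw [γ_mul_self, he.1 k]; simp
  induction hx using Algebra.adjoin_induction with
  | mem x hx =>
    obtain ⟨i, hi, rfl⟩ := hx
    rcases Finset.mem_insert.1 (by simpa using hi) with rfl | hi
    · exact ⟨0, zero_mem _, 1, one_mem _, by simp⟩
    · exact ⟨_, γ_mem_gen hi, 0, zero_mem _, by simp⟩
  | algebraMap r => exact ⟨_, Subalgebra.algebraMap_mem _ r, 0, zero_mem _, by simp⟩
  | add x y _ _ hx hy =>
    obtain ⟨a, ha, b, hb, rfl⟩ := hx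
    obtain ⟨c, hc, d, hd, rfl⟩ := hy
    exact ⟨a + c, add_mem ha hc, b + d, add_mem hb hd, by rw [mul_add]; abel⟩
  | mul x y _ _ hx hy =>
    obtain ⟨a, ha, b, hb, rfl⟩ := hx
    obtain ⟨c, hc, d, hd, rfl⟩ := hy
    refine ⟨a * c + grade b * d, add_mem (mul_mem ha hc) (mul_mem (grade_mem_gen hb) hd),
      grade a * d + b * c, add_mem (mul_mem (grade_mem_gen ha) hd) (mul_mem hb hc), ?_⟩
    have h1 : a * (γ (e k) * d) = γ (e k) * (grade a * d) := by
      rw [← mul_assoc, gen_mul_γ ho ha, mul_assoc]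
    have h2 : γ (e k) * b * (γ (e k) * d) = grade b * d := by
      rw [mul_assoc, ← mul_assoc b, gen_mul_γ ho hb, mul_assoc, ← mul_assoc, hsq, one_mul]
    rw [add_mul, mul_add, mul_add, h1, h2, mul_add]
    rw [mul_assoc]; abel

lemma gen_empty {x : Cl V} (hx : x ∈ gen e ∅) : ∃ z : ℂ, x = algebraMap ℂ (Cl V) z := by
  simp only [gen, Finset.coe_empty, Set.image_empty, Algebra.adjoin_empty] at hx
  obtain ⟨z, rfl⟩ := Algebra.mem_bot.1 hx
  exact ⟨z, rfl⟩

lemma finite_gen (he : Orthonormal ℝ e) (s : Finset ι) :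
    (Subalgebra.toSubmodule (gen e s)).FG := by
  induction s using Finset.induction_on with
  | empty =>
    simp only [gen, Finset.coe_empty, Set.image_empty, Algebra.adjoin_empty]
    exact Subalgebra.fg_bot_toSubmodule
  | insert k s hk ih =>
    have : Subalgebra.toSubmodule (gen e (insert k s)) ≤ Subalgebra.toSubmodule (gen e s) ⊔
        (Subalgebra.toSubmodule (gen e s)).map (LinearMap.mulLeft ℂ (γ (e k))) := by
      intro x hx
      obtain ⟨a, ha, b, hb, rfl⟩ := exists_of_mem_gen_insert he hk hx
      exact Submodule.add_mem_sup ha ⟨b, hb, rfl⟩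
    exact Submodule.FG.of_le (ih.sup (ih.map _)) this

end Gen

section FiniteDim

variable [FiniteDimensional ℝ V]

lemma gen_basis_univ :
    gen (stdOrthonormalBasis ℝ V) (Finset.univ) = (⊤ : Subalgebra ℂ (Cl V)) := by
  rw [← adjoin_γ, eq_comm]
  apply le_antisymm
  · rw [Algebra.adjoin_le_iff]
    rintro _ ⟨v, rfl⟩
    have hlin : γ v = ∑ i, ((stdOrthonormalBasis ℝ V).repr v i : ℂ) •
        γ (stdOrthonormalBasis ℝ V i) := by
      have hγ : ∀ (c : ℝ) (w : V), γ (c • w) = (c : ℂ) • γ w := by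
        intro c w
        rw [Algebra.smul_def, algebraMap_def, γ, γ, mk_mul_mk, map_smul, mk, mk,
          TensorProduct.tmul_smul, TensorProduct.smul_tmul']
        simp
        rfl
      have hs : ∀ (f : Fin (Module.finrank ℝ V) → V), γ (∑ i, f i) = ∑ i, γ (f i) := fun f => by
        let g : V →+ Cl V :=
          { toFun := γ
            map_zero' := by rw [γ, map_zero, mk, TensorProduct.tmul_zero]; rfl
            map_add' := fun a b => by
              rw [γ, map_add, mk, TensorProduct.tmul_add]; rfl }
        exact map_sum g f _
      conv_lhs => rw [← (stdOrthonormalBasis ℝ V).sum_repr v]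
      rw [hs]
      simp [hγ]
    rw [hlin]
    exact sum_mem fun i _ => Subalgebra.smul_mem _ (γ_mem_gen (by simp)) _
  · refine Algebra.adjoin_mono ?_
    rintro _ ⟨i, -, rfl⟩
    exact ⟨_, rfl⟩

instance : Module.Finite ℂ (Cl V) := by
  constructor
  have := finite_gen (stdOrthonormalBasis ℝ V).orthonormal Finset.univ
  rwa [gen_basis_univ, Algebra.top_toSubmodule] at this

instance : Nontrivial (Cl V) := by
  have : Function.Injective (algebraMap ℂ (Cl V)) := by
    let f : Cl V →ₐ[ℂ] ℂ ⊗[ℝ] CliffordAlgebra (normForm V) := AlgHom.id ℂ _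
    have h := Algebra.TensorProduct.includeLeft_injective (S := ℂ) (R := ℝ) (A := ℂ)
      (B := CliffordAlgebra (normForm V)) (FaithfulSMul.algebraMap_injective ℝ (CliffordAlgebra (normForm V)))
    exact h
  exact this.nontrivial

/-- The normalised trace of left multiplication. -/
def tr : Cl V →ₗ[ℂ] ℂ :=
  (Module.finrank ℂ (Cl V) : ℂ)⁻¹ • LinearMap.trace ℂ (Cl V) ∘ₗ LinearMap.mul ℂ (Cl V)

lemma tr_apply (x : Cl V) : tr x = (Module.finrank ℂ (Cl V) : ℂ)⁻¹ *
    LinearMap.trace ℂ (Cl V) (LinearMap.mulLeft ℂ x) := rfl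

lemma tr_mul_comm (x y : Cl V) : tr (x * y) = tr (y * x) := by
  rw [tr_apply, tr_apply, LinearMap.mulLeft_mul, LinearMap.mulLeft_mul]
  rw [← Module.End.mul_eq_comp, ← Module.End.mul_eq_comp, LinearMap.trace_mul_comm]

lemma tr_algebraMap (z : ℂ) : tr (algebraMap ℂ (Cl V) z) = z := by
  have h : LinearMap.mulLeft ℂ (algebraMap ℂ (Cl V) z) = z • LinearMap.id := by
    ext x; simp [Algebra.smul_def]
  have h0 : (Module.finrank ℂ (Cl V) : ℂ) ≠ 0 := by
    exact_mod_cast (Module.finrank_pos).ne'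
  rw [tr_apply, h, map_smul, LinearMap.trace_id, smul_eq_mul]
  field_simp

lemma tr_mapEquiv (u : V ≃ₗᵢ[ℝ] V) (x : Cl V) : tr (map u x) = tr x := by
  have h : LinearMap.mulLeft ℂ (map u x) =
      (mapEquiv u).toLinearEquiv.conj (LinearMap.mulLeft ℂ x) := by
    ext y
    have h1 : (mapEquiv u).toLinearEquiv.conj (LinearMap.mulLeft ℂ x) y =
      map u (x * map u.symm y) := rfl
    have h2 : map u (map u.symm y) = y := (mapEquiv u).apply_symm_apply y
    rw [h1, map_mul, h2]; rfl
  rw [tr_apply, tr_apply, h, LinearMap.trace_conj']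

lemma tr_γ_mul {ι : Type*} [DecidableEq ι] {e : ι → V} {s : Finset ι} {v : V}
    (hv : ∀ i ∈ s, inner ℝ v (e i) = 0) {x : Cl V} (hx : x ∈ gen e s) : tr (γ v * x) = 0 := by
  let u : V ≃ₗᵢ[ℝ] V := (ℝ ∙ v)ᗮ.reflection
  have huv : u v = - v := Submodule.reflection_orthogonalComplement_singleton_eq_neg v
  have hx' : map u x = x := by
    induction hx using Algebra.adjoin_induction with
    | mem x hx =>
      obtain ⟨i, hi, rfl⟩ := hx
      rw [map_γ]
      congr 1
      exact Submodule.reflection_mem_subspace_eq_self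
        (Submodule.mem_orthogonal_singleton_iff_inner_right.2 (hv i (by simpa using hi)))
    | algebraMap r => simp
    | add x y _ _ hx hy => rw [map_add, hx, hy]
    | mul x y _ _ hx hy => rw [map_mul, hx, hy]
  have hneg : γ (-v) = - γ v := by
    rw [γ, map_neg, mk, TensorProduct.tmul_neg]; rfl
  have h := tr_mapEquiv u (γ v * x)
  rw [map_mul, map_γ, huv, hx', hneg, neg_mul, map_neg] at h
  exact self_eq_neg.1 h.symm

lemma tr_star (x : Cl V) : tr (star x) = starRingEnd ℂ (tr x) := by
  let e := stdOrthonormalBasis ℝ V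
  have key : ∀ s : Finset (Fin (Module.finrank ℝ V)), ∀ x ∈ gen e s,
      tr (star x) = starRingEnd ℂ (tr x) := by
    intro s
    induction s using Finset.induction_on with
    | empty =>
      intro x hx
      obtain ⟨z, rfl⟩ := gen_empty hx
      rw [← algebraMap_star_comm, tr_algebraMap, tr_algebraMap]; rfl
    | insert k s hk ih =>
      intro x hx
      obtain ⟨a, ha, b, hb, rfl⟩ := exists_of_mem_gen_insert e.orthonormal hk hx
      have ho : ∀ i ∈ s, inner ℝ (e k) (e i) = 0 := fun i hi =>
        e.orthonormal.2 (by rintro rfl; exact hk hi)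
      rw [star_add, star_mul, star_γ, map_add, map_add, map_add, ih a ha, tr_mul_comm,
        tr_γ_mul ho hb, tr_γ_mul ho (star_mem_gen hb), map_zero]
  exact key Finset.univ x (by rw [gen_basis_univ]; trivial)

open scoped ComplexOrder in
lemma tr_star_mul_self_pos {x : Cl V} (hx : x ≠ 0) : 0 < tr (star x * x) := by
  let e := stdOrthonormalBasis ℝ V
  have key : ∀ s : Finset (Fin (Module.finrank ℝ V)), ∀ x ∈ gen e s, x ≠ 0 →
      0 < tr (star x * x) := by
    intro s
    induction s using Finset.induction_on with
    | empty =>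
      intro x hx h0
      obtain ⟨z, rfl⟩ := gen_empty hx
      have hz : z ≠ 0 := by rintro rfl; simp at h0
      rw [← algebraMap_star_comm, ← map_mul, tr_algebraMap]
      exact star_mul_self_pos (IsRegular.of_ne_zero hz)
    | insert k s hk ih =>
      intro x hx h0
      obtain ⟨a, ha, b, hb, rfl⟩ := exists_of_mem_gen_insert e.orthonormal hk hx
      have ho : ∀ i ∈ s, inner ℝ (e k) (e i) = 0 := fun i hi =>
        e.orthonormal.2 (by rintro rfl; exact hk hi)
      have hsq : γ (e k) * γ (e k) = 1 := by rw [γ_mul_self, e.orthonormal.1 k]; simp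
      have hb2 : star b * γ (e k) * (γ (e k) * b) = star b * b := by
        rw [mul_assoc, ← mul_assoc (γ (e k)), hsq, one_mul]
      have h1 : tr (star a * (γ (e k) * b)) = 0 := by
        rw [tr_mul_comm, mul_assoc]; exact tr_γ_mul ho (mul_mem hb (star_mem_gen ha))
      have h2 : tr (star b * γ (e k) * a) = 0 := by
        rw [mul_assoc, tr_mul_comm, mul_assoc]
        exact tr_γ_mul ho (mul_mem ha (star_mem_gen hb))
      have hn : ∀ y ∈ gen e s, 0 ≤ tr (star y * y) := fun y hy => by
        by_cases h : y = 0
        · simp [h]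
        · exact (ih y hy h).le
      rw [star_add, star_mul, star_γ, add_mul, mul_add, mul_add, map_add, map_add, map_add, hb2,
        h1, h2, add_zero, zero_add]
      by_cases h : a = 0
      · have hb0 : b ≠ 0 := by rintro rfl; simp [h] at h0
        exact add_pos_of_nonneg_of_pos (hn a ha) (ih b hb hb0)
      · exact add_pos_of_pos_of_nonneg (ih a ha h) (hn b hb)
  exact key Finset.univ x (by rw [gen_basis_univ]; trivial) hx

variable (V) in
/-- The Clifford algebra as a Hilbert space with the inner product `⟪x, y⟫ = tr (star x * y)`. -/
def Hilb : Type _ := Cl V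

instance : AddCommGroup (Hilb V) := inferInstanceAs (AddCommGroup (Cl V))
instance : Module ℂ (Hilb V) := inferInstanceAs (Module ℂ (Cl V))

/-- The identity map. -/
def toHilb : Cl V ≃ₗ[ℂ] Hilb V := LinearEquiv.refl ℂ (Cl V)

instance : Module.Finite ℂ (Hilb V) := Module.Finite.equiv toHilb

open scoped ComplexOrder in
variable (V) in
/-- The trace inner product. -/
@[reducible] def hilbCore : InnerProductSpace.Core ℂ (Hilb V) where
  inner x y := tr (star (toHilb.symm x) * toHilb.symm y)
  conj_inner_symm x y := by
    rw [← tr_star, star_mul, star_star]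
  re_inner_nonneg x := by
    by_cases h : toHilb.symm x = 0
    · simp [h]
    · exact (Complex.pos_iff.1 (tr_star_mul_self_pos h)).1.le
  add_left x y z := by
    rw [map_add, star_add, add_mul, map_add]
  smul_left x y z := by
    rw [map_smul, star_smul, smul_mul_assoc, map_smul]; rfl
  definite x h := by
    by_contra h0
    have h0' : toHilb.symm x ≠ 0 := by simpa using h0
    exact (tr_star_mul_self_pos h0').ne' h

instance : NormedAddCommGroup (Hilb V) := (hilbCore V).toNormedAddCommGroup
instance : InnerProductSpace ℂ (Hilb V) := InnerProductSpace.ofCore (hilbCore V).toCore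
instance : CompleteSpace (Hilb V) := FiniteDimensional.complete ℂ _

lemma inner_hilb (x y : Hilb V) : inner ℂ x y = tr (star (toHilb.symm x) * toHilb.symm y) := rfl

/-- The left regular representation of the Clifford algebra on its Hilbert space. -/
def leftReg : Cl V →ₐ[ℂ] (Hilb V →L[ℂ] Hilb V) :=
  AlgHom.ofLinearMap
    ((LinearMap.toContinuousLinearMap : (Hilb V →ₗ[ℂ] Hilb V) ≃ₗ[ℂ] _).toLinearMap ∘ₗ
      (toHilb (V := V)).conj.toLinearMap ∘ₗ LinearMap.mul ℂ (Cl V))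
    (by ext x; simp [LinearEquiv.conj_apply])
    (fun x y => by ext z; simp [LinearEquiv.conj_apply, mul_assoc])

lemma leftReg_apply (x : Cl V) (y : Hilb V) : leftReg x y = toHilb (x * toHilb.symm y) := rfl

lemma leftReg_injective : Function.Injective (leftReg (V := V)) := fun x y h => by
  have := congrArg (fun f => f (toHilb (1 : Cl V))) h
  simpa [leftReg_apply] using this

lemma leftReg_star (x : Cl V) : leftReg (star x) = star (leftReg x) := by
  rw [ContinuousLinearMap.star_eq_adjoint, ContinuousLinearMap.eq_adjoint_iff]
  intro a b
  simp [leftReg_apply, inner_hilb, mul_assoc]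

/-- The C⋆-norm on the Clifford algebra: the operator norm in the left regular representation. -/
instance : NormedRing (Cl V) :=
  NormedRing.induced (Cl V) (Hilb V →L[ℂ] Hilb V) leftReg leftReg_injective

lemma norm_def (x : Cl V) : ‖x‖ = ‖leftReg x‖ := rfl

instance : NormedAlgebra ℂ (Cl V) where
  norm_smul_le z x := by rw [norm_def, norm_def, map_smul]; exact norm_smul_le z (leftReg x)

instance : CStarRing (Cl V) where
  norm_mul_self_le x := by
    rw [norm_def, norm_def, map_mul, leftReg_star]
    exact CStarRing.norm_mul_self_le (leftReg x)

instance : CompleteSpace (Cl V) := FiniteDimensional.complete ℂ _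

instance : CStarAlgebra (Cl V) where


/-! ### Isometries induce isometries -/

variable [FiniteDimensional ℝ W]

lemma norm_map (u : V ≃ₗᵢ[ℝ] W) (x : Cl V) : ‖map u x‖ = ‖x‖ := by
  let φ : Cl V →⋆ₐ[ℂ] Cl W := { map u with map_star' := map_star u }
  exact NonUnitalStarAlgHom.norm_map φ (mapEquiv u).injective x

lemma conjMap_conjMap {U : Type*} [NormedAddCommGroup U] [InnerProductSpace ℝ U]
    (u : V ≃ₗᵢ[ℝ] W) (w : W ≃ₗᵢ[ℝ] U) (x : Cl V) :
    conjMap w (conjMap u x) = map (u.trans w) x := by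
  induction x using Cl.induction with
  | hadd x y hx hy => simp [hx, hy]
  | hmk z c =>
    rw [conjMap_mk, conjMap_mk, ← map_map, map_mk, map_mk, Complex.conj_conj]

lemma conjMap_map {U : Type*} [NormedAddCommGroup U] [InnerProductSpace ℝ U]
    (u : V ≃ₗᵢ[ℝ] W) (w : W ≃ₗᵢ[ℝ] U) (x : Cl V) :
    conjMap w (map u x) = conjMap (u.trans w) x := by
  induction x using Cl.induction with
  | hadd x y hx hy => simp [hx, hy]
  | hmk z c => rw [map_mk, conjMap_mk, conjMap_mk, ← map_mk (u.trans w), ← map_map, map_mk, map_mk]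

lemma map_conjMap {U : Type*} [NormedAddCommGroup U] [InnerProductSpace ℝ U]
    (u : V ≃ₗᵢ[ℝ] W) (w : W ≃ₗᵢ[ℝ] U) (x : Cl V) :
    map w (conjMap u x) = conjMap (u.trans w) x := by
  have h : conjMap u x = conjMap (LinearIsometryEquiv.refl ℝ W) (map u x) := by
    induction x using Cl.induction with
    | hadd x y hx hy => simp [hx, hy]
    | hmk z c =>
      rw [conjMap_mk, map_mk, conjMap_mk, ← map_mk, ← map_mk, ← map_mk, map_refl]; rfl
  have h'' : ∀ y : Cl W, map w (conjMap (LinearIsometryEquiv.refl ℝ W) y) = conjMap w y := by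
    intro y
    induction y using Cl.induction with
    | hadd x y hx hy => simp [hx, hy]
    | hmk z c => rw [conjMap_mk, conjMap_mk, ← map_mk, map_refl, AlgHom.id_apply, map_mk]
  rw [h, h'', conjMap_map]

lemma conjMap_star (u : V ≃ₗᵢ[ℝ] W) (x : Cl V) : conjMap u (star x) = star (conjMap u x) := by
  have h : ∀ y : Cl V, conjMap u y = map u (conjMap (LinearIsometryEquiv.refl ℝ V) y) := by
    intro y; rw [map_conjMap]; congr 1
  have h' : ∀ y : Cl V, conjMap (LinearIsometryEquiv.refl ℝ V) (star y) =
      star (conjMap (LinearIsometryEquiv.refl ℝ V) y) := by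
    intro y
    induction y using Cl.induction with
    | hadd x y hx hy => simp [hx, hy]
    | hmk z c =>
      have h0 : ∀ (z : ℂ) (c : CliffordAlgebra (normForm V)),
          conjMap (LinearIsometryEquiv.refl ℝ V) (mk z c) = mk (starRingEnd ℂ z) c := by
        intro z c; rw [conjMap_mk, ← map_mk, map_refl]; rfl
      rw [star_mk, h0, h0, star_mk]
  rw [h, h, h', map_star]

lemma tr_conjMap (u : V ≃ₗᵢ[ℝ] W) (x : Cl V) : tr (conjMap u x) = starRingEnd ℂ (tr x) := by
  let e := stdOrthonormalBasis ℝ V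
  have hmem : ∀ s : Finset (Fin (Module.finrank ℝ V)), ∀ x ∈ gen e s,
      conjMap u x ∈ gen (fun i => u (e i)) s := by
    intro s x hx
    induction hx using Algebra.adjoin_induction with
    | mem x hx =>
      obtain ⟨i, hi, rfl⟩ := hx
      rw [conjMap_γ]; exact γ_mem_gen (e := fun i => u (e i)) (by simpa using hi)
    | algebraMap r =>
      rw [Algebra.algebraMap_eq_smul_one, conjMap_smul, map_one]
      exact Subalgebra.smul_mem _ (one_mem _) _
    | add x y _ _ hx hy => rw [map_add]; exact add_mem hx hy
    | mul x y _ _ hx hy => rw [map_mul]; exact mul_mem hx hy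
  have key : ∀ s : Finset (Fin (Module.finrank ℝ V)), ∀ x ∈ gen e s,
      tr (conjMap u x) = starRingEnd ℂ (tr x) := by
    intro s
    induction s using Finset.induction_on with
    | empty =>
      intro x hx
      obtain ⟨z, rfl⟩ := gen_empty hx
      rw [Algebra.algebraMap_eq_smul_one, conjMap_smul, map_one, ← Algebra.algebraMap_eq_smul_one,
        ← Algebra.algebraMap_eq_smul_one, tr_algebraMap, tr_algebraMap]
    | insert k s hk ih =>
      intro x hx
      obtain ⟨a, ha, b, hb, rfl⟩ := exists_of_mem_gen_insert e.orthonormal hk hx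
      have ho : ∀ i ∈ s, inner ℝ (e k) (e i) = 0 := fun i hi =>
        e.orthonormal.2 (by rintro rfl; exact hk hi)
      have ho' : ∀ i ∈ s, inner ℝ (u (e k)) (u (e i)) = 0 := fun i hi => by
        rw [u.inner_map_map]; exact ho i hi
      rw [map_add, map_mul, conjMap_γ, map_add, map_add, map_add, ih a ha,
        tr_γ_mul ho' (hmem s b hb), tr_γ_mul ho hb, map_zero]
  exact key Finset.univ x (by rw [gen_basis_univ]; trivial)

lemma norm_conjMap_le (u : V ≃ₗᵢ[ℝ] W) (x : Cl V) : ‖conjMap u x‖ ≤ ‖x‖ := by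
  have hn : ∀ y : Cl V, ‖toHilb (conjMap u y)‖ = ‖toHilb y‖ := by
    intro y
    have h2 : ‖toHilb (conjMap u y)‖ ^ 2 = (tr (star (conjMap u y) * conjMap u y)).re := by
      rw [← inner_self_eq_norm_sq (𝕜 := ℂ)]; rfl
    have h1 : ‖toHilb y‖ ^ 2 = (tr (star y * y)).re := by
      rw [← inner_self_eq_norm_sq (𝕜 := ℂ)]; rfl
    rw [← conjMap_star, ← map_mul, tr_conjMap, Complex.conj_re, ← h1] at h2
    exact (sq_eq_sq₀ (norm_nonneg _) (norm_nonneg _)).1 h2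
  rw [norm_def, norm_def]
  refine ContinuousLinearMap.opNorm_le_bound _ (norm_nonneg _) fun η => ?_
  obtain ⟨y, rfl⟩ : ∃ y : Cl V, toHilb (conjMap u y) = η :=
    ⟨conjMap u.symm (toHilb.symm η), by rw [conjMap_conjMap]; simp [map_refl]⟩
  rw [leftReg_apply, LinearEquiv.symm_apply_apply, ← map_mul, hn, hn]
  exact (leftReg x).le_opNorm (toHilb y)

lemma continuous_conjMap (u : V ≃ₗᵢ[ℝ] W) : Continuous (conjMap u : Cl V → Cl W) :=
  AddMonoidHomClass.continuous_of_bound (conjMap u) 1 (by simpa using norm_conjMap_le u)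

lemma grade_star (x : Cl V) : grade (star x) = star (grade x) := by
  induction x using Cl.induction with
  | hadd x y hx hy => simp [hx, hy]
  | hmk z c =>
    rw [star_mk, grade_mk, grade_mk, star_mk, CliffordAlgebra.reverse_involute]

lemma grade_grade (x : Cl V) : grade (grade x) = x := by
  induction x using Cl.induction with
  | hadd x y hx hy => simp [hx, hy]
  | hmk z c => rw [grade_mk, grade_mk, CliffordAlgebra.involute_involute]

lemma grade_map (u : V ≃ₗᵢ[ℝ] W) (x : Cl V) : grade (map u x) = map u (grade x) := by
  have : grade.comp (map u) = (map u).comp grade := by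
    ext v; simp only [AlgHom.comp_apply, map_γ, grade_γ, _root_.map_neg]
  exact congrArg (fun f => f x) this

lemma norm_grade (x : Cl V) : ‖grade x‖ = ‖x‖ := by
  let φ : Cl V →⋆ₐ[ℂ] Cl V := { grade with map_star' := grade_star }
  exact NonUnitalStarAlgHom.norm_map φ (Function.LeftInverse.injective grade_grade) x

end FiniteDim

end Cl
end Clifford
section Bundles

open Bundle Filter Topology

variable (𝕜 : Type*) [RCLike 𝕜] {X : Type*} [TopologicalSpace X]

section

variable (V : X → Type*) [∀ x, NormedAddCommGroup (V x)] [∀ x, InnerProductSpace 𝕜 (V x)]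
  [TopologicalSpace (TotalSpace Unit V)]

/-- A local trivialisation, isometric on the fibres, of a family of inner product spaces `V x` with
a topology on the total space (the argument `Unit` of `TotalSpace` plays no role). -/
structure IsometricTriv (n : ℕ) where
  baseSet : Set X
  isOpen_baseSet : IsOpen baseSet
  coord : ∀ x : baseSet, V x ≃ₗᵢ[𝕜] EuclideanSpace 𝕜 (Fin n)
  continuous_coord :
    Continuous fun p : {p : TotalSpace Unit V // p.proj ∈ baseSet} => coord ⟨p.1.proj, p.2⟩ p.1.snd
  continuous_coord_symm :
    Continuous fun q : baseSet × EuclideanSpace 𝕜 (Fin n) =>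
      (⟨q.1, (coord q.1).symm q.2⟩ : TotalSpace Unit V)

/-- `V` is a locally trivial vector bundle of finite (locally constant) rank with a continuous inner
product on the fibres. By the Gram-Schmidt process, such a bundle is locally isometrically
trivial. -/
class IsMetricBundle : Prop where
  continuous_proj : Continuous (TotalSpace.proj : TotalSpace Unit V → X)
  exists_triv : ∀ x : X, ∃ (n : ℕ) (e : IsometricTriv 𝕜 V n), x ∈ e.baseSet

instance IsMetricBundle.finiteDimensional [IsMetricBundle 𝕜 V] (x : X) :
    FiniteDimensional 𝕜 (V x) := by
  obtain ⟨n, e, hx⟩ := IsMetricBundle.exists_triv (𝕜 := 𝕜) (V := V) x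
  exact Module.Finite.equiv (e.coord ⟨x, hx⟩).symm.toLinearEquiv

variable {V}

/-- A section is continuous as a map into the total space. -/
def ContinuousSection (s : ∀ x, V x) : Prop := Continuous fun x => (⟨x, s x⟩ : TotalSpace Unit V)

lemma continuousSection_iff [IsMetricBundle 𝕜 V] {s : ∀ x, V x} :
    ContinuousSection s ↔
      ∀ (n : ℕ) (e : IsometricTriv 𝕜 V n), Continuous fun x : e.baseSet => e.coord x (s x) := by
  constructor
  · intro h n e
    exact e.continuous_coord.comp
      (Continuous.subtype_mk (h.comp continuous_subtype_val) fun x => x.2)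
  · intro h
    rw [ContinuousSection, continuous_iff_continuousAt]
    intro x
    obtain ⟨n, e, hx⟩ := IsMetricBundle.exists_triv (𝕜 := 𝕜) (V := V) x
    have h1 := e.continuous_coord_symm.comp (continuous_id.prodMk (h n e))
    have h2 : Continuous fun y : e.baseSet => (⟨y, s y⟩ : TotalSpace Unit V) := by
      refine h1.congr fun y => ?_
      simp
    exact (e.isOpen_baseSet.isOpenEmbedding_subtypeVal.continuousAt_iff (x := ⟨x, hx⟩)).1
      h2.continuousAt

variable (V) in
/-- The space `C₀(X, V)` of continuous sections of `V` that vanish at infinity. -/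
def C0Section [IsMetricBundle 𝕜 V] : Submodule 𝕜 (∀ x, V x) where
  carrier := {s | ContinuousSection s ∧ Tendsto (fun x => ‖s x‖) (cocompact X) (𝓝 0)}
  zero_mem' := ⟨(continuousSection_iff 𝕜).2 fun n e => by simpa using continuous_const,
    by simpa using tendsto_const_nhds⟩
  add_mem' {s t} hs ht := by
    refine ⟨(continuousSection_iff 𝕜).2 fun n e => ?_, ?_⟩
    · simp only [Pi.add_apply, map_add]
      exact ((continuousSection_iff 𝕜).1 hs.1 n e).add ((continuousSection_iff 𝕜).1 ht.1 n e)
    · exact squeeze_zero (fun x => norm_nonneg _) (fun x => norm_add_le (s x) (t x))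
        (by simpa using hs.2.add ht.2)
  smul_mem' c s hs := by
    refine ⟨(continuousSection_iff 𝕜).2 fun n e => ?_, ?_⟩
    · simp only [Pi.smul_apply, map_smul]
      exact ((continuousSection_iff 𝕜).1 hs.1 n e).const_smul c
    · simpa [norm_smul] using hs.2.const_mul ‖c‖

end

end Bundles

section Real

open Bundle Filter Topology

/-- A "real" structure on a topological space, that is, a continuous involution. -/
structure RealStructure (X : Type*) [TopologicalSpace X] where
  toFun : X → X
  continuous_toFun : Continuous toFun
  involutive : Function.Involutive toFun

instance (X : Type*) [TopologicalSpace X] : CoeFun (RealStructure X) fun _ => X → X :=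
  ⟨RealStructure.toFun⟩

variable {X : Type*} [TopologicalSpace X]

/-- The involution as a homeomorphism. -/
def RealStructure.homeo (r : RealStructure X) : X ≃ₜ X where
  toFun := r
  invFun := r
  left_inv := r.involutive
  right_inv := r.involutive
  continuous_toFun := r.continuous_toFun
  continuous_invFun := r.continuous_toFun

lemma RealStructure.tendsto (r : RealStructure X) : Tendsto r (cocompact X) (cocompact X) :=
  (r.homeo.map_cocompact).le

/-- A `ℤ/2`-equivariant (Euclidean) real vector bundle over a "real" space. -/
structure EquivariantBundle (r : RealStructure X) where
  fiber : X → Type*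
  [normed : ∀ x, NormedAddCommGroup (fiber x)]
  [innerProduct : ∀ x, InnerProductSpace ℝ (fiber x)]
  [topology : TopologicalSpace (TotalSpace Unit fiber)]
  [metricBundle : IsMetricBundle ℝ fiber]
  /-- The action of the generator of `ℤ/2`. -/
  inv : ∀ x, fiber x ≃ₗᵢ[ℝ] fiber (r x)
  inv_inv : Function.Involutive
    fun p : TotalSpace Unit fiber => (⟨r p.proj, inv p.proj p.snd⟩ : TotalSpace Unit fiber)
  continuous_inv : Continuous
    fun p : TotalSpace Unit fiber => (⟨r p.proj, inv p.proj p.snd⟩ : TotalSpace Unit fiber)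

attribute [instance] EquivariantBundle.normed EquivariantBundle.innerProduct
  EquivariantBundle.topology EquivariantBundle.metricBundle

/-- A `ℤ/2`-graded "real" (Hermitian) complex line bundle over a "real" space. -/
structure RealLineBundle (r : RealStructure X) where
  fiber : X → Type*
  [normed : ∀ x, NormedAddCommGroup (fiber x)]
  [innerProduct : ∀ x, InnerProductSpace ℂ (fiber x)]
  [topology : TopologicalSpace (TotalSpace Unit fiber)]
  [metricBundle : IsMetricBundle ℂ fiber]
  finrank_fiber : ∀ x, Module.finrank ℂ (fiber x) = 1
  /-- The grading involution, which is `1` on the even and `-1` on the odd part. -/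
  grade : ∀ x, fiber x ≃ₗᵢ[ℂ] fiber x
  grade_grade : ∀ x v, grade x (grade x v) = v
  continuous_grade : Continuous
    fun p : TotalSpace Unit fiber => (⟨p.proj, grade p.proj p.snd⟩ : TotalSpace Unit fiber)
  /-- The conjugate-linear "real" involution. -/
  conj : ∀ x, fiber x ≃ₛₗᵢ[starRingEnd ℂ] fiber (r x)
  conj_conj : Function.Involutive
    fun p : TotalSpace Unit fiber => (⟨r p.proj, conj p.proj p.snd⟩ : TotalSpace Unit fiber)
  continuous_conj : Continuous
    fun p : TotalSpace Unit fiber => (⟨r p.proj, conj p.proj p.snd⟩ : TotalSpace Unit fiber)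
  conj_grade : ∀ x v, conj x (grade x v) = grade (r x) (conj x v)

attribute [instance] RealLineBundle.normed RealLineBundle.innerProduct
  RealLineBundle.topology RealLineBundle.metricBundle

/-- A family of maps `f x : V x → V (r x)` over an involution `r` that is involutive on the total
space satisfies `f (r x) = (f x)⁻¹` (up to the identification of `V (r (r x))` with `V x`). -/
lemma totalSpace_symm_eq {V : X → Type*} (r : RealStructure X) (f : ∀ x, V x ≃ V (r x))
    (hf : Function.Involutive
      fun p : TotalSpace Unit V => (⟨r p.proj, f p.proj p.snd⟩ : TotalSpace Unit V))
    (x : X) (w : V (r x)) :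
    (⟨x, (f x).symm w⟩ : TotalSpace Unit V) = ⟨r (r x), f (r x) w⟩ := by
  have h := hf ⟨x, (f x).symm w⟩
  simpa using h.symm

namespace RealLineBundle

variable {r : RealStructure X}

/-- An isomorphism of `ℤ/2`-graded "real" line bundles. -/
structure Iso (L : RealLineBundle r) (L' : RealLineBundle r) where
  toFun : ∀ x, L.fiber x ≃ₗᵢ[ℂ] L'.fiber x
  continuous_toFun : Continuous fun p : TotalSpace Unit L.fiber =>
    (⟨p.proj, toFun p.proj p.snd⟩ : TotalSpace Unit L'.fiber)
  continuous_symm : Continuous fun p : TotalSpace Unit L'.fiber =>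
    (⟨p.proj, (toFun p.proj).symm p.snd⟩ : TotalSpace Unit L.fiber)
  map_grade : ∀ x v, toFun x (L.grade x v) = L'.grade x (toFun x v)
  map_conj : ∀ x v, toFun (r x) (L.conj x v) = L'.conj x (toFun x v)

variable (L : RealLineBundle r)

/-- The space `C₀(X, L)`. -/
abbrev Sections := C0Section ℂ L.fiber

/-- The grading on `C₀(X, L)`. -/
def gradeSection (s : L.Sections) : L.Sections :=
  ⟨fun x => L.grade x (s.1 x), L.continuous_grade.comp s.2.1, by simpa using s.2.2⟩

/-- The "real" structure on `C₀(X, L)`: the section `x ↦ 𝔯 (s (r x))`, where the "real" involution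
`L.fiber (r x) → L.fiber x` is the inverse of `L.conj x`. -/
def conjSection (s : L.Sections) : L.Sections :=
  ⟨fun x => (L.conj x).symm (s.1 (r x)), by
    have h := L.continuous_conj.comp (s.2.1.comp r.continuous_toFun)
    refine h.congr fun x => ?_
    exact (totalSpace_symm_eq r (fun x => (L.conj x).toEquiv) L.conj_conj x _).symm, by
    simp only [LinearIsometryEquiv.norm_map]
    exact s.2.2.comp r.tendsto⟩

end RealLineBundle

namespace EquivariantBundle

variable {r : RealStructure X} (E : EquivariantBundle r)

/-- The local trivialisation over `r ⁻¹ (U)` induced by one over `U`. -/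
def pullTriv {n : ℕ} (e : IsometricTriv ℝ E.fiber n) : IsometricTriv ℝ E.fiber n where
  baseSet := r ⁻¹' e.baseSet
  isOpen_baseSet := e.isOpen_baseSet.preimage r.continuous_toFun
  coord x := (E.inv x).trans (e.coord ⟨r x, x.2⟩)
  continuous_coord := e.continuous_coord.comp
    (Continuous.subtype_mk (E.continuous_inv.comp continuous_subtype_val) fun p => p.2)
  continuous_coord_symm := by
    have h0 : Continuous fun x : r ⁻¹' e.baseSet => (⟨r x, x.2⟩ : e.baseSet) :=
      (r.continuous_toFun.comp continuous_subtype_val).subtype_mk _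
    have h := E.continuous_inv.comp (e.continuous_coord_symm.comp (h0.prodMap continuous_id))
    refine h.congr fun q => ?_
    exact (totalSpace_symm_eq r (fun x => (E.inv x).toEquiv) E.inv_inv _ _).symm

/-- A section of the Clifford algebra bundle is continuous if it is so in local isometric
trivialisations of `E`, which identify the Clifford algebra bundle with a trivial bundle. -/
def ContinuousCl (f : ∀ x, Cl (E.fiber x)) : Prop :=
  ∀ (n : ℕ) (e : IsometricTriv ℝ E.fiber n),
    Continuous fun x : e.baseSet => Cl.map (e.coord x) (f x)

/-- The `ℤ/2`-graded "real" C⋆-algebra `C₀(X, Cl_E)` of continuous sections vanishing at infinity of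
the Clifford algebra bundle of `E`, with pointwise operations. -/
def ClSection : NonUnitalStarSubalgebra ℂ (∀ x, Cl (E.fiber x)) where
  carrier := {f | E.ContinuousCl f ∧ Tendsto (fun x => ‖f x‖) (cocompact X) (𝓝 0)}
  zero_mem' := ⟨fun n e => by simpa using continuous_const, by simpa using tendsto_const_nhds⟩
  add_mem' {f g} hf hg := by
    refine ⟨fun n e => by
      simp only [Pi.add_apply, map_add]; exact (hf.1 n e).add (hg.1 n e), ?_⟩
    exact squeeze_zero (fun x => norm_nonneg _) (fun x => norm_add_le (f x) (g x))
      (by simpa using hf.2.add hg.2)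
  mul_mem' {f g} hf hg := by
    refine ⟨fun n e => by
      simp only [Pi.mul_apply, map_mul]; exact (hf.1 n e).mul (hg.1 n e), ?_⟩
    exact squeeze_zero (fun x => norm_nonneg _) (fun x => norm_mul_le (f x) (g x))
      (by simpa using hf.2.mul hg.2)
  smul_mem' c f hf := by
    refine ⟨fun n e => by
      simp only [Pi.smul_apply, map_smul]; exact (hf.1 n e).const_smul c, ?_⟩
    simpa [norm_smul] using hf.2.const_mul ‖c‖
  star_mem' {f} hf := by
    refine ⟨fun n e => by
      simp only [Pi.star_apply, Cl.map_star]; exact (hf.1 n e).star, ?_⟩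
    exact hf.2.congr fun x => (norm_star (f x)).symm

/-- The grading on `C₀(X, Cl_E)`. -/
def gradeCl (f : E.ClSection) : E.ClSection :=
  ⟨fun x => Cl.grade (f.1 x), by
    intro n e
    simp only [← Cl.grade_map]
    exact (LinearMap.continuous_of_finiteDimensional (Cl.grade.toLinearMap)).comp (f.2.1 n e), by
    simpa [Cl.norm_grade] using f.2.2⟩

/-- The "real" structure on `C₀(X, Cl_E)`: the section `x ↦ 𝔯 (f (r x))`, where
`𝔯 : Cl (E.fiber (r x)) → Cl (E.fiber x)` is the conjugate-linear extension of the `ℤ/2`-action. -/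
def conjCl (f : E.ClSection) : E.ClSection :=
  ⟨fun x => Cl.conjMap (E.inv x).symm (f.1 (r x)), by
    intro n e
    have hr : ∀ x : e.baseSet, r x ∈ (E.pullTriv e).baseSet := fun x => by
      change r (r x) ∈ e.baseSet
      rw [r.involutive]; exact x.2
    have h0 : Continuous fun x : e.baseSet => (⟨r x, hr x⟩ : (E.pullTriv e).baseSet) :=
      (r.continuous_toFun.comp continuous_subtype_val).subtype_mk _
    refine ((Cl.continuous_conjMap (LinearIsometryEquiv.refl ℝ _)).comp ((f.2.1 n (E.pullTriv e)).comp h0)).congr fun x => ?_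
    have h1 : (E.inv x).symm.trans (e.coord x) = (E.pullTriv e).coord ⟨r x, hr x⟩ := by
      ext1 w
      have h2 : ∀ p q : {p : TotalSpace Unit E.fiber // p.proj ∈ e.baseSet}, p = q →
          e.coord ⟨p.1.proj, p.2⟩ p.1.snd = e.coord ⟨q.1.proj, q.2⟩ q.1.snd := by
        rintro p _ rfl; rfl
      exact h2 ⟨⟨x, (E.inv x).symm w⟩, x.2⟩ ⟨⟨r (r x), E.inv (r x) w⟩, hr x⟩
        (Subtype.ext (totalSpace_symm_eq r (fun x => (E.inv x).toEquiv) E.inv_inv _ _))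
    rw [Cl.map_conjMap, h1, Function.comp_apply, Function.comp_apply, Cl.conjMap_map]
    rfl, by
    exact squeeze_zero (fun x => norm_nonneg _) (fun x => Cl.norm_conjMap_le _ _)
      (f.2.2.comp r.tendsto)⟩

end EquivariantBundle

section Morita

open scoped ZeroAtInfty

/-- The involution `(x, y) ↦ (x, -y)` of `ℝ^{a,b} = ℝ^a × ℝ^b`. -/
def reflAB (a b : ℕ) :
    EuclideanSpace ℝ (Fin a ⊕ Fin b) ≃ₗᵢ[ℝ] EuclideanSpace ℝ (Fin a ⊕ Fin b) :=
  LinearIsometryEquiv.piLpCongrRight 2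
    (Sum.elim (fun _ => LinearIsometryEquiv.refl ℝ ℝ) (fun _ => LinearIsometryEquiv.neg ℝ))

/-- The Clifford algebra `Cl_{a,b}` with self-adjoint generators `γ_1, …, γ_{a+b}`. -/
abbrev ClAB (a b : ℕ) : Type := Cl (EuclideanSpace ℝ (Fin a ⊕ Fin b))

/-- The "real" structure on `Cl_{a,b}`, for which `γ_1, …, γ_a` and `i γ_{a+1}, …, i γ_{a+b}` are
real. -/
def conjAB (a b : ℕ) : ClAB a b →+* ClAB a b := Cl.conjMap (reflAB a b)

variable (X) in
/-- The C⋆-algebra `C₀(X) ⊗ Cl_{a,b} = C₀(X, Cl_{a,b})`. -/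
abbrev TrivCl (a b : ℕ) : Type _ := C₀(X, ClAB a b)

/-- The grading on `C₀(X, Cl_{a,b})`. -/
def gradeTriv {a b : ℕ} (g : TrivCl X a b) : TrivCl X a b where
  toFun x := Cl.grade (g x)
  continuous_toFun :=
    (LinearMap.continuous_of_finiteDimensional (Cl.grade.toLinearMap)).comp g.continuous
  zero_at_infty' := by
    have h := (zero_at_infty g).norm
    rw [tendsto_zero_iff_norm_tendsto_zero]
    simpa [Cl.norm_grade] using h

/-- The "real" structure `(𝔯 g) x = 𝔯 (g (r x))` on `C₀(X, Cl_{a,b})`. -/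
def conjTriv (r : RealStructure X) {a b : ℕ} (g : TrivCl X a b) : TrivCl X a b where
  toFun x := conjAB a b (g (r x))
  continuous_toFun := (Cl.continuous_conjMap _).comp (g.continuous.comp r.continuous_toFun)
  zero_at_infty' := by
    have h := ((Cl.continuous_conjMap (reflAB a b)).tendsto 0).comp
      ((zero_at_infty g).comp r.tendsto)
    rwa [map_zero] at h

/-- The inclusion `C₀(X) → C₀(X, Cl_{a,b})`, `f ↦ f ⊗ 1`. -/
def scalarTriv (a b : ℕ) (f : C₀(X, ℂ)) : TrivCl X a b where
  toFun x := algebraMap ℂ (ClAB a b) (f x)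
  continuous_toFun := (continuous_algebraMap ℂ _).comp f.continuous
  zero_at_infty' := by
    have h := ((continuous_algebraMap ℂ (ClAB a b)).tendsto 0).comp (zero_at_infty f)
    rwa [map_zero] at h

variable {r : RealStructure X}

/-- The inclusion `C₀(X) → C₀(X, Cl_E)`, `f ↦ f ⊗ 1`. -/
def EquivariantBundle.scalarCl (E : EquivariantBundle r) (f : C₀(X, ℂ)) : E.ClSection :=
  ⟨fun x => algebraMap ℂ (Cl (E.fiber x)) (f x), by
    intro n e
    simp only [AlgHom.commutes]
    exact (continuous_algebraMap ℂ _).comp (f.continuous.comp continuous_subtype_val), by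
    have h := (zero_at_infty f).norm
    simpa [norm_algebraMap'] using h⟩

/-- A `KR`-orientation of `E`, with underlying Banach space `M`: a `ℤ/2`-graded, "real",
`C₀(X)`-linear Morita equivalence between `C₀(X, Cl_E)` and `C₀(X) ⊗ Cl_{a,b}`. -/
structure KROrientation (E : EquivariantBundle r) (a b : ℕ) (M : Type*) [NormedAddCommGroup M]
    [NormedSpace ℂ M] [CompleteSpace M] where
  /-- The left action: `lact f m = f · m`. -/
  lact : E.ClSection →ₗ[ℂ] M →ₗ[ℂ] M
  lact_mul : ∀ f g m, lact (f * g) m = lact f (lact g m)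
  /-- The right action: `ract g m = m · g`. -/
  ract : TrivCl X a b →ₗ[ℂ] M →ₗ[ℂ] M
  ract_mul : ∀ g h m, ract (g * h) m = ract h (ract g m)
  lact_ract : ∀ f g m, lact f (ract g m) = ract g (lact f m)
  /-- The left inner product with values in `C₀(X, Cl_E)`. -/
  linner : M →ₗ[ℂ] M →ₗ⋆[ℂ] E.ClSection
  linner_lact : ∀ f m m', linner (lact f m) m' = f * linner m m'
  star_linner : ∀ m m', star (linner m m') = linner m' m
  linner_nonneg : ∀ m, ∃ f, linner m m = star f * f
  linner_ract : ∀ g m m', linner (ract g m) m' = linner m (ract (star g) m')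
  /-- The right inner product with values in `C₀(X, Cl_{a,b})`. -/
  rinner : M →ₗ⋆[ℂ] M →ₗ[ℂ] TrivCl X a b
  rinner_ract : ∀ g m m', rinner m (ract g m') = rinner m m' * g
  star_rinner : ∀ m m', star (rinner m m') = rinner m' m
  rinner_nonneg : ∀ m, ∃ g, rinner m m = star g * g
  rinner_lact : ∀ f m m', rinner (lact f m) m' = rinner m (lact (star f) m')
  /-- `M` carries the Hilbert module norm. -/
  norm_sq : ∀ m, ‖m‖ ^ 2 = ‖rinner m m‖
  /-- The two inner products are compatible. -/
  linner_rinner : ∀ m m' m'', lact (linner m m') m'' = ract (rinner m' m'') m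
  /-- `M` is full as a left Hilbert module (the norm on `C₀(X, Cl_E)` is the supremum norm). -/
  linner_full : ∀ f : E.ClSection, ∀ ε : ℝ, 0 < ε →
    ∃ g ∈ Submodule.span ℂ (Set.range fun p : M × M => linner p.1 p.2),
      ∀ x, ‖f.1 x - g.1 x‖ < ε
  /-- `M` is full as a right Hilbert module. -/
  rinner_full : Dense
    (Submodule.span ℂ (Set.range fun p : M × M => rinner p.1 p.2) : Set (TrivCl X a b))
  /-- The left and right multiplication actions of `C₀(X)` agree. -/
  scalar : ∀ (f : C₀(X, ℂ)) m, lact (E.scalarCl f) m = ract (scalarTriv a b f) m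
  /-- The grading involution, which is `1` on the even and `-1` on the odd part. -/
  grade : M →ₗ[ℂ] M
  grade_grade : ∀ m, grade (grade m) = m
  grade_lact : ∀ f m, grade (lact f m) = lact (E.gradeCl f) (grade m)
  grade_ract : ∀ g m, grade (ract g m) = ract (gradeTriv g) (grade m)
  linner_grade : ∀ m m', linner (grade m) (grade m') = E.gradeCl (linner m m')
  rinner_grade : ∀ m m', rinner (grade m) (grade m') = gradeTriv (rinner m m')
  /-- The conjugate-linear "real" involution. -/
  conj : M →ₗ⋆[ℂ] M
  conj_conj : ∀ m, conj (conj m) = m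
  conj_grade : ∀ m, conj (grade m) = grade (conj m)
  conj_lact : ∀ f m, conj (lact f m) = lact (E.conjCl f) (conj m)
  conj_ract : ∀ g m, conj (ract g m) = ract (conjTriv r g) (conj m)
  linner_conj : ∀ m m', linner (conj m) (conj m') = E.conjCl (linner m m')
  rinner_conj : ∀ m m', rinner (conj m) (conj m') = conjTriv r (rinner m m')

/-- An isomorphism `L ⊗̂ M₁ ≅ M₂` of `ℤ/2`-graded "real" Hilbert bimodules, where `L ⊗̂ M₁` is the
graded tensor product over `X` with the line bundle `L`, that is, the completion of the algebraic
tensor product of `C₀(X, L)` and `M₁` for the inner product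
`⟪l ⊗ m, l' ⊗ m'⟫ = ⟪l, l'⟫ • ⟪m, m'⟫` with values in `C₀(X, Cl_{a,b})`, with the right action on
the factor `M₁`, with the left action `f (l ⊗ m) = (-1) ^ (|f| |l|) l ⊗ f m`, and with
the diagonal grading and "real" structure. A unitary from this completion onto `M₂` is the same as a
bilinear map that preserves the inner products and has dense linear span of its range. It preserves
the left inner products automatically because these are determined by
`⟪ξ, η⟫ ζ = ξ ⟪η, ζ⟫`. -/
structure TensorIso {E : EquivariantBundle r} {a b : ℕ}
    {M₁ : Type*} [NormedAddCommGroup M₁] [NormedSpace ℂ M₁] [CompleteSpace M₁]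
    {M₂ : Type*} [NormedAddCommGroup M₂] [NormedSpace ℂ M₂] [CompleteSpace M₂]
    (L : RealLineBundle r) (K₁ : KROrientation E a b M₁) (K₂ : KROrientation E a b M₂) where
  /-- The image of `l ⊗ m`. -/
  tmul : L.Sections →ₗ[ℂ] M₁ →ₗ[ℂ] M₂
  rinner_tmul : ∀ l l' m m' x,
    K₂.rinner (tmul l m) (tmul l' m') x = inner ℂ (l.1 x) (l'.1 x) • K₁.rinner m m' x
  dense : Dense
    (Submodule.span ℂ (Set.range fun p : L.Sections × M₁ => tmul p.1 p.2) : Set M₂)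
  ract_tmul : ∀ g l m, K₂.ract g (tmul l m) = tmul l (K₁.ract g m)
  lact_tmul_of_even : ∀ f, E.gradeCl f = f →
    ∀ l m, K₂.lact f (tmul l m) = tmul l (K₁.lact f m)
  lact_tmul_of_odd : ∀ f, E.gradeCl f = -f →
    ∀ l m, K₂.lact f (tmul l m) = tmul (L.gradeSection l) (K₁.lact f m)
  grade_tmul : ∀ l m, K₂.grade (tmul l m) = tmul (L.gradeSection l) (K₁.grade m)
  conj_tmul : ∀ l m, K₂.conj (tmul l m) = tmul (L.conjSection l) (K₁.conj m)

end Morita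

end Real

end KR

end

/-!
Consider homogeneous *intertwiners* `T : M₁ → M₂`: right module maps that commute, up to the sign
rule, with the left action of `C₀(X, Cl_E)`. If `S` and `T` are intertwiners, then `⟪S m, T n⟫` is
multiplication of `⟪m, n⟫` by a scalar function on `X`, because `M₁` is full and the supercentre of
`Cl_{a,b}` is `ℂ`. So the values at a point `x` of all intertwiners span at most a line, and this
scalar is an inner product on it. Intertwiners that do not vanish at a given point are obtained by
symmetrising a rank one map over a local orthonormal frame of `E`, one Clifford generator at a time.
Thus these lines form a line bundle `L`, and evaluation is an isomorphism `L ⊗ M₁ ≅ M₂`.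

Conversely, if `L' ⊗ M₁ ≅ M₂`, then homogeneous sections of `L'` act on `M₁` as intertwiners, which
identifies `L'` with `L`.
-/

noncomputable section

namespace KR

open Bundle Filter Topology
open scoped ZeroAtInfty CompactlySupported ComplexOrder

/-! ### Functions vanishing at infinity and Clifford algebras -/

section C0

variable {X : Type*} [TopologicalSpace X]

lemma norm_c0_apply_le {F : Type*} [NormedAddCommGroup F] (g : C₀(X, F)) (x : X) : ‖g x‖ ≤ ‖g‖ :=
  g.toBCF.norm_coe_le_norm x

lemma norm_c0_le {F : Type*} [NormedAddCommGroup F] (g : C₀(X, F)) {C : ℝ} (hC : 0 ≤ C)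
    (h : ∀ x, ‖g x‖ ≤ C) : ‖g‖ ≤ C :=
  (BoundedContinuousFunction.norm_le hC).2 h

/-- Evaluation of functions vanishing at infinity at a point. -/
def evalC0 (F : Type*) [NormedAddCommGroup F] [NormedSpace ℂ F] (x : X) : C₀(X, F) →L[ℂ] F :=
  LinearMap.mkContinuous
    { toFun := fun g => g x
      map_add' := fun _ _ => rfl
      map_smul' := fun _ _ => rfl } 1 fun g => by
    rw [one_mul]
    exact norm_c0_apply_le g x

/-- A compactly supported real function, as a complex function vanishing at infinity. -/
def ofRealC0 (χ : C_c(X, ℝ)) : C₀(X, ℂ) where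
  toFun x := (χ x : ℂ)
  continuous_toFun := Complex.continuous_ofReal.comp χ.continuous
  zero_at_infty' := (χ.hasCompactSupport.comp_left Complex.ofReal_zero).is_zero_at_infty

@[simp] lemma ofRealC0_apply (χ : C_c(X, ℝ)) (x : X) : ofRealC0 χ x = χ x := rfl

/-- The quotients `χ / ∑ i, f i` are extended by zero off the support of `χ`. -/
lemma exists_finset_sum_mul_eq {ι : Type*} {f : ι → X → ℝ} (hf : ∀ i, Continuous (f i))
    (hf0 : ∀ i x, 0 ≤ f i x) (hpos : ∀ x, ∃ i, 0 < f i x) (χ : C_c(X, ℝ)) :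
    ∃ (t : Finset ι) (g : C_c(X, ℝ)), ∀ x, ∑ i ∈ t, g x * f i x = χ x := by
  obtain ⟨t, ht⟩ := χ.hasCompactSupport.elim_finite_subcover (fun i => {x | 0 < f i x})
    (fun i => isOpen_lt continuous_const (hf i))
    fun x _ => Set.mem_iUnion.2 (hpos x)
  have hsum : ∀ x ∈ tsupport χ, 0 < ∑ i ∈ t, f i x := fun x hx => by
    obtain ⟨i, hi, hix⟩ := Set.mem_iUnion₂.1 (ht hx)
    exact Finset.sum_pos' (fun i _ => hf0 i x) ⟨i, hi, hix⟩
  have hsub : tsupport (fun x => χ x / ∑ i ∈ t, f i x) ⊆ tsupport χ :=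
    closure_mono fun x hx h0 => hx (by simp only [h0, zero_div])
  refine ⟨t, ⟨⟨fun x => χ x / ∑ i ∈ t, f i x, continuous_of_tsupport fun x hx => ?_⟩,
    χ.hasCompactSupport.of_isClosed_subset (isClosed_tsupport _) hsub⟩, fun x => ?_⟩
  · exact χ.continuous.continuousAt.div (continuous_finsetSum t fun i _ => hf i).continuousAt
      (hsum x (hsub hx)).ne'
  · change ∑ i ∈ t, χ x / (∑ j ∈ t, f j x) * f i x = χ x
    rw [← Finset.mul_sum]
    by_cases hx : x ∈ tsupport χ
    · exact div_mul_cancel₀ _ (hsum x hx).ne'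
    · rw [image_eq_zero_of_notMem_tsupport hx, zero_div, zero_mul]

variable [T2Space X] [LocallyCompactSpace X]

lemma exists_cutoff {K U : Set X} (hK : IsCompact K) (hU : IsOpen U) (hKU : K ⊆ U) :
    ∃ χ : C_c(X, ℝ), Set.EqOn χ 1 K ∧ tsupport χ ⊆ U ∧ ∀ x, χ x ∈ Set.Icc 0 1 := by
  obtain ⟨χ, h1, hc, hs, hI⟩ := exists_continuousMap_one_of_isCompact_subset_isOpen hK hU hKU
  exact ⟨⟨χ, hc⟩, h1, hs, hI⟩

lemma exists_cutoff_apply_eq_one {x : X} {U : Set X} (hU : IsOpen U) (hx : x ∈ U) :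
    ∃ χ : C_c(X, ℝ), χ x = 1 ∧ tsupport χ ⊆ U := by
  obtain ⟨χ, h1, hs, -⟩ := exists_cutoff isCompact_singleton hU (Set.singleton_subset_iff.2 hx)
  exact ⟨χ, h1 rfl, hs⟩

lemma exists_c0_apply_eq {F : Type*} [NormedAddCommGroup F] [NormedSpace ℂ F] (x : X) (c : F) :
    ∃ g : C₀(X, F), g x = c := by
  obtain ⟨χ, hx, -⟩ := exists_cutoff_apply_eq_one isOpen_univ (Set.mem_univ x)
  refine ⟨⟨⟨fun y => ofRealC0 χ y • c, by fun_prop⟩, ?_⟩, ?_⟩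
  · simpa using (zero_at_infty (ofRealC0 χ)).smul_const c
  · change (χ x : ℂ) • c = c
    rw [hx, Complex.ofReal_one, one_smul]

lemma exists_cutoff_mul_le {f : X → ℝ} (hf : Tendsto f (cocompact X) (𝓝 0)) {ε : ℝ} (hε : 0 < ε) :
    ∃ χ : C_c(X, ℝ), (∀ x, χ x ∈ Set.Icc 0 1) ∧ ∀ x, (1 - χ x) * f x ≤ ε := by
  obtain ⟨C, hC, hCf⟩ := mem_cocompact.1 (hf.eventually_lt_const hε)
  obtain ⟨χ, h1, -, hI⟩ := exists_cutoff hC isOpen_univ (Set.subset_univ C)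
  refine ⟨χ, hI, fun x => ?_⟩
  by_cases hx : x ∈ C
  · simpa [h1 hx] using hε.le
  · have hfx : f x < ε := hCf hx
    nlinarith [(hI x).1, (hI x).2]

end C0

section Line

/-- Multiplication by a sign. -/
def signIsometry (F : Type*) [NormedAddCommGroup F] [NormedSpace ℂ F] (ε : ℤˣ) : F ≃ₗᵢ[ℂ] F where
  toFun v := ε • v
  invFun v := ε • v
  left_inv v := by simp only [smul_smul, Int.units_mul_self, one_smul]
  right_inv v := by simp only [smul_smul, Int.units_mul_self, one_smul]
  map_add' := smul_add ε
  map_smul' z v := smul_comm ε z v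
  norm_map' v := norm_units_zsmul ε v

variable {F : Type*} [NormedAddCommGroup F] [InnerProductSpace ℂ F]

/-- The unitary `z ↦ z • v` from `ℂ` onto a line spanned by a unit vector `v`. -/
def unitEquiv (hF : Module.finrank ℂ F = 1) (v : F) (hv : ‖v‖ = 1) : ℂ ≃ₗᵢ[ℂ] F :=
  LinearIsometryEquiv.ofSurjective
    ⟨LinearMap.toSpanSingleton ℂ F v, fun z => by
      rw [LinearMap.toSpanSingleton_apply, norm_smul, hv, mul_one]⟩
    (exists_smul_eq_of_finrank_eq_one hF (norm_ne_zero_iff.1 (by rw [hv]; exact one_ne_zero)))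

@[simp] lemma unitEquiv_apply (hF : Module.finrank ℂ F = 1) (v : F) (hv : ‖v‖ = 1) (z : ℂ) :
    unitEquiv hF v hv z = z • v := rfl

lemma unitEquiv_symm_apply (hF : Module.finrank ℂ F = 1) (v : F) (hv : ‖v‖ = 1) (w : F) :
    (unitEquiv hF v hv).symm w = inner ℂ v w := by
  obtain ⟨z, rfl⟩ := (unitEquiv hF v hv).surjective w
  rw [LinearIsometryEquiv.symm_apply_apply, unitEquiv_apply, inner_smul_right,
    inner_self_eq_norm_sq_to_K, hv]
  simp

lemma eq_inner_div_inner_smul (hF : Module.finrank ℂ F = 1) {v : F} (hv : v ≠ 0) (w : F) :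
    w = (inner ℂ v w / inner ℂ v v) • v := by
  obtain ⟨z, rfl⟩ := exists_smul_eq_of_finrank_eq_one hF hv w
  rw [inner_smul_right, mul_div_cancel_right₀ _ (inner_self_ne_zero.2 hv)]

end Line

namespace Cl

section

variable {V : Type*} [NormedAddCommGroup V] [InnerProductSpace ℝ V]

lemma γ_add (v w : V) : γ (v + w) = γ v + γ w := by
  simp only [γ, mk, map_add]
  exact TensorProduct.tmul_add _ _ _

lemma γ_smul (c : ℝ) (w : V) : γ (c • w) = (c : ℂ) • γ w := by
  rw [Algebra.smul_def, algebraMap_def, γ, γ, mk_mul_mk, map_smul, mk, mk,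
    TensorProduct.tmul_smul, TensorProduct.smul_tmul', one_mul, mul_one, Complex.real_smul, mul_one]

lemma γ_mul_self_of_orthonormal {ι : Type*} {e : ι → V} (he : Orthonormal ℝ e) (k : ι) :
    γ (e k) * γ (e k) = 1 := by
  rw [γ_mul_self, he.1 k, one_pow, Complex.ofReal_one, map_one]

end

section FiniteDim

variable {V : Type*} [NormedAddCommGroup V] [InnerProductSpace ℝ V] [FiniteDimensional ℝ V]

/-- Write `d = a + e_k b` with `a` and `b` in the algebra generated by `s`: supercommuting with
`e_k` forces `b = -b`. -/
lemma mem_gen_of_supercommute {ι : Type*} [DecidableEq ι] {e : ι → V} (he : Orthonormal ℝ e)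
    {s : Finset ι} {k : ι} (hk : k ∉ s) {d : Cl V} (hd : d ∈ gen e (insert k s))
    (hcomm : γ (e k) * d = grade d * γ (e k)) : d ∈ gen e s := by
  obtain ⟨a, ha, b, hb, rfl⟩ := exists_of_mem_gen_insert he hk hd
  have horth : ∀ i ∈ s, inner ℝ (e k) (e i) = 0 := fun i hi =>
    he.2 (ne_of_mem_of_not_mem hi hk).symm
  have hgrade : ∀ x ∈ gen e s, grade x * γ (e k) = γ (e k) * x := fun x hx => by
    rw [gen_mul_γ horth (grade_mem_gen hx), grade_grade]
  have hsq := γ_mul_self_of_orthonormal he k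
  have hb_neg : b = -b := by
    rw [mul_add, ← mul_assoc, hsq, one_mul, map_add, map_mul, grade_γ, add_mul, hgrade a ha,
      neg_mul, neg_mul, mul_assoc, hgrade b hb, ← mul_assoc, hsq, one_mul] at hcomm
    exact add_left_cancel hcomm
  have hb_zero : b = 0 := by
    have h2 : (2 : ℂ) • b = 0 := by rw [two_smul, ← eq_neg_iff_add_eq_zero]; exact hb_neg
    exact (smul_eq_zero.1 h2).resolve_left two_ne_zero
  rwa [hb_zero, mul_zero, add_zero]

lemma eq_algebraMap_of_mem_gen_of_supercommute {ι : Type*} {e : ι → V}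
    (he : Orthonormal ℝ e) (s : Finset ι) {d : Cl V} (hd : d ∈ gen e s)
    (hcomm : ∀ i ∈ s, γ (e i) * d = grade d * γ (e i)) : ∃ z : ℂ, d = algebraMap ℂ (Cl V) z := by
  classical
  induction s using Finset.induction_on with
  | empty => exact gen_empty hd
  | insert k s hk ih =>
    exact ih (mem_gen_of_supercommute he hk hd (hcomm k (Finset.mem_insert_self k s)))
      fun i hi => hcomm i (Finset.mem_insert_of_mem hi)

lemma eq_algebraMap_of_supercentral {d : Cl V} (hd : ∀ v : V, γ v * d = grade d * γ v) :
    ∃ z : ℂ, d = algebraMap ℂ (Cl V) z :=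
  eq_algebraMap_of_mem_gen_of_supercommute (stdOrthonormalBasis ℝ V).orthonormal Finset.univ
    (by rw [gen_basis_univ]; exact Algebra.mem_top) fun i _ => hd _

lemma eq_zero_of_tr_star_mul_self {x : Cl V} (h : tr (star x * x) = 0) : x = 0 := by
  by_contra hx
  exact (tr_star_mul_self_pos hx).ne' h

lemma norm_toHilb_one : ‖toHilb (1 : Cl V)‖ = 1 := by
  have h : ‖toHilb (1 : Cl V)‖ ^ 2 = (tr (star (1 : Cl V) * 1)).re :=
    (inner_self_eq_norm_sq (𝕜 := ℂ) (toHilb (1 : Cl V))).symm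
  rw [star_one, one_mul, ← map_one (algebraMap ℂ (Cl V)), tr_algebraMap, Complex.one_re] at h
  exact (pow_eq_one_iff_of_nonneg (norm_nonneg _) two_ne_zero).1 h

lemma norm_tr_le (x : Cl V) : ‖tr x‖ ≤ ‖x‖ := calc
  ‖tr x‖ = ‖inner ℂ (toHilb 1) (leftReg x (toHilb 1))‖ := by simp [leftReg_apply, inner_hilb]
  _ ≤ ‖toHilb (1 : Cl V)‖ * ‖leftReg x (toHilb 1)‖ := norm_inner_le_norm _ _
  _ ≤ ‖x‖ := by simpa [norm_toHilb_one, norm_def] using (leftReg x).le_opNorm (toHilb 1)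

lemma norm_γ (v : V) : ‖γ v‖ = ‖v‖ := by
  have h := CStarRing.norm_star_mul_self (x := γ v)
  rw [star_γ, γ_mul_self, norm_algebraMap', Complex.norm_real, Real.norm_eq_abs,
    abs_of_nonneg (by positivity), sq] at h
  exact (mul_self_inj (norm_nonneg _) (norm_nonneg _)).1 h.symm

lemma continuous_γ : Continuous (γ : V → Cl V) :=
  LinearMap.continuous_of_finiteDimensional
    ({ toFun := γ, map_add' := γ_add, map_smul' := γ_smul } : V →ₗ[ℝ] Cl V)

lemma grade_conjMap {W : Type*} [NormedAddCommGroup W] [InnerProductSpace ℝ W]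
    [FiniteDimensional ℝ W] (u : V ≃ₗᵢ[ℝ] W) (x : Cl V) :
    grade (conjMap u x) = conjMap u (grade x) := by
  induction x using Cl.induction with
  | hadd x y hx hy => simp only [map_add, hx, hy]
  | hmk z c => rw [conjMap_mk, ← map_mk, grade_map, grade_mk, grade_mk, map_mk, conjMap_mk]

end FiniteDim

end Cl

section Sections

variable {X : Type*} [TopologicalSpace X] {r : RealStructure X} {E : EquivariantBundle r} {a b : ℕ}

namespace EquivariantBundle

lemma continuous_norm_clSection (f : E.ClSection) : Continuous fun x => ‖f.1 x‖ := by
  rw [continuous_iff_continuousAt]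
  intro x
  obtain ⟨n, e, hx⟩ := IsMetricBundle.exists_triv (𝕜 := ℝ) (V := E.fiber) x
  have h : Continuous fun y : e.baseSet => ‖f.1 y‖ :=
    (f.2.1 n e).norm.congr fun y => Cl.norm_map _ _
  exact (e.isOpen_baseSet.isOpenEmbedding_subtypeVal.continuousAt_iff (x := ⟨x, hx⟩)).1
    h.continuousAt

lemma norm_sqrt_inv_smul {F : Type*} [NormedAddCommGroup F] [NormedSpace ℂ F] (v : F) :
    ‖(((√‖v‖)⁻¹ : ℝ) : ℂ) • v‖ = √‖v‖ := by
  rw [norm_smul, Complex.norm_real, Real.norm_eq_abs, abs_of_nonneg (by positivity),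
    inv_mul_eq_div, Real.div_sqrt]

lemma continuous_sqrt_inv_smul {F : Type*} [NormedAddCommGroup F] [NormedSpace ℂ F] :
    Continuous fun v : F => (((√‖v‖)⁻¹ : ℝ) : ℂ) • v := by
  rw [continuous_iff_continuousAt]
  intro v
  have hsqrt : Continuous fun v : F => √‖v‖ := Real.continuous_sqrt.comp continuous_norm
  rcases eq_or_ne v 0 with rfl | hv
  · rw [ContinuousAt, smul_zero, tendsto_zero_iff_norm_tendsto_zero]
    simpa only [norm_sqrt_inv_smul, norm_zero, Real.sqrt_zero] using hsqrt.tendsto 0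
  · have h0 : √‖v‖ ≠ 0 := (Real.sqrt_pos.2 (norm_pos_iff.2 hv)).ne'
    exact (Complex.continuous_ofReal.continuousAt.comp
      (hsqrt.continuousAt.inv₀ h0)).smul continuousAt_id

/-- The scalar factor is `√‖f‖`, so that the other factor has norm `√‖f‖` as well. -/
lemma exists_eq_scalarCl_mul (f : E.ClSection) :
    ∃ (h : C₀(X, ℂ)) (f' : E.ClSection), f = E.scalarCl h * f' ∧ ∀ x, f.1 x = 0 → h x = 0 := by
  have hc : Continuous fun x => √‖f.1 x‖ := Real.continuous_sqrt.comp (continuous_norm_clSection f)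
  have ht : Tendsto (fun x => √‖f.1 x‖) (cocompact X) (𝓝 0) := by
    simpa only [Function.comp_def, Real.sqrt_zero] using
      (Real.continuous_sqrt.tendsto 0).comp f.2.2
  refine ⟨⟨⟨fun x => ((√‖f.1 x‖ : ℝ) : ℂ), Complex.continuous_ofReal.comp hc⟩, by
    simpa [Function.comp_def] using (Complex.continuous_ofReal.tendsto 0).comp ht⟩,
    ⟨fun x => (((√‖f.1 x‖)⁻¹ : ℝ) : ℂ) • f.1 x, fun n e => ?_, ?_⟩,
    Subtype.ext (funext fun x => ?_), fun x hx => ?_⟩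
  · refine (continuous_sqrt_inv_smul.comp (f.2.1 n e)).congr fun x => ?_
    simp only [Function.comp_apply, map_smul, Cl.norm_map]
  · simpa only [norm_sqrt_inv_smul] using ht
  · change f.1 x = algebraMap ℂ _ ((√‖f.1 x‖ : ℝ) : ℂ) * ((((√‖f.1 x‖)⁻¹ : ℝ) : ℂ) • f.1 x)
    rw [← Algebra.smul_def, smul_smul, ← Complex.ofReal_mul]
    rcases eq_or_ne (f.1 x) 0 with h0 | h0
    · rw [h0, smul_zero]
    · rw [mul_inv_cancel₀ (Real.sqrt_pos.2 (norm_pos_iff.2 h0)).ne', Complex.ofReal_one, one_smul]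
  · change ((√‖f.1 x‖ : ℝ) : ℂ) = 0
    rw [hx, norm_zero, Real.sqrt_zero, Complex.ofReal_zero]

lemma gradeCl_gradeCl (f : E.ClSection) : E.gradeCl (E.gradeCl f) = f :=
  Subtype.ext (funext fun _ => Cl.grade_grade _)

lemma gradeCl_conjCl (f : E.ClSection) : E.gradeCl (E.conjCl f) = E.conjCl (E.gradeCl f) :=
  Subtype.ext (funext fun _ => Cl.grade_conjMap _ _)

lemma map_apply_of_eq (f : ∀ x, Cl (E.fiber x)) {x y : X} (h : y = x)
    {u : E.fiber y ≃ₗᵢ[ℝ] E.fiber x}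
    (hu : ∀ v, (⟨x, u v⟩ : TotalSpace Unit E.fiber) = ⟨y, v⟩) : Cl.map u (f y) = f x := by
  subst h
  have hu_refl : u = LinearIsometryEquiv.refl ℝ _ := by
    ext v
    simpa using hu v
  rw [hu_refl, Cl.map_refl, AlgHom.id_apply]

lemma conjCl_conjCl (f : E.ClSection) : E.conjCl (E.conjCl f) = f := by
  refine Subtype.ext (funext fun x => ?_)
  change Cl.conjMap (E.inv x).symm (Cl.conjMap (E.inv (r x)).symm (f.1 (r (r x)))) = f.1 x
  rw [Cl.conjMap_conjMap]
  refine map_apply_of_eq f.1 (r.involutive x) fun v => ?_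
  have h := totalSpace_symm_eq r (fun x => (E.inv x).toEquiv) E.inv_inv x ((E.inv (r x)).symm v)
  refine h.trans ?_
  change (⟨r (r x), E.inv (r x) ((E.inv (r x)).symm v)⟩ : TotalSpace Unit E.fiber) = _
  rw [LinearIsometryEquiv.apply_symm_apply]

/-- The automorphism of `C₀(X, Cl_E)` by which an element changes when it is commuted past an
operator of parity `ε`: the identity if `ε = 1`, the grading if `ε = -1`. -/
def twistCl (E : EquivariantBundle r) (ε : ℤˣ) : E.ClSection →ₙₐ[ℂ] E.ClSection :=
  if ε = 1 then NonUnitalAlgHom.id ℂ E.ClSection else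
    { toFun := E.gradeCl
      map_smul' := fun z f => Subtype.ext (funext fun x => map_smul Cl.grade z (f.1 x))
      map_zero' := Subtype.ext (funext fun _ => map_zero Cl.grade)
      map_add' := fun _ _ => Subtype.ext (funext fun _ => map_add Cl.grade _ _)
      map_mul' := fun _ _ => Subtype.ext (funext fun _ => map_mul Cl.grade _ _) }

@[simp] lemma twistCl_one (f : E.ClSection) : E.twistCl 1 f = f := by
  rw [twistCl, if_pos rfl]
  rfl

@[simp] lemma twistCl_neg_one (f : E.ClSection) : E.twistCl (-1) f = E.gradeCl f := by
  rw [twistCl, if_neg (by decide)]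
  rfl

lemma twistCl_twistCl (ε : ℤˣ) (f : E.ClSection) : E.twistCl ε (E.twistCl ε f) = f := by
  rcases Int.units_eq_one_or ε with rfl | rfl
  · simp only [twistCl_one]
  · rw [twistCl_neg_one, twistCl_neg_one, gradeCl_gradeCl]

lemma twistCl_star (ε : ℤˣ) (f : E.ClSection) : E.twistCl ε (star f) = star (E.twistCl ε f) := by
  rcases Int.units_eq_one_or ε with rfl | rfl
  · simp only [twistCl_one]
  · rw [twistCl_neg_one, twistCl_neg_one]
    exact Subtype.ext (funext fun _ => Cl.grade_star _)

lemma twistCl_scalarCl (ε : ℤˣ) (h : C₀(X, ℂ)) : E.twistCl ε (E.scalarCl h) = E.scalarCl h := by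
  rcases Int.units_eq_one_or ε with rfl | rfl
  · simp only [twistCl_one]
  · rw [twistCl_neg_one]
    exact Subtype.ext (funext fun _ => AlgHom.commutes _ _)

lemma conjCl_twistCl (ε : ℤˣ) (f : E.ClSection) :
    E.conjCl (E.twistCl ε f) = E.twistCl ε (E.conjCl f) := by
  rcases Int.units_eq_one_or ε with rfl | rfl
  · simp only [twistCl_one]
  · rw [twistCl_neg_one, twistCl_neg_one, gradeCl_conjCl]

lemma twistCl_of_even {f : E.ClSection} (hf : E.gradeCl f = f) (ε : ℤˣ) : E.twistCl ε f = f := by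
  rcases Int.units_eq_one_or ε with rfl | rfl
  · simp only [twistCl_one]
  · rw [twistCl_neg_one, hf]

lemma twistCl_of_odd {f : E.ClSection} (hf : E.gradeCl f = -f) (ε : ℤˣ) :
    E.twistCl ε f = ε • f := by
  rcases Int.units_eq_one_or ε with rfl | rfl
  · rw [twistCl_one, one_smul]
  · rw [twistCl_neg_one, hf, Units.neg_smul, one_smul]

lemma exists_even_add_odd (f : E.ClSection) :
    ∃ f₀ f₁, E.gradeCl f₀ = f₀ ∧ E.gradeCl f₁ = -f₁ ∧ f₀ + f₁ = f := by
  refine ⟨(2⁻¹ : ℂ) • (f + E.gradeCl f), (2⁻¹ : ℂ) • (f - E.gradeCl f), ?_, ?_, by module⟩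
  · refine Subtype.ext (funext fun x => ?_)
    change Cl.grade ((2⁻¹ : ℂ) • (f.1 x + Cl.grade (f.1 x))) =
      (2⁻¹ : ℂ) • (f.1 x + Cl.grade (f.1 x))
    rw [map_smul, map_add, Cl.grade_grade, add_comm]
  · refine Subtype.ext (funext fun x => ?_)
    change Cl.grade ((2⁻¹ : ℂ) • (f.1 x - Cl.grade (f.1 x))) =
      -((2⁻¹ : ℂ) • (f.1 x - Cl.grade (f.1 x)))
    rw [map_smul, map_sub, Cl.grade_grade, ← smul_neg, neg_sub]

lemma twistCl_apply_congr (ε : ℤˣ) {f g : E.ClSection} {x : X} (h : f.1 x = g.1 x) :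
    (E.twistCl ε f).1 x = (E.twistCl ε g).1 x := by
  rcases Int.units_eq_one_or ε with rfl | rfl
  · simpa only [twistCl_one] using h
  · rw [twistCl_neg_one, twistCl_neg_one]
    exact congrArg Cl.grade h

end EquivariantBundle

lemma gradeTriv_gradeTriv (g : TrivCl X a b) : gradeTriv (gradeTriv g) = g :=
  ZeroAtInftyContinuousMap.ext fun _ => Cl.grade_grade _

lemma conjAB_conjAB (c : ClAB a b) : conjAB a b (conjAB a b c) = c := by
  have h : (reflAB a b).trans (reflAB a b) = LinearIsometryEquiv.refl ℝ _ := by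
    ext v i
    rcases i with i | i <;> simp [reflAB]
  rw [conjAB, Cl.conjMap_conjMap, h, Cl.map_refl, AlgHom.id_apply]

lemma conjTriv_conjTriv (g : TrivCl X a b) : conjTriv r (conjTriv r g) = g :=
  ZeroAtInftyContinuousMap.ext fun x => by
    change conjAB a b (conjAB a b (g (r (r x)))) = g x
    rw [conjAB_conjAB, r.involutive]

end Sections

/-! ### Fibres of a KR-orientation -/

namespace KROrientation

variable {X : Type*} [TopologicalSpace X] {r : RealStructure X} {E : EquivariantBundle r} {a b : ℕ}
  {M : Type*} [NormedAddCommGroup M] [NormedSpace ℂ M] [CompleteSpace M]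
  (K : KROrientation E a b M)

/-- The value of `n` in the fibre of `M` over `x`, encoded as the functional `m ↦ ⟪m, n⟫ x`. -/
def eval (x : X) : M →ₗ[ℂ] M →ₗ⋆[ℂ] ClAB a b :=
  LinearMap.mk₂'ₛₗ (RingHom.id ℂ) (starRingEnd ℂ) (fun n m => K.rinner m n x)
    (fun n n' m => by rw [map_add]; rfl) (fun z n m => by rw [map_smul]; rfl)
    (fun n m m' => by rw [map_add]; rfl) (fun z n m => by rw [LinearMap.map_smulₛₗ]; rfl)

lemma eval_apply (x : X) (m n : M) : K.eval x n m = K.rinner m n x := rfl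

lemma rinner_symm (m n : M) (x : X) : K.rinner m n x = star (K.rinner n m x) := by
  rw [← K.star_rinner n m]
  rfl

lemma rinner_smul_apply (z : ℂ) (m n : M) (x : X) :
    K.rinner m (z • n) x = z • K.rinner m n x := by
  rw [map_smul, ZeroAtInftyContinuousMap.smul_apply]

lemma rinner_smul_left_apply (z : ℂ) (m n : M) (x : X) :
    K.rinner (z • m) n x = star z • K.rinner m n x := by
  rw [K.rinner_symm, rinner_smul_apply, star_smul, ← K.rinner_symm]

lemma rinner_units_smul_units_smul (ε δ : ℤˣ) (m n : M) (x : X) :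
    K.rinner (ε • m) (δ • n) x = (ε * δ) • K.rinner m n x := by
  simp only [Units.smul_def, map_zsmul, LinearMap.smul_apply, ZeroAtInftyContinuousMap.smul_apply,
    smul_smul, Units.val_mul, mul_comm]

lemma rinner_ract_apply (g : TrivCl X a b) (m n : M) (x : X) :
    K.rinner m (K.ract g n) x = K.rinner m n x * g x := by
  rw [K.rinner_ract, ZeroAtInftyContinuousMap.mul_apply]

lemma rinner_ract_left_apply (g : TrivCl X a b) (m n : M) (x : X) :
    K.rinner (K.ract g m) n x = star (g x) * K.rinner m n x := by
  rw [K.rinner_symm, K.rinner_ract_apply, star_mul, ← K.rinner_symm]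

lemma rinner_lact_right (f : E.ClSection) (m n : M) :
    K.rinner m (K.lact f n) = K.rinner (K.lact (star f) m) n := by
  rw [K.rinner_lact, star_star]

lemma grade_rinner_apply (m n : M) (x : X) :
    Cl.grade (K.rinner m n x) = K.rinner (K.grade m) (K.grade n) x :=
  (DFunLike.congr_fun (K.rinner_grade m n) x).symm

lemma rinner_grade_right (m n : M) (x : X) :
    K.rinner m (K.grade n) x = Cl.grade (K.rinner (K.grade m) n x) := by
  rw [grade_rinner_apply, K.grade_grade]

lemma rinner_conj_right (m n : M) (x : X) :
    K.rinner m (K.conj n) x = conjAB a b (K.rinner (K.conj m) n (r x)) := by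
  have h := K.rinner_conj (K.conj m) n
  rw [K.conj_conj] at h
  exact DFunLike.congr_fun h x

section Eval

variable {K} {x : X}

lemma rinner_congr {m m' n n' : M} (hm : K.eval x m = K.eval x m')
    (hn : K.eval x n = K.eval x n') : K.rinner m n x = K.rinner m' n' x := calc
  K.rinner m n x = K.rinner m n' x := LinearMap.congr_fun hn m
  _ = star (K.eval x m n') := K.rinner_symm m n' x
  _ = K.rinner m' n' x := by rw [hm, eval_apply, ← K.rinner_symm]

lemma eval_ract_congr {n n' : M} {g g' : TrivCl X a b} (hn : K.eval x n = K.eval x n')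
    (hg : g x = g' x) : K.eval x (K.ract g n) = K.eval x (K.ract g' n') :=
  LinearMap.ext fun m => by
    rw [eval_apply, eval_apply, rinner_ract_apply, rinner_ract_apply, hg, rinner_congr rfl hn]

lemma eval_grade_congr {n n' : M} (hn : K.eval x n = K.eval x n') :
    K.eval x (K.grade n) = K.eval x (K.grade n') :=
  LinearMap.ext fun m => by
    rw [eval_apply, eval_apply, rinner_grade_right, rinner_grade_right, rinner_congr rfl hn]

lemma eval_conj_congr {n n' : M} (hn : K.eval (r x) n = K.eval (r x) n') :
    K.eval x (K.conj n) = K.eval x (K.conj n') :=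
  LinearMap.ext fun m => by
    rw [eval_apply, eval_apply, rinner_conj_right, rinner_conj_right, rinner_congr rfl hn]

end Eval

lemma eval_ract_of_apply_eq {x : X} {g : TrivCl X a b} {z : ℂ} (hg : g x = algebraMap ℂ _ z)
    (n : M) : K.eval x (K.ract g n) = z • K.eval x n :=
  LinearMap.ext fun m => by
    rw [LinearMap.smul_apply, eval_apply, eval_apply, rinner_ract_apply, hg, ← Algebra.commutes,
      ← Algebra.smul_def]

lemma eval_ract_scalar (x : X) (h : C₀(X, ℂ)) (n : M) :
    K.eval x (K.ract (scalarTriv a b h) n) = h x • K.eval x n :=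
  K.eval_ract_of_apply_eq rfl n

lemma eval_lact_of_apply_eq_zero {x : X} {f : E.ClSection} (hf : f.1 x = 0) (n : M) :
    K.eval x (K.lact f n) = 0 := by
  obtain ⟨h, f', rfl, h0⟩ := EquivariantBundle.exists_eq_scalarCl_mul f
  rw [K.lact_mul, K.scalar, eval_ract_scalar, h0 x hf, zero_smul]

lemma eval_lact_congr {x : X} {f f' : E.ClSection} {n n' : M} (hf : f.1 x = f'.1 x)
    (hn : K.eval x n = K.eval x n') : K.eval x (K.lact f n) = K.eval x (K.lact f' n') := by
  have hsub : (f - f').1 x = 0 := sub_eq_zero.2 hf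
  have hf_sub := K.eval_lact_of_apply_eq_zero hsub n
  rw [map_sub, LinearMap.sub_apply, map_sub, sub_eq_zero] at hf_sub
  refine hf_sub.trans (LinearMap.ext fun m => ?_)
  rw [eval_apply, eval_apply, rinner_lact_right, rinner_lact_right, rinner_congr rfl hn]

lemma norm_le_of_rinner {m : M} {C : ℝ} (hC : 0 ≤ C) (h : ∀ x, ‖K.rinner m m x‖ ≤ C ^ 2) :
    ‖m‖ ≤ C := by
  refine (sq_le_sq₀ (norm_nonneg _) hC).1 ?_
  rw [K.norm_sq]
  exact norm_c0_le _ (by positivity) h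

lemma norm_rinner_apply_le (m : M) (x : X) : ‖K.rinner m m x‖ ≤ ‖m‖ ^ 2 := by
  rw [K.norm_sq]
  exact norm_c0_apply_le _ x

lemma ext_eval {m n : M} (h : ∀ x, K.eval x m = K.eval x n) : m = n := by
  have hnorm : ‖m - n‖ ≤ 0 := K.norm_le_of_rinner le_rfl fun x => by
    have h0 : K.eval x (m - n) = 0 := by rw [map_sub, h, sub_self]
    rw [← eval_apply, h0, LinearMap.zero_apply, norm_zero]
    positivity
  exact sub_eq_zero.1 (norm_le_zero_iff.1 hnorm)

lemma tr_rinner_self_nonneg (m : M) (x : X) : 0 ≤ Cl.tr (K.rinner m m x) := by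
  obtain ⟨g, hg⟩ := K.rinner_nonneg m
  rw [hg]
  rcases eq_or_ne (g x) 0 with h0 | h0
  · simp [h0]
  · exact (Cl.tr_star_mul_self_pos h0).le

/-- The scalar-valued inner product `tr ⟪m, n⟫ x`, to which the Cauchy-Schwarz inequality
applies. -/
abbrev trCore (x : X) : PreInnerProductSpace.Core ℂ M where
  inner m n := Cl.tr (K.rinner m n x)
  conj_inner_symm m n := by rw [K.rinner_symm m n, Cl.tr_star]
  re_inner_nonneg m := (Complex.nonneg_iff.1 (K.tr_rinner_self_nonneg m x)).1
  add_left m n p := by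
    rw [map_add, LinearMap.add_apply, ZeroAtInftyContinuousMap.add_apply, map_add]
  smul_left m n c := by
    rw [LinearMap.map_smulₛₗ, LinearMap.smul_apply, ZeroAtInftyContinuousMap.smul_apply, map_smul,
      smul_eq_mul]

lemma norm_tr_rinner_sq_le (m n : M) (x : X) :
    ‖Cl.tr (K.rinner m n x)‖ ^ 2 ≤ ‖K.rinner m m x‖ * ‖K.rinner n n x‖ := by
  have hre : ∀ p, (Cl.tr (K.rinner p p x)).re ≤ ‖K.rinner p p x‖ := fun p =>
    (Complex.re_le_norm _).trans (Cl.norm_tr_le _)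
  let : PreInnerProductSpace.Core ℂ M := K.trCore x
  have hcs : ‖Cl.tr (K.rinner m n x)‖ * ‖Cl.tr (K.rinner n m x)‖ ≤
      (Cl.tr (K.rinner m m x)).re * (Cl.tr (K.rinner n n x)).re :=
    InnerProductSpace.Core.inner_mul_inner_self_le (𝕜 := ℂ) m n
  rw [K.rinner_symm n m, Cl.tr_star, RCLike.norm_conj, ← sq] at hcs
  refine hcs.trans (mul_le_mul (hre m) (hre n) ?_ (norm_nonneg _))
  exact (Complex.nonneg_iff.1 (K.tr_rinner_self_nonneg n x)).1

lemma norm_tr_rinner_le (m n : M) (x : X) : ‖Cl.tr (K.rinner m n x)‖ ≤ ‖m‖ * ‖n‖ := by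
  refine abs_le_of_sq_le_sq' ?_ (by positivity) |>.2
  rw [mul_pow]
  exact (K.norm_tr_rinner_sq_le m n x).trans (mul_le_mul (K.norm_rinner_apply_le m x)
    (K.norm_rinner_apply_le n x) (norm_nonneg _) (by positivity))

lemma continuous_tr_rinner (m : M) (x : X) : Continuous fun n => Cl.tr (K.rinner m n x) :=
  AddMonoidHomClass.continuous_of_bound
    (Cl.tr ∘ₗ (evalC0 (ClAB a b) x).toLinearMap ∘ₗ K.rinner m) ‖m‖
    fun n => K.norm_tr_rinner_le m n x

lemma norm_ract_le (g : TrivCl X a b) (m : M) : ‖K.ract g m‖ ≤ ‖m‖ * ‖g‖ := by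
  refine K.norm_le_of_rinner (by positivity) fun x => ?_
  rw [rinner_ract_apply, rinner_ract_left_apply]
  calc ‖star (g x) * K.rinner m m x * g x‖ ≤ ‖star (g x)‖ * ‖K.rinner m m x‖ * ‖g x‖ :=
        norm_mul₃_le
    _ = ‖g x‖ * ‖K.rinner m m x‖ * ‖g x‖ := by rw [norm_star]
    _ ≤ ‖g‖ * ‖m‖ ^ 2 * ‖g‖ := by
        gcongr
        exacts [norm_c0_apply_le g x, K.norm_rinner_apply_le m x, norm_c0_apply_le g x]
    _ = (‖m‖ * ‖g‖) ^ 2 := by ring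

variable [T2Space X] [LocallyCompactSpace X]

lemma eval_eq_of_tr {x : X} {n n' : M}
    (h : ∀ m, Cl.tr (K.rinner m n x) = Cl.tr (K.rinner m n' x)) : K.eval x n = K.eval x n' := by
  rw [← sub_eq_zero, ← map_sub]
  refine LinearMap.ext fun m => ?_
  obtain ⟨g, hg⟩ := exists_c0_apply_eq x (K.rinner m (n - n') x)
  have htr : Cl.tr (K.rinner (K.ract g m) (n - n') x) = 0 := by
    rw [← eval_apply, map_sub, LinearMap.sub_apply, map_sub, eval_apply, eval_apply, h, sub_self]
  rw [rinner_ract_left_apply, hg] at htr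
  exact Cl.eq_zero_of_tr_star_mul_self htr

lemma eval_eq_zero_of_rinner_self {x : X} {n : M} (h : K.rinner n n x = 0) : K.eval x n = 0 := by
  rw [← map_zero (K.eval x)]
  refine K.eval_eq_of_tr fun m => ?_
  have hle := K.norm_tr_rinner_sq_le m n x
  rw [h, norm_zero, mul_zero] at hle
  have hm0 : K.rinner m 0 x = 0 := by rw [map_zero]; rfl
  rw [hm0, map_zero]
  exact norm_eq_zero.1 (pow_eq_zero_iff two_ne_zero |>.1 (le_antisymm hle (by positivity)))

lemma span_rinner_apply (x : X) :
    Submodule.span ℂ (Set.range fun p : M × M => K.rinner p.1 p.2 x) = ⊤ := by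
  let S := Submodule.span ℂ (Set.range fun p : M × M => K.rinner p.1 p.2)
  let T := Submodule.span ℂ (Set.range fun p : M × M => K.rinner p.1 p.2 x)
  have hmap : S.map (evalC0 (ClAB a b) x).toLinearMap = T := by
    rw [Submodule.map_span, ← Set.range_comp]
    rfl
  have hsurj : Function.Surjective (evalC0 (ClAB a b) x) := exists_c0_apply_eq x
  have hdense : Dense (T : Set (ClAB a b)) := by
    rw [← hmap]
    exact hsurj.denseRange.dense_image (evalC0 (ClAB a b) x).continuous K.rinner_full
  have hclosed : IsClosed (T : Set (ClAB a b)) := Submodule.closed_of_finiteDimensional T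
  exact SetLike.coe_injective (hclosed.closure_eq.symm.trans hdense.closure_eq)

lemma exists_sum_rinner_eq_one (x : X) :
    ∃ (k : ℕ) (p q : Fin k → M), ∑ i, K.rinner (p i) (q i) x = 1 := by
  obtain ⟨k, z, v, hv⟩ :=
    Submodule.mem_span_set'.1 ((K.span_rinner_apply x).symm ▸ Submodule.mem_top (x := 1))
  choose s hs using fun i => (v i).2
  refine ⟨k, fun i => (s i).1, fun i => z i • (s i).2, hv ▸ Finset.sum_congr rfl fun i _ => ?_⟩
  rw [map_smul, ZeroAtInftyContinuousMap.smul_apply]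
  exact congrArg _ (hs i)

lemma exists_tr_rinner_self_pos (x : X) : ∃ m, 0 < Cl.tr (K.rinner m m x) := by
  by_contra h
  push Not at h
  have hzero : ∀ m, K.eval x m = 0 := fun m => K.eval_eq_zero_of_rinner_self <| by
    obtain ⟨g, hg⟩ := K.rinner_nonneg m
    have htr := (K.tr_rinner_self_nonneg m x).eq_of_not_lt (h m)
    rw [hg] at htr ⊢
    have hgx : g x = 0 := Cl.eq_zero_of_tr_star_mul_self htr.symm
    rw [ZeroAtInftyContinuousMap.mul_apply, hgx, mul_zero]
  obtain ⟨k, p, q, hpq⟩ := K.exists_sum_rinner_eq_one x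
  refine one_ne_zero (α := ClAB a b) (hpq.symm.trans (Finset.sum_eq_zero fun i _ => ?_))
  rw [← eval_apply, hzero, LinearMap.zero_apply]

lemma eq_of_forall_rinner_mul_eq (x : X) {c d : ClAB a b}
    (h : ∀ m n, K.rinner m n x * c = K.rinner m n x * d) : c = d := by
  obtain ⟨k, p, q, hpq⟩ := K.exists_sum_rinner_eq_one x
  rw [← one_mul c, ← one_mul d, ← hpq, Finset.sum_mul, Finset.sum_mul]
  exact Finset.sum_congr rfl fun i _ => h (p i) (q i)

end KROrientation

/-! ### Intertwiners -/

/-- The algebra automorphism by which an element of a Clifford algebra changes when it is commuted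
past an element of parity `ε`: the identity if `ε = 1`, the grading if `ε = -1`. -/
def Cl.twist {V : Type*} [NormedAddCommGroup V] [InnerProductSpace ℝ V] (ε : ℤˣ) :
    Cl V →ₐ[ℂ] Cl V :=
  if ε = 1 then AlgHom.id ℂ (Cl V) else Cl.grade

namespace Cl

variable {V : Type*} [NormedAddCommGroup V] [InnerProductSpace ℝ V]

@[simp] lemma twist_one (c : Cl V) : twist 1 c = c := by
  rw [twist, if_pos rfl, AlgHom.id_apply]

@[simp] lemma twist_neg_one (c : Cl V) : twist (-1) c = grade c := by
  rw [twist, if_neg (by decide)]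

lemma twist_γ (ε : ℤˣ) (v : V) : twist ε (γ v) = ε • γ v := by
  rcases Int.units_eq_one_or ε with rfl | rfl
  · rw [twist_one, one_smul]
  · rw [twist_neg_one, grade_γ, Units.neg_smul, one_smul]

end Cl

section InvariantForms

variable {X : Type*} [TopologicalSpace X] {r : RealStructure X} {E : EquivariantBundle r} {a b : ℕ}
  {M : Type*} [NormedAddCommGroup M] [NormedSpace ℂ M] [CompleteSpace M]
  {K : KROrientation E a b M} {x : X} {ε : ℤˣ} {Q : M → M → ClAB a b}

/-- A form of parity `ε` on the fibre of `M` over `x` that is compatible with both actions and with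
the grading. -/
structure IsInvariantForm (K : KROrientation E a b M) (x : X) (ε : ℤˣ) (Q : M → M → ClAB a b) :
    Prop where
  ract_right : ∀ m n g, Q m (K.ract g n) = Q m n * Cl.twist ε (g x)
  ract_left : ∀ m n g, Q (K.ract g m) n = star (g x) * Q m n
  lact_left : ∀ f m n, Q (K.lact f m) n = Q m (K.lact (star f) n)
  grade_apply : ∀ m n, Cl.grade (Q m n) = ε • Q (K.grade m) (K.grade n)

namespace IsInvariantForm

/-- Both sides are the value of `Q` at `m` and `⟪n, m'⟫ n' = n ⟪m', n'⟫`. -/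
lemma mul_twist_rinner (hQ : IsInvariantForm K x ε Q) (m n m' n' : M) :
    Q m n * Cl.twist ε (K.rinner m' n' x) = K.rinner m n x * Q m' n' := calc
  Q m n * Cl.twist ε (K.rinner m' n' x) = Q m (K.lact (K.linner n m') n') := by
    rw [← hQ.ract_right, K.linner_rinner]
  _ = Q (K.lact (K.linner m' n) m) n' := by rw [hQ.lact_left, K.star_linner]
  _ = K.rinner m n x * Q m' n' := by rw [K.linner_rinner, hQ.ract_left, ← K.rinner_symm]

variable [T2Space X] [LocallyCompactSpace X]

lemma exists_eq_rinner_mul (hQ : IsInvariantForm K x ε Q) :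
    ∃ d, ∀ m n, Q m n = K.rinner m n x * d := by
  obtain ⟨k, p, q, hpq⟩ := K.exists_sum_rinner_eq_one x
  refine ⟨∑ i, Q (p i) (q i), fun m n => ?_⟩
  simp only [Finset.mul_sum, ← hQ.mul_twist_rinner]
  rw [← Finset.mul_sum, ← map_sum, hpq, map_one, mul_one]

lemma mul_twist_eq (hQ : IsInvariantForm K x ε Q) {d : ClAB a b}
    (hd : ∀ m n, Q m n = K.rinner m n x * d) (c : ClAB a b) : d * Cl.twist ε c = c * d := by
  obtain ⟨g, rfl⟩ := exists_c0_apply_eq x c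
  refine K.eq_of_forall_rinner_mul_eq x fun m n => ?_
  rw [← mul_assoc, ← hd, ← hQ.ract_right, hd, K.rinner_ract_apply, mul_assoc]

lemma grade_eq_smul (hQ : IsInvariantForm K x ε Q) {d : ClAB a b}
    (hd : ∀ m n, Q m n = K.rinner m n x * d) : Cl.grade d = ε • d := by
  refine K.eq_of_forall_rinner_mul_eq x fun m n => ?_
  have hmn : K.rinner m n x = Cl.grade (K.rinner (K.grade m) (K.grade n) x) := by
    rw [← K.rinner_grade_right, K.grade_grade]
  rw [hmn, ← map_mul, ← hd, hQ.grade_apply, K.grade_grade, K.grade_grade, hd, ← hmn, mul_smul_comm]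

/-- The ratio of `Q` to the inner product is supercentral in `Cl_{a,b}`, hence a scalar. -/
lemma exists_eq_smul (hQ : IsInvariantForm K x ε Q) :
    ∃ z : ℂ, ε • z = z ∧ ∀ m n, Q m n = z • K.rinner m n x := by
  obtain ⟨d, hd⟩ := hQ.exists_eq_rinner_mul
  have hgrade := hQ.grade_eq_smul hd
  obtain ⟨z, rfl⟩ := Cl.eq_algebraMap_of_supercentral fun v => by
    rw [hgrade, ← hQ.mul_twist_eq hd, Cl.twist_γ, mul_smul_comm, smul_mul_assoc]
  refine ⟨z, FaithfulSMul.algebraMap_injective ℂ (ClAB a b) ?_, fun m n => ?_⟩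
  · rw [AlgHom.commutes] at hgrade
    rw [Units.smul_def, map_zsmul, ← Units.smul_def, ← hgrade]
  · rw [hd, ← Algebra.commutes, Algebra.smul_def]

lemma eq_zero (hQ : IsInvariantForm K x (-1) Q) (m n : M) : Q m n = 0 := by
  obtain ⟨z, hz, h⟩ := hQ.exists_eq_smul
  rw [Units.neg_smul, one_smul, neg_eq_self] at hz
  rw [h, hz, zero_smul]

end IsInvariantForm

end InvariantForms

section Intertwiners

variable {X : Type*} [TopologicalSpace X] {r : RealStructure X} {E : EquivariantBundle r} {a b : ℕ}
  {M₁ : Type*} [NormedAddCommGroup M₁] [NormedSpace ℂ M₁] [CompleteSpace M₁]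
  {M₂ : Type*} [NormedAddCommGroup M₂] [NormedSpace ℂ M₂] [CompleteSpace M₂]

lemma EquivariantBundle.twistCl_twistCl_of_ne {ε δ : ℤˣ} (h : ε ≠ δ) (f : E.ClSection) :
    E.twistCl ε (E.twistCl δ f) = E.gradeCl f := by
  rcases Int.units_eq_one_or ε with rfl | rfl <;> rcases Int.units_eq_one_or δ with rfl | rfl <;>
    simp_all

/-- A homogeneous map of graded right modules, of either parity. -/
structure GradedHom (K₁ : KROrientation E a b M₁) (K₂ : KROrientation E a b M₂) where
  /-- The underlying linear map. -/
  toFun : M₁ →ₗ[ℂ] M₂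
  /-- The parity. -/
  sign : ℤˣ
  map_ract : ∀ g m, toFun (K₁.ract g m) = K₂.ract g (toFun m)
  map_grade : ∀ m, toFun (K₁.grade m) = sign • K₂.grade (toFun m)

/-- A homogeneous map of right modules that supercommutes with the left action. -/
structure Intertwiner (K₁ : KROrientation E a b M₁) (K₂ : KROrientation E a b M₂) extends
    GradedHom K₁ K₂ where
  map_lact : ∀ f m, toFun (K₁.lact f m) = K₂.lact (E.twistCl sign f) (toFun m)

namespace Intertwiner

variable {K₁ : KROrientation E a b M₁} {K₂ : KROrientation E a b M₂}

instance : CoeFun (Intertwiner K₁ K₂) fun _ => M₁ → M₂ := ⟨fun T => T.toFun⟩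

instance : SMul ℂ (Intertwiner K₁ K₂) where
  smul z S :=
    { toFun := z • S.toFun
      sign := S.sign
      map_ract := fun g m => by
        rw [LinearMap.smul_apply, S.map_ract, LinearMap.smul_apply, map_smul]
      map_lact := fun f m => by
        rw [LinearMap.smul_apply, S.map_lact, LinearMap.smul_apply, map_smul]
      map_grade := fun m => by
        rw [LinearMap.smul_apply, S.map_grade, LinearMap.smul_apply, map_smul, smul_comm] }

lemma smul_apply (z : ℂ) (S : Intertwiner K₁ K₂) (m : M₁) : (z • S) m = z • S m := rfl

/-- The "real" structure on intertwiners. -/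
def conj (S : Intertwiner K₁ K₂) : Intertwiner K₁ K₂ where
  toFun :=
    { toFun := fun m => K₂.conj (S (K₁.conj m))
      map_add' := fun m n => by rw [map_add, map_add, map_add]
      map_smul' := fun z m => by
        rw [LinearMap.map_smulₛₗ, map_smul, LinearMap.map_smulₛₗ, Complex.conj_conj,
          RingHom.id_apply] }
  sign := S.sign
  map_ract g m := by
    change K₂.conj (S (K₁.conj (K₁.ract g m))) = K₂.ract g (K₂.conj (S (K₁.conj m)))
    rw [K₁.conj_ract, S.map_ract, K₂.conj_ract, conjTriv_conjTriv]
  map_lact f m := by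
    change K₂.conj (S (K₁.conj (K₁.lact f m))) =
      K₂.lact (E.twistCl S.sign f) (K₂.conj (S (K₁.conj m)))
    rw [K₁.conj_lact, S.map_lact, K₂.conj_lact, EquivariantBundle.conjCl_twistCl,
      EquivariantBundle.conjCl_conjCl]
  map_grade m := by
    change K₂.conj (S (K₁.conj (K₁.grade m))) = S.sign • K₂.grade (K₂.conj (S (K₁.conj m)))
    rw [K₁.conj_grade, S.map_grade, Units.smul_def, map_zsmul, K₂.conj_grade, ← Units.smul_def]

lemma conj_apply (S : Intertwiner K₁ K₂) (m : M₁) : S.conj m = K₂.conj (S (K₁.conj m)) := rfl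

lemma conj_conj_apply (S : Intertwiner K₁ K₂) (m : M₁) : S.conj.conj m = S m := by
  rw [conj_apply, conj_apply, K₁.conj_conj, K₂.conj_conj]

lemma lact_apply (T : Intertwiner K₁ K₂) (f : E.ClSection) (m : M₁) :
    K₂.lact f (T m) = T (K₁.lact (E.twistCl T.sign f) m) := by
  rw [T.map_lact, EquivariantBundle.twistCl_twistCl]

lemma grade_apply (T : Intertwiner K₁ K₂) (m : M₁) :
    K₂.grade (T m) = T.sign • T (K₁.grade m) := by
  rw [T.map_grade, smul_smul, Int.units_mul_self, one_smul]

lemma rinner_ract (S T : Intertwiner K₁ K₂) (m n : M₁) (g : TrivCl X a b) (x : X) :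
    K₂.rinner (S m) (T (K₁.ract g n)) x = K₂.rinner (S m) (T n) x * g x := by
  rw [T.map_ract, K₂.rinner_ract_apply]

lemma rinner_ract_left (S T : Intertwiner K₁ K₂) (m n : M₁) (g : TrivCl X a b) (x : X) :
    K₂.rinner (S (K₁.ract g m)) (T n) x = star (g x) * K₂.rinner (S m) (T n) x := by
  rw [S.map_ract, K₂.rinner_ract_left_apply]

lemma rinner_lact (S T : Intertwiner K₁ K₂) (m n : M₁) (f : E.ClSection) :
    K₂.rinner (S (K₁.lact f m)) (T n) =
      K₂.rinner (S m) (T (K₁.lact (E.twistCl T.sign (E.twistCl S.sign (star f))) n)) := by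
  rw [S.map_lact, K₂.rinner_lact, T.lact_apply, EquivariantBundle.twistCl_star,
    EquivariantBundle.twistCl_star, EquivariantBundle.twistCl_star]

lemma grade_rinner (S T : Intertwiner K₁ K₂) (m n : M₁) (x : X) :
    Cl.grade (K₂.rinner (S m) (T n) x) =
      (S.sign * T.sign) • K₂.rinner (S (K₁.grade m)) (T (K₁.grade n)) x := by
  rw [K₂.grade_rinner_apply, S.grade_apply, T.grade_apply,
    K₂.rinner_units_smul_units_smul]

lemma isInvariantForm_of_sign_eq {S T : Intertwiner K₁ K₂} (h : S.sign = T.sign) (x : X) :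
    IsInvariantForm K₁ x 1 fun m n => K₂.rinner (S m) (T n) x where
  ract_right m n g := by rw [rinner_ract, Cl.twist_one]
  ract_left m n g := rinner_ract_left S T m n g x
  lact_left f m n := by rw [rinner_lact, h, EquivariantBundle.twistCl_twistCl]
  grade_apply m n := by rw [grade_rinner, h, Int.units_mul_self]

lemma isInvariantForm_of_sign_ne {S T : Intertwiner K₁ K₂} (h : S.sign ≠ T.sign) (x : X) :
    IsInvariantForm K₁ x (-1) fun m n => K₂.rinner (S m) (T (K₁.grade n)) x where
  ract_right m n g := by
    rw [K₁.grade_ract, rinner_ract, Cl.twist_neg_one]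
    rfl
  ract_left m n g := rinner_ract_left S T m _ g x
  lact_left f m n := by
    rw [rinner_lact, EquivariantBundle.twistCl_twistCl_of_ne h.symm, K₁.grade_lact]
  grade_apply m n := by
    have hsign : S.sign * T.sign = -1 := by
      rw [Int.units_ne_iff_eq_neg.1 h, neg_mul, Int.units_mul_self]
    rw [grade_rinner, hsign]

variable [T2Space X] [LocallyCompactSpace X]

lemma rinner_eq_zero_of_sign_ne {S T : Intertwiner K₁ K₂} (h : S.sign ≠ T.sign) (m n : M₁) (x : X) :
    K₂.rinner (S m) (T n) x = 0 := by
  simpa only [K₁.grade_grade] using (isInvariantForm_of_sign_ne h x).eq_zero m (K₁.grade n)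

lemma exists_rinner_eq_smul (S T : Intertwiner K₁ K₂) (x : X) :
    ∃ z : ℂ, ∀ m n, K₂.rinner (S m) (T n) x = z • K₁.rinner m n x := by
  by_cases h : S.sign = T.sign
  · obtain ⟨z, -, hz⟩ := (isInvariantForm_of_sign_eq h x).exists_eq_smul
    exact ⟨z, hz⟩
  · exact ⟨0, fun m n => by rw [rinner_eq_zero_of_sign_ne h, zero_smul]⟩

/-- The inner product of the values at `x` of two intertwiners, as elements of the line of
fibrewise intertwiners. -/
def coef (S T : Intertwiner K₁ K₂) (x : X) : ℂ := (exists_rinner_eq_smul S T x).choose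

lemma rinner_apply (S T : Intertwiner K₁ K₂) (m n : M₁) (x : X) :
    K₂.rinner (S m) (T n) x = coef S T x • K₁.rinner m n x :=
  (exists_rinner_eq_smul S T x).choose_spec m n

lemma coef_eq {S T : Intertwiner K₁ K₂} {x : X} {z : ℂ}
    (h : ∀ m n, K₂.rinner (S m) (T n) x = z • K₁.rinner m n x) : coef S T x = z := by
  obtain ⟨m, hm⟩ := K₁.exists_tr_rinner_self_pos x
  have htr := congrArg Cl.tr (h m m)
  rw [rinner_apply, map_smul, map_smul] at htr
  exact mul_right_cancel₀ hm.ne' htr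

lemma coef_of_sign_ne {S T : Intertwiner K₁ K₂} (h : S.sign ≠ T.sign) (x : X) : coef S T x = 0 :=
  coef_eq fun m n => by rw [rinner_eq_zero_of_sign_ne h, zero_smul]

lemma star_coef (S T : Intertwiner K₁ K₂) (x : X) : star (coef S T x) = coef T S x :=
  (coef_eq fun m n => by
    rw [K₂.rinner_symm, rinner_apply, star_smul, ← K₁.rinner_symm]).symm

lemma coef_smul_smul (z w : ℂ) (S T : Intertwiner K₁ K₂) (x : X) :
    coef (z • S) (w • T) x = star z * w * coef S T x :=
  coef_eq fun m n => by
    rw [smul_apply, smul_apply, K₂.rinner_smul_left_apply, K₂.rinner_smul_apply, rinner_apply,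
      smul_smul, smul_smul, mul_assoc]

lemma coef_conj_conj (S T : Intertwiner K₁ K₂) (x : X) :
    coef S.conj T.conj x = star (coef S T (r x)) :=
  coef_eq fun m n => by
    have hsmul : ∀ (z : ℂ) (c : ClAB a b), conjAB a b (z • c) = star z • conjAB a b c :=
      Cl.conjMap_smul _
    rw [conj_apply, conj_apply, K₂.rinner_conj_right, K₂.conj_conj, rinner_apply, hsmul,
      ← K₁.rinner_conj_right, K₁.conj_conj]

lemma coef_conj_left (S T : Intertwiner K₁ K₂) (x : X) :
    coef S.conj T x = star (coef S T.conj (r x)) := by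
  rw [← coef_conj_conj]
  exact coef_eq fun m n => by rw [← conj_conj_apply T, rinner_apply]

lemma continuous_coef (S T : Intertwiner K₁ K₂) : Continuous (coef S T) := by
  rw [continuous_iff_continuousAt]
  intro x
  obtain ⟨m, hm⟩ := K₁.exists_tr_rinner_self_pos x
  have htr : Continuous (Cl.tr : ClAB a b → ℂ) := LinearMap.continuous_of_finiteDimensional _
  have h₁ : Continuous fun y => Cl.tr (K₁.rinner m m y) := htr.comp (K₁.rinner m m).continuous
  have h₂ : Continuous fun y => Cl.tr (K₂.rinner (S m) (T m) y) :=
    htr.comp (K₂.rinner (S m) (T m)).continuous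
  refine (h₂.continuousAt.div h₁.continuousAt hm.ne').congr ?_
  filter_upwards [h₁.continuousAt.eventually_ne hm.ne'] with y hy
  rw [Pi.div_apply, rinner_apply, map_smul, smul_eq_mul, mul_div_cancel_right₀ _ hy]

lemma coef_self_nonneg (S : Intertwiner K₁ K₂) (x : X) : 0 ≤ coef S S x := by
  obtain ⟨m, hm⟩ := K₁.exists_tr_rinner_self_pos x
  have hS := K₂.tr_rinner_self_nonneg (S m) x
  rw [rinner_apply, map_smul, smul_eq_mul] at hS
  exact le_of_mul_le_mul_right (by rwa [zero_mul]) hm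

/-- Write `n` as a sum of terms `n ⟪S p, S q⟫ = ⟪n, S p⟫ (S q)`. -/
lemma exists_eval_eq {S : Intertwiner K₁ K₂} {x : X} (h : coef S S x ≠ 0) (n : M₂) :
    ∃ m, K₂.eval x (S m) = K₂.eval x n := by
  obtain ⟨k, p, q, hpq⟩ := K₁.exists_sum_rinner_eq_one x
  refine ⟨(coef S S x)⁻¹ • ∑ i, K₁.lact (E.twistCl S.sign (K₂.linner n (S (p i)))) (q i),
    LinearMap.ext fun m => ?_⟩
  simp only [map_smul, map_sum, ← S.lact_apply, K₂.linner_rinner, LinearMap.smul_apply,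
    LinearMap.sum_apply, KROrientation.eval_apply, K₂.rinner_ract_apply]
  simp only [rinner_apply, mul_smul_comm, ← Finset.smul_sum]
  rw [smul_smul, inv_mul_cancel₀ h, one_smul, ← Finset.mul_sum, hpq, mul_one]

lemma coef_smul_eval (S T : Intertwiner K₁ K₂) (x : X) (m : M₁) :
    coef S S x • K₂.eval x (T m) = coef S T x • K₂.eval x (S m) := by
  by_cases h : coef S S x = 0
  · have hS : K₂.eval x (S m) = 0 :=
      K₂.eval_eq_zero_of_rinner_self (by rw [rinner_apply, h, zero_smul])
    rw [h, hS, zero_smul, smul_zero]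
  · refine LinearMap.ext fun n => ?_
    obtain ⟨m', hm'⟩ := exists_eval_eq h n
    simp only [LinearMap.smul_apply, KROrientation.eval_apply,
      ← KROrientation.rinner_congr hm' rfl]
    rw [rinner_apply, rinner_apply, smul_smul, smul_smul, mul_comm]

lemma coef_mul_coef (S T U : Intertwiner K₁ K₂) (x : X) :
    coef U S x * coef S T x = coef S S x * coef U T x := by
  obtain ⟨m, hm⟩ := K₁.exists_tr_rinner_self_pos x
  have h := congrArg Cl.tr (LinearMap.congr_fun (coef_smul_eval S T x m) (U m))
  simp only [LinearMap.smul_apply, KROrientation.eval_apply, rinner_apply, map_smul, smul_smul,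
    smul_eq_mul] at h
  rw [mul_comm (coef U S x), ← mul_right_cancel₀ hm.ne' h]

end Intertwiner

end Intertwiners

/-! ### Existence of intertwiners -/

section BumpSections

variable {𝕜 : Type*} [RCLike 𝕜] {X : Type*} [TopologicalSpace X]
  {V : X → Type*} [∀ x, NormedAddCommGroup (V x)] [∀ x, InnerProductSpace 𝕜 (V x)]
  [TopologicalSpace (TotalSpace Unit V)] {n : ℕ}

open Classical in
/-- The vector field that is constantly `w` in a local trivialisation, multiplied by a function and
extended by zero. -/
def bumpField (e : IsometricTriv 𝕜 V n) (χ : X → ℝ) (w : EuclideanSpace 𝕜 (Fin n)) (x : X) : V x :=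
  if h : x ∈ e.baseSet then (χ x : 𝕜) • (e.coord ⟨x, h⟩).symm w else 0

lemma bumpField_of_mem (e : IsometricTriv 𝕜 V n) (χ : X → ℝ) (w : EuclideanSpace 𝕜 (Fin n)) {x : X}
    (h : x ∈ e.baseSet) : bumpField e χ w x = (χ x : 𝕜) • (e.coord ⟨x, h⟩).symm w := dif_pos h

lemma bumpField_of_eq_zero (e : IsometricTriv 𝕜 V n) {χ : X → ℝ} (w : EuclideanSpace 𝕜 (Fin n))
    {x : X} (h : χ x = 0) : bumpField e χ w x = 0 := by
  rw [bumpField]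
  split_ifs
  · rw [h, RCLike.ofReal_zero, zero_smul]
  · rfl

lemma norm_bumpField_le (e : IsometricTriv 𝕜 V n) (χ : X → ℝ) (w : EuclideanSpace 𝕜 (Fin n))
    (x : X) : ‖bumpField e χ w x‖ ≤ |χ x| * ‖w‖ := by
  rw [bumpField]
  split_ifs
  · rw [norm_smul, LinearIsometryEquiv.norm_map, RCLike.norm_ofReal]
  · rw [norm_zero]
    positivity

lemma continuousSection_bumpField [IsMetricBundle 𝕜 V] (e : IsometricTriv 𝕜 V n) {χ : X → ℝ}
    (hχ : Continuous χ) (hsupp : tsupport χ ⊆ e.baseSet) (w : EuclideanSpace 𝕜 (Fin n)) :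
    ContinuousSection (bumpField e χ w) := by
  rw [ContinuousSection, continuous_iff_continuousAt]
  intro x
  by_cases hx : x ∈ e.baseSet
  · have hcoord : Continuous fun y : e.baseSet => (χ y : 𝕜) • w :=
      Continuous.fun_smul (RCLike.continuous_ofReal.comp (hχ.comp continuous_subtype_val))
        continuous_const
    have hbase : Continuous fun y : e.baseSet =>
        (⟨y, bumpField e χ w y⟩ : TotalSpace Unit V) := by
      refine (e.continuous_coord_symm.comp (continuous_id.prodMk hcoord)).congr fun y => ?_
      rw [bumpField_of_mem e χ w y.2, ← map_smul]
      rfl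
    exact (e.isOpen_baseSet.isOpenEmbedding_subtypeVal.continuousAt_iff (x := ⟨x, hx⟩)).1
      hbase.continuousAt
  · have hzero : Continuous fun y => (⟨y, (0 : ∀ x, V x) y⟩ : TotalSpace Unit V) :=
      (C0Section 𝕜 V).zero_mem.1
    refine hzero.continuousAt.congr ?_
    filter_upwards [(isClosed_tsupport χ).isOpen_compl.mem_nhds fun h => hx (hsupp h)] with y hy
    rw [bumpField_of_eq_zero e w (image_eq_zero_of_notMem_tsupport hy)]
    rfl

/-- The vector field `bumpField` for a cutoff function, as a section. -/
def bumpSection [IsMetricBundle 𝕜 V] (e : IsometricTriv 𝕜 V n) (χ : C_c(X, ℝ))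
    (hχ : tsupport χ ⊆ e.baseSet) (w : EuclideanSpace 𝕜 (Fin n)) : C0Section 𝕜 V :=
  ⟨bumpField e χ w, continuousSection_bumpField e χ.continuous hχ w,
    squeeze_zero (fun _ => norm_nonneg _) (norm_bumpField_le e χ w) <| by
      simpa only [abs_zero, zero_mul] using
        χ.hasCompactSupport.is_zero_at_infty.abs.mul_const ‖w‖⟩

lemma inner_bumpSection [IsMetricBundle 𝕜 V] (e : IsometricTriv 𝕜 V n) (χ : C_c(X, ℝ))
    (hχ : tsupport χ ⊆ e.baseSet) (v w : EuclideanSpace 𝕜 (Fin n)) (x : X) :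
    inner 𝕜 ((bumpSection e χ hχ v).1 x) ((bumpSection e χ hχ w).1 x) =
      (χ x : 𝕜) * χ x * inner 𝕜 v w := by
  change inner 𝕜 (bumpField e χ v x) (bumpField e χ w x) = _
  by_cases hx : x ∈ e.baseSet
  · rw [bumpField_of_mem e χ _ hx, bumpField_of_mem e χ _ hx, inner_smul_left, inner_smul_right,
      LinearIsometryEquiv.inner_map_map, RCLike.conj_ofReal, mul_assoc]
  · have hx0 : χ x = 0 := image_eq_zero_of_notMem_tsupport fun h => hx (hχ h)
    rw [bumpField_of_eq_zero e _ hx0, inner_zero_left, hx0, RCLike.ofReal_zero, zero_mul, zero_mul]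

variable (𝕜) in
lemma exists_section_apply_eq [T2Space X] [LocallyCompactSpace X] [IsMetricBundle 𝕜 V] (x : X)
    (v : V x) : ∃ s : C0Section 𝕜 V, s.1 x = v := by
  obtain ⟨n, e, hx⟩ := IsMetricBundle.exists_triv (𝕜 := 𝕜) (V := V) x
  obtain ⟨χ, hχx, hχ⟩ := exists_cutoff_apply_eq_one e.isOpen_baseSet hx
  refine ⟨bumpSection e χ hχ (e.coord ⟨x, hx⟩ v), (bumpField_of_mem e χ _ hx).trans ?_⟩
  rw [hχx, RCLike.ofReal_one, one_smul, LinearIsometryEquiv.symm_apply_apply]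

end BumpSections

namespace EquivariantBundle

variable {X : Type*} [TopologicalSpace X] {r : RealStructure X} {E : EquivariantBundle r}

/-- A section of `E` as a section of the Clifford algebra bundle. -/
def clSection (s : C0Section ℝ E.fiber) : E.ClSection :=
  ⟨fun x => Cl.γ (s.1 x), by
    intro n e
    simp only [Cl.map_γ]
    exact Cl.continuous_γ.comp ((continuousSection_iff ℝ).1 s.2.1 n e), by
    simpa only [Cl.norm_γ] using s.2.2⟩

lemma gradeCl_clSection (s : C0Section ℝ E.fiber) : E.gradeCl (clSection s) = -clSection s :=
  Subtype.ext (funext fun _ => Cl.grade_γ _)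

lemma clSection_mul_of_inner_eq_zero {s t : C0Section ℝ E.fiber}
    (h : ∀ x, inner ℝ (s.1 x) (t.1 x) = 0) :
    clSection s * clSection t = -(clSection t * clSection s) :=
  Subtype.ext (funext fun x => Cl.γ_anticomm (h x))

lemma clSection_mul_self {s : C0Section ℝ E.fiber} {q : C₀(X, ℂ)}
    (h : ∀ x, ((inner ℝ (s.1 x) (s.1 x) : ℝ) : ℂ) = q x) :
    clSection s * clSection s = E.scalarCl q := by
  refine Subtype.ext (funext fun x => (Cl.γ_mul_self (s.1 x)).trans ?_)
  rw [← real_inner_self_eq_norm_sq, h]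
  rfl

section Generation

variable [T2Space X] [LocallyCompactSpace X] {D : NonUnitalSubalgebra ℂ E.ClSection} {x : X}

lemma exists_mem_apply_eq_of_γ (hscalar : ∀ h, E.scalarCl h ∈ D)
    (hγ : ∀ v, ∃ f ∈ D, f.1 x = Cl.γ v) (c : Cl (E.fiber x)) : ∃ f ∈ D, f.1 x = c := by
  have hc : c ∈ Algebra.adjoin ℂ (Set.range (Cl.γ : E.fiber x → Cl (E.fiber x))) := by
    rw [Cl.adjoin_γ]
    exact Algebra.mem_top
  induction hc using Algebra.adjoin_induction with
  | mem c hc =>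
    obtain ⟨v, rfl⟩ := hc
    exact hγ v
  | algebraMap z =>
    obtain ⟨h, rfl⟩ := exists_c0_apply_eq x z
    exact ⟨E.scalarCl h, hscalar h, rfl⟩
  | add c d _ _ hc hd =>
    obtain ⟨f, hf, rfl⟩ := hc
    obtain ⟨g, hg, rfl⟩ := hd
    exact ⟨f + g, add_mem hf hg, rfl⟩
  | mul c d _ _ hc hd =>
    obtain ⟨f, hf, rfl⟩ := hc
    obtain ⟨g, hg, rfl⟩ := hd
    exact ⟨f * g, mul_mem hf hg, rfl⟩

lemma exists_mem_apply_eq (hscalar : ∀ h, E.scalarCl h ∈ D) {s : Set (E.fiber x)}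
    (hs : Submodule.span ℝ s = ⊤) (hγ : ∀ v ∈ s, ∃ f ∈ D, f.1 x = Cl.γ v) (c : Cl (E.fiber x)) :
    ∃ f ∈ D, f.1 x = c := by
  refine exists_mem_apply_eq_of_γ hscalar (fun v => ?_) c
  have hsmul : ∀ (t : ℝ) (v : E.fiber x), (∃ f ∈ D, f.1 x = Cl.γ v) →
      ∃ f ∈ D, f.1 x = Cl.γ (t • v) := by
    rintro t v ⟨f, hf, hfv⟩
    refine ⟨(t : ℂ) • f, SMulMemClass.smul_mem _ hf, ?_⟩
    rw [Cl.γ_smul, ← hfv]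
    rfl
  have hv : v ∈ Submodule.span ℝ s := hs ▸ Submodule.mem_top
  induction hv using Submodule.span_induction with
  | mem v hv => exact hγ v hv
  | zero =>
    refine ⟨0, zero_mem D, ?_⟩
    rw [← zero_smul ℝ (0 : E.fiber x), Cl.γ_smul, Complex.ofReal_zero, zero_smul]
    rfl
  | add v w _ _ hv hw =>
    obtain ⟨f, hf, hfv⟩ := hv
    obtain ⟨g, hg, hgw⟩ := hw
    refine ⟨f + g, add_mem hf hg, ?_⟩
    rw [Cl.γ_add, ← hfv, ← hgw]
    rfl
  | smul t v _ hv => exact hsmul t v hv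

end Generation

section LocalFrame

variable {n : ℕ} (e : IsometricTriv ℝ E.fiber n) (χ : C_c(X, ℝ)) (hχ : tsupport χ ⊆ e.baseSet)

/-- The `i`-th vector of the orthonormal frame of `E` given by a local trivialisation, multiplied by
a cutoff function, as a section of the Clifford algebra bundle. -/
def frameSection (i : Fin n) : E.ClSection :=
  clSection (bumpSection e χ hχ (EuclideanSpace.basisFun (Fin n) ℝ i))

lemma frameSection_apply (i : Fin n) {x : X} (hx : x ∈ e.baseSet) :
    (frameSection e χ hχ i).1 x = (χ x : ℂ) •
      Cl.γ ((e.coord ⟨x, hx⟩).symm (EuclideanSpace.basisFun (Fin n) ℝ i)) := by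
  rw [← Cl.γ_smul]
  exact congrArg Cl.γ (bumpField_of_mem e χ _ hx)

lemma frameSection_mul_self (i : Fin n) :
    frameSection e χ hχ i * frameSection e χ hχ i = E.scalarCl (ofRealC0 χ * ofRealC0 χ) :=
  clSection_mul_self fun x => by
    rw [inner_bumpSection, real_inner_self_eq_norm_sq,
      (EuclideanSpace.basisFun (Fin n) ℝ).orthonormal.1 i, one_pow, mul_one]
    exact Complex.ofReal_mul _ _

lemma frameSection_mul_frameSection {i j : Fin n} (hij : i ≠ j) :
    frameSection e χ hχ i * frameSection e χ hχ j =
      -(frameSection e χ hχ j * frameSection e χ hχ i) :=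
  clSection_mul_of_inner_eq_zero fun x => by
    rw [inner_bumpSection, (EuclideanSpace.basisFun (Fin n) ℝ).orthonormal.2 hij, mul_zero]

variable {e χ} in
lemma exists_mem_apply_eq_of_frameSection [T2Space X] [LocallyCompactSpace X]
    {D : NonUnitalSubalgebra ℂ E.ClSection} (hscalar : ∀ h, E.scalarCl h ∈ D)
    (hframe : ∀ i, frameSection e χ hχ i ∈ D) {x : X} (hx : χ x ≠ 0) (c : Cl (E.fiber x)) :
    ∃ f ∈ D, f.1 x = c := by
  have hxe : x ∈ e.baseSet := hχ (subset_tsupport χ hx)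
  let basis := (EuclideanSpace.basisFun (Fin n) ℝ).map (e.coord ⟨x, hxe⟩).symm
  refine exists_mem_apply_eq hscalar (s := Set.range basis)
    (by rw [← OrthonormalBasis.coe_toBasis, Module.Basis.span_eq]) ?_ c
  rintro _ ⟨i, rfl⟩
  refine ⟨(χ x : ℂ)⁻¹ • frameSection e χ hχ i, SMulMemClass.smul_mem _ (hframe i), ?_⟩
  change (χ x : ℂ)⁻¹ • (frameSection e χ hχ i).1 x = _
  rw [frameSection_apply e χ hχ i hxe, smul_smul, inv_mul_cancel₀ (Complex.ofReal_ne_zero.2 hx),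
    one_smul]
  rfl

end LocalFrame

end EquivariantBundle

section Existence

variable {X : Type*} [TopologicalSpace X] {r : RealStructure X} {E : EquivariantBundle r} {a b : ℕ}
  {M₁ : Type*} [NormedAddCommGroup M₁] [NormedSpace ℂ M₁] [CompleteSpace M₁]
  {M₂ : Type*} [NormedAddCommGroup M₂] [NormedSpace ℂ M₂] [CompleteSpace M₂]
  {K₁ : KROrientation E a b M₁} {K₂ : KROrientation E a b M₂}

namespace KROrientation

lemma lact_grade_of_odd (K : KROrientation E a b M₁) {g : E.ClSection} (hg : E.gradeCl g = -g)
    (m : M₁) : K.lact g (K.grade m) = -K.grade (K.lact g m) := by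
  rw [K.grade_lact, hg, map_neg, LinearMap.neg_apply, neg_neg]

lemma lact_lact_of_anticomm (K : KROrientation E a b M₁) {f g : E.ClSection}
    (h : g * f = -(f * g)) (m : M₁) : K.lact g (K.lact f m) = -K.lact f (K.lact g m) := by
  rw [← K.lact_mul, h, map_neg, LinearMap.neg_apply, K.lact_mul]

end KROrientation

namespace GradedHom

instance : CoeFun (GradedHom K₁ K₂) fun _ => M₁ → M₂ := ⟨fun S => S.toFun⟩

/-- The parity `ε` part of the rank one map `m ↦ p ⟪m', m⟫`. -/
def rankOne (K₁ : KROrientation E a b M₁) (K₂ : KROrientation E a b M₂) (m' : M₁) (p : M₂)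
    (ε : ℤˣ) : GradedHom K₁ K₂ where
  toFun := K₂.ract.flip p ∘ₗ K₁.rinner m' +
    ε • K₂.grade ∘ₗ K₂.ract.flip p ∘ₗ K₁.rinner m' ∘ₗ K₁.grade
  sign := ε
  map_ract g m := by
    change K₂.ract (K₁.rinner m' (K₁.ract g m)) p +
        ε • K₂.grade (K₂.ract (K₁.rinner m' (K₁.grade (K₁.ract g m))) p) =
      K₂.ract g (K₂.ract (K₁.rinner m' m) p +
        ε • K₂.grade (K₂.ract (K₁.rinner m' (K₁.grade m)) p))
    rw [K₁.grade_ract, K₁.rinner_ract, K₁.rinner_ract, K₂.ract_mul, K₂.ract_mul, K₂.grade_ract,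
      gradeTriv_gradeTriv, map_add, Units.smul_def, Units.smul_def, map_zsmul]
  map_grade m := by
    change K₂.ract (K₁.rinner m' (K₁.grade m)) p +
        ε • K₂.grade (K₂.ract (K₁.rinner m' (K₁.grade (K₁.grade m))) p) =
      ε • K₂.grade (K₂.ract (K₁.rinner m' m) p +
        ε • K₂.grade (K₂.ract (K₁.rinner m' (K₁.grade m)) p))
    rw [map_add, Units.smul_def ε (K₂.grade _), Units.smul_def ε (K₂.grade _), map_zsmul,
      ← Units.smul_def, ← Units.smul_def, smul_add, smul_smul, Int.units_mul_self, one_smul,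
      K₁.grade_grade, K₂.grade_grade, add_comm]

lemma rankOne_one_add_rankOne_neg_one (m' : M₁) (p : M₂) (m : M₁) :
    rankOne K₁ K₂ m' p 1 m + rankOne K₁ K₂ m' p (-1) m =
      (2 : ℂ) • K₂.ract (K₁.rinner m' m) p := by
  let n := K₂.grade (K₂.ract (K₁.rinner m' (K₁.grade m)) p)
  change K₂.ract (K₁.rinner m' m) p + (1 : ℤˣ) • n +
    (K₂.ract (K₁.rinner m' m) p + (-1 : ℤˣ) • n) = _
  rw [Units.neg_smul, one_smul, two_smul]
  abel

/-- Exact supercommutation with the left action of a single section. -/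
def Supercommutes (S : GradedHom K₁ K₂) (f : E.ClSection) : Prop :=
  ∀ m, S (K₁.lact f m) = K₂.lact (E.twistCl S.sign f) (S m)

lemma map_lact_scalarCl (S : GradedHom K₁ K₂) (q : C₀(X, ℂ)) (m : M₁) :
    S (K₁.lact (E.scalarCl q) m) = K₂.lact (E.scalarCl q) (S m) := by
  rw [K₁.scalar, K₂.scalar, S.map_ract]

lemma map_lact_lact_of_mul_self {S : GradedHom K₁ K₂} {g : E.ClSection} {q : C₀(X, ℂ)}
    (hq : g * g = E.scalarCl q) (m : M₁) :
    S (K₁.lact g (K₁.lact g m)) = K₂.lact g (K₂.lact g (S m)) := by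
  rw [← K₁.lact_mul, ← K₂.lact_mul, hq, S.map_lact_scalarCl]

lemma Supercommutes.map_lact_of_odd {S : GradedHom K₁ K₂} {f : E.ClSection}
    (h : S.Supercommutes f) (hf : E.gradeCl f = -f) (m : M₁) :
    S (K₁.lact f m) = S.sign • K₂.lact f (S m) := by
  rw [h m, EquivariantBundle.twistCl_of_odd hf, Units.smul_def, map_zsmul, LinearMap.smul_apply,
    ← Units.smul_def]

lemma supercommutes_of_odd {S : GradedHom K₁ K₂} {f : E.ClSection} (hf : E.gradeCl f = -f)
    (h : ∀ m, S (K₁.lact f m) = S.sign • K₂.lact f (S m)) : S.Supercommutes f := fun m => by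
  rw [h m, EquivariantBundle.twistCl_of_odd hf, Units.smul_def, Units.smul_def, map_zsmul,
    LinearMap.smul_apply]

section Symmetrization

variable (S : GradedHom K₁ K₂) {g : E.ClSection} (hg : E.gradeCl g = -g)

/-- The map `g² S + ε g S g`, where `ε` is the parity of `S`. -/
def average : GradedHom K₁ K₂ where
  toFun := K₂.lact g ∘ₗ (K₂.lact g ∘ₗ S.toFun + S.sign • S.toFun ∘ₗ K₁.lact g)
  sign := S.sign
  map_ract h m := by
    change K₂.lact g (K₂.lact g (S (K₁.ract h m)) + S.sign • S (K₁.lact g (K₁.ract h m))) =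
      K₂.ract h (K₂.lact g (K₂.lact g (S m) + S.sign • S (K₁.lact g m)))
    rw [K₁.lact_ract, S.map_ract, S.map_ract, K₂.lact_ract, Units.smul_def, ← map_zsmul, ← map_add,
      K₂.lact_ract]
    rfl
  map_grade m := by
    change K₂.lact g (K₂.lact g (S (K₁.grade m)) + S.sign • S (K₁.lact g (K₁.grade m))) =
      S.sign • K₂.grade (K₂.lact g (K₂.lact g (S m) + S.sign • S (K₁.lact g m)))
    rw [K₁.lact_grade_of_odd hg, map_neg, S.map_grade, S.map_grade]
    simp only [Units.smul_def, map_zsmul, map_add, map_neg, K₂.lact_grade_of_odd hg, smul_neg,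
      neg_neg, smul_add]

/-- The map `S g - ε g S`, where `ε` is the parity of `S`. -/
def supercommutator : GradedHom K₁ K₂ where
  toFun := S.toFun ∘ₗ K₁.lact g - S.sign • K₂.lact g ∘ₗ S.toFun
  sign := -S.sign
  map_ract h m := by
    change S (K₁.lact g (K₁.ract h m)) - S.sign • K₂.lact g (S (K₁.ract h m)) =
      K₂.ract h (S (K₁.lact g m) - S.sign • K₂.lact g (S m))
    rw [K₁.lact_ract, S.map_ract, S.map_ract, K₂.lact_ract, Units.smul_def, ← map_zsmul, ← map_sub]
    rfl
  map_grade m := by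
    change S (K₁.lact g (K₁.grade m)) - S.sign • K₂.lact g (S (K₁.grade m)) =
      -S.sign • K₂.grade (S (K₁.lact g m) - S.sign • K₂.lact g (S m))
    rw [K₁.lact_grade_of_odd hg, map_neg, S.map_grade, S.map_grade, Units.neg_smul]
    simp only [Units.smul_def, map_zsmul, map_sub, K₂.lact_grade_of_odd hg, smul_neg, smul_sub]
    abel

lemma average_apply (m : M₁) :
    S.average hg m = K₂.lact g (K₂.lact g (S m) + S.sign • S (K₁.lact g m)) := rfl

lemma supercommutator_apply (m : M₁) :
    S.supercommutator hg m = S (K₁.lact g m) - S.sign • K₂.lact g (S m) := rfl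

variable {S}

lemma supercommutes_average {q : C₀(X, ℂ)} (hq : g * g = E.scalarCl q) :
    (S.average hg).Supercommutes g := by
  refine supercommutes_of_odd hg fun m => ?_
  change S.average hg (K₁.lact g m) = S.sign • K₂.lact g (S.average hg m)
  rw [average_apply, average_apply, map_lact_lact_of_mul_self hq]
  simp only [Units.smul_def, map_add, map_zsmul, smul_add]
  rw [← Units.smul_def, ← Units.smul_def, ← Units.smul_def, smul_smul, Int.units_mul_self,
    one_smul, add_comm]

lemma supercommutes_supercommutator {q : C₀(X, ℂ)} (hq : g * g = E.scalarCl q) :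
    (S.supercommutator hg).Supercommutes g := by
  refine supercommutes_of_odd hg fun m => ?_
  change S.supercommutator hg (K₁.lact g m) = -S.sign • K₂.lact g (S.supercommutator hg m)
  rw [supercommutator_apply, supercommutator_apply, map_lact_lact_of_mul_self hq, map_sub,
    smul_sub, Units.smul_def S.sign (K₂.lact g (S m)), map_zsmul, ← Units.smul_def, smul_smul,
    neg_mul, Int.units_mul_self]
  simp only [Units.neg_smul, one_smul]
  abel

variable {f : E.ClSection}

lemma Supercommutes.average (hS : S.Supercommutes f) (hf : E.gradeCl f = -f)
    (hgf : g * f = -(f * g)) : (S.average hg).Supercommutes f := by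
  refine supercommutes_of_odd hf fun m => ?_
  change S.average hg (K₁.lact f m) = S.sign • K₂.lact f (S.average hg m)
  simp only [average_apply, K₁.lact_lact_of_anticomm hgf, map_neg, hS.map_lact_of_odd hf, map_add,
    Units.smul_def, map_zsmul, K₂.lact_lact_of_anticomm hgf, smul_neg, smul_add, neg_neg]

lemma Supercommutes.supercommutator (hS : S.Supercommutes f) (hf : E.gradeCl f = -f)
    (hgf : g * f = -(f * g)) : (S.supercommutator hg).Supercommutes f := by
  refine supercommutes_of_odd hf fun m => ?_
  change S.supercommutator hg (K₁.lact f m) = -S.sign • K₂.lact f (S.supercommutator hg m)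
  rw [Units.neg_smul]
  simp only [supercommutator_apply, K₁.lact_lact_of_anticomm hgf, map_neg, hS.map_lact_of_odd hf,
    map_sub, Units.smul_def, map_zsmul, K₂.lact_lact_of_anticomm hgf, smul_neg, smul_sub]
  abel

lemma average_add_supercommutator_lact {q : C₀(X, ℂ)} (hq : g * g = E.scalarCl q) (m : M₁) :
    S.average hg m + S.supercommutator hg (K₁.lact g m) =
      (2 : ℂ) • K₂.ract (scalarTriv a b q) (S m) := by
  rw [average_apply, supercommutator_apply, map_lact_lact_of_mul_self hq, map_add, Units.smul_def,
    map_zsmul, ← Units.smul_def, ← K₂.lact_mul, hq, K₂.scalar, two_smul]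
  abel

end Symmetrization

/-- The sections with which a graded map supercommutes over a given point. -/
def supercommutant (S : GradedHom K₁ K₂) (x : X) : NonUnitalSubalgebra ℂ E.ClSection where
  carrier := {f | ∀ m, K₂.eval x (S (K₁.lact f m)) = K₂.eval x (K₂.lact (E.twistCl S.sign f) (S m))}
  add_mem' hf hg m := by
    simp only [map_add, LinearMap.add_apply, hf m, hg m]
  zero_mem' m := by
    simp only [map_zero, LinearMap.zero_apply]
  mul_mem' {f g} hf hg m := by
    rw [K₁.lact_mul, hf, map_mul, K₂.lact_mul]
    exact K₂.eval_lact_congr rfl (hg m)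
  smul_mem' z f hf m := by
    simp only [map_smul, LinearMap.smul_apply, hf m]

lemma Supercommutes.mem_supercommutant {S : GradedHom K₁ K₂} {f : E.ClSection}
    (h : S.Supercommutes f) (x : X) : f ∈ S.supercommutant x := fun m => by rw [h]

lemma scalarCl_mem_supercommutant (S : GradedHom K₁ K₂) (x : X) (q : C₀(X, ℂ)) :
    E.scalarCl q ∈ S.supercommutant x := fun m => by
  rw [S.map_lact_scalarCl, EquivariantBundle.twistCl_scalarCl]

lemma eval_map_lact_of_apply_eq_zero (S : GradedHom K₁ K₂) {x : X} {f : E.ClSection}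
    (hf : f.1 x = 0) (m : M₁) : K₂.eval x (S (K₁.lact f m)) = 0 := by
  obtain ⟨h, f', rfl, h0⟩ := EquivariantBundle.exists_eq_scalarCl_mul f
  rw [K₁.lact_mul, S.map_lact_scalarCl, K₂.scalar, K₂.eval_ract_scalar, h0 x hf, zero_smul]

lemma mem_supercommutant_congr {S : GradedHom K₁ K₂} {x : X} {f f' : E.ClSection}
    (hf' : f' ∈ S.supercommutant x) (h : f.1 x = f'.1 x) : f ∈ S.supercommutant x := fun m => by
  have hsub := S.eval_map_lact_of_apply_eq_zero (f := f - f') (sub_eq_zero.2 h) m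
  simp only [map_sub, LinearMap.sub_apply, sub_eq_zero] at hsub
  rw [hsub, hf' m]
  exact K₂.eval_lact_congr (EquivariantBundle.twistCl_apply_congr _ h.symm) rfl

/-- A graded map that supercommutes with everything over the support of a function becomes an
intertwiner when multiplied by this function. -/
def cutoff (S : GradedHom K₁ K₂) (h : C₀(X, ℂ))
    (hS : ∀ x, h x ≠ 0 → ∀ f, f ∈ S.supercommutant x) : Intertwiner K₁ K₂ where
  toFun := K₂.ract (scalarTriv a b h) ∘ₗ S.toFun
  sign := S.sign
  map_ract g m := by
    change K₂.ract (scalarTriv a b h) (S (K₁.ract g m)) =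
      K₂.ract g (K₂.ract (scalarTriv a b h) (S m))
    rw [S.map_ract, ← K₂.scalar, ← K₂.scalar, K₂.lact_ract]
  map_grade m := by
    have hgrade : gradeTriv (scalarTriv a b h) = scalarTriv a b h :=
      ZeroAtInftyContinuousMap.ext fun x =>
        AlgHom.commutes (Cl.grade : ClAB a b →ₐ[ℂ] ClAB a b) (h x)
    change K₂.ract (scalarTriv a b h) (S (K₁.grade m)) =
      S.sign • K₂.grade (K₂.ract (scalarTriv a b h) (S m))
    rw [S.map_grade, K₂.grade_ract, hgrade, Units.smul_def, map_zsmul, ← Units.smul_def]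
  map_lact f m := by
    change K₂.ract (scalarTriv a b h) (S (K₁.lact f m)) =
      K₂.lact (E.twistCl S.sign f) (K₂.ract (scalarTriv a b h) (S m))
    rw [K₂.lact_ract]
    refine K₂.ext_eval fun x => ?_
    rw [K₂.eval_ract_scalar, K₂.eval_ract_scalar]
    by_cases hx : h x = 0
    · rw [hx, zero_smul, zero_smul]
    · rw [hS x hx f m]

lemma eval_cutoff (S : GradedHom K₁ K₂) (h : C₀(X, ℂ))
    (hS : ∀ x, h x ≠ 0 → ∀ f, f ∈ S.supercommutant x) (x : X) (m : M₁) :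
    K₂.eval x (S.cutoff h hS m) = h x • K₂.eval x (S m) :=
  K₂.eval_ract_scalar x h (S m)

lemma exists_eval_ne_zero_of_mul_self {S : GradedHom K₁ K₂} {x : X} {g : E.ClSection}
    (hg : E.gradeCl g = -g) {q : C₀(X, ℂ)} (hq : g * g = E.scalarCl q) (hqx : q x ≠ 0)
    (hS : ∃ m, K₂.eval x (S m) ≠ 0) :
    (∃ m, K₂.eval x (S.average hg m) ≠ 0) ∨ ∃ m, K₂.eval x (S.supercommutator hg m) ≠ 0 := by
  obtain ⟨m, hm⟩ := hS
  by_contra! h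
  have hsum := congrArg (K₂.eval x) (average_add_supercommutator_lact (S := S) hg hq m)
  rw [map_add, h.1, h.2, add_zero, LinearMap.map_smulₛₗ, K₂.eval_ract_scalar, smul_smul, eq_comm,
    smul_eq_zero] at hsum
  exact hsum.elim (mul_ne_zero (by simp) hqx) hm

variable [T2Space X] [LocallyCompactSpace X]

variable (K₁ K₂) in
lemma exists_eval_ne_zero (x : X) : ∃ (S : GradedHom K₁ K₂) (m : M₁), K₂.eval x (S m) ≠ 0 := by
  obtain ⟨p, hp⟩ := K₂.exists_tr_rinner_self_pos x
  obtain ⟨k, m', m, hm⟩ := K₁.exists_sum_rinner_eq_one x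
  by_contra! h
  have hrank : ∀ i, K₂.rinner p p x * K₁.rinner (m' i) (m i) x = 0 := fun i => by
    have hsum := congrArg (K₂.eval x)
      (rankOne_one_add_rankOne_neg_one (K₁ := K₁) (K₂ := K₂) (m' i) p (m i))
    rw [map_add, h, h, add_zero, LinearMap.map_smulₛₗ, eq_comm, smul_eq_zero] at hsum
    rw [← K₂.rinner_ract_apply, ← K₂.eval_apply, hsum.resolve_left (by simp),
      LinearMap.zero_apply]
  have hzero : K₂.rinner p p x = 0 := by
    rw [← mul_one (K₂.rinner p p x), ← hm, Finset.mul_sum, Finset.sum_eq_zero fun i _ => hrank i]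
  rw [hzero, map_zero] at hp
  exact hp.false

variable (K₁ K₂) in
/-- Symmetrise a nonzero graded map with respect to one generator after the other. -/
lemma exists_supercommutes {ι : Type*} {g : ι → E.ClSection} {q : ι → C₀(X, ℂ)}
    (hodd : ∀ i, E.gradeCl (g i) = -g i) (hq : ∀ i, g i * g i = E.scalarCl (q i))
    (hanti : Pairwise fun i j => g i * g j = -(g j * g i)) {x : X} (hx : ∀ i, q i x ≠ 0)
    (s : Finset ι) : ∃ S : GradedHom K₁ K₂,
      (∀ i ∈ s, S.Supercommutes (g i)) ∧ ∃ m, K₂.eval x (S m) ≠ 0 := by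
  induction s using Finset.cons_induction with
  | empty =>
    obtain ⟨S, hS⟩ := exists_eval_ne_zero K₁ K₂ x
    exact ⟨S, fun i hi => absurd hi (Finset.notMem_empty i), hS⟩
  | cons k s hk ih =>
    obtain ⟨S, hS, hSx⟩ := ih
    have hks : ∀ i ∈ s, g k * g i = -(g i * g k) := fun i hi =>
      hanti (ne_of_mem_of_not_mem hi hk).symm
    rcases exists_eval_ne_zero_of_mul_self (hodd k) (hq k) (hx k) hSx with hne | hne
    · exact ⟨_, Finset.forall_mem_cons hk _ |>.2 ⟨supercommutes_average (hodd k) (hq k),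
        fun i hi => (hS i hi).average (hodd k) (hodd i) (hks i hi)⟩, hne⟩
    · exact ⟨_, Finset.forall_mem_cons hk _ |>.2 ⟨supercommutes_supercommutator (hodd k) (hq k),
        fun i hi => (hS i hi).supercommutator (hodd k) (hodd i) (hks i hi)⟩, hne⟩

end GradedHom

namespace Intertwiner

variable [T2Space X] [LocallyCompactSpace X]

variable (K₁ K₂) in
lemma exists_eval_ne_zero (x : X) : ∃ (S : Intertwiner K₁ K₂) (m : M₁), K₂.eval x (S m) ≠ 0 := by
  obtain ⟨n, e, hxe⟩ := IsMetricBundle.exists_triv (𝕜 := ℝ) (V := E.fiber) x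
  obtain ⟨χ, hχx, hχ⟩ := exists_cutoff_apply_eq_one e.isOpen_baseSet hxe
  have hχx' : ofRealC0 χ x = 1 := by rw [ofRealC0_apply, hχx, Complex.ofReal_one]
  obtain ⟨S, hS, m, hm⟩ := GradedHom.exists_supercommutes K₁ K₂
    (g := EquivariantBundle.frameSection e χ hχ) (x := x)
    (fun _ => EquivariantBundle.gradeCl_clSection _)
    (EquivariantBundle.frameSection_mul_self e χ hχ)
    (fun _ _ => EquivariantBundle.frameSection_mul_frameSection e χ hχ)
    (fun _ => by rw [ZeroAtInftyContinuousMap.mul_apply, hχx', one_mul]; exact one_ne_zero)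
    Finset.univ
  have hsupp : ∀ y, ofRealC0 χ y ≠ 0 → ∀ f, f ∈ S.supercommutant y := fun y hy f => by
    obtain ⟨f', hf', hff'⟩ := EquivariantBundle.exists_mem_apply_eq_of_frameSection hχ
      (S.scalarCl_mem_supercommutant y)
      (fun i => (hS i (Finset.mem_univ i)).mem_supercommutant y) (Complex.ofReal_ne_zero.1 hy)
      (f.1 y)
    exact GradedHom.mem_supercommutant_congr hf' hff'.symm
  refine ⟨S.cutoff (ofRealC0 χ) hsupp, m, ?_⟩
  rwa [S.eval_cutoff, hχx', one_smul]

variable (K₁ K₂) in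
lemma exists_coef_self_eq_one (x : X) : ∃ S : Intertwiner K₁ K₂, coef S S x = 1 := by
  obtain ⟨S, m, hm⟩ := exists_eval_ne_zero K₁ K₂ x
  obtain ⟨t, ht, hS⟩ : ∃ t : ℝ, 0 ≤ t ∧ coef S S x = t :=
    (RCLike.nonneg_iff_exists_ofReal.1 (coef_self_nonneg S x)).imp fun _ h => ⟨h.1, h.2.symm⟩
  have ht0 : t ≠ 0 := by
    rintro rfl
    refine hm (K₂.eval_eq_zero_of_rinner_self ?_)
    rw [rinner_apply, hS, Complex.ofReal_zero, zero_smul]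
  refine ⟨(((√t)⁻¹ : ℝ) : ℂ) • S, ?_⟩
  rw [coef_smul_smul, hS, Complex.star_def, Complex.conj_ofReal, ← Complex.ofReal_mul,
    ← Complex.ofReal_mul, ← mul_inv, Real.mul_self_sqrt ht, inv_mul_cancel₀ ht0,
    Complex.ofReal_one]

end Intertwiner

end Existence

/-! ### The line bundle of intertwiners -/

section LineBundle

variable {X : Type*} [TopologicalSpace X] {r : RealStructure X} {E : EquivariantBundle r} {a b : ℕ}
  {M₁ : Type*} [NormedAddCommGroup M₁] [NormedSpace ℂ M₁] [CompleteSpace M₁]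
  {M₂ : Type*} [NormedAddCommGroup M₂] [NormedSpace ℂ M₂] [CompleteSpace M₂]

/-- The line of fibrewise intertwiners over a point. It is spanned by the value of `frame`, which
is encoded as `1`, so that the line lives in the lowest universe. -/
def LineFiber (_ : KROrientation E a b M₁) (_ : KROrientation E a b M₂) (_ : X) : Type := ℂ

variable (K₁ : KROrientation E a b M₁) (K₂ : KROrientation E a b M₂)

instance (x : X) : NormedAddCommGroup (LineFiber K₁ K₂ x) := inferInstanceAs (NormedAddCommGroup ℂ)

instance (x : X) : InnerProductSpace ℂ (LineFiber K₁ K₂ x) :=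
  inferInstanceAs (InnerProductSpace ℂ ℂ)

/-- The coordinate of a vector in the line over `x` with respect to the value of `frame`. -/
def lineCoord (x : X) : LineFiber K₁ K₂ x ≃ₗᵢ[ℂ] ℂ := LinearIsometryEquiv.refl ℂ ℂ

lemma finrank_lineFiber (x : X) : Module.finrank ℂ (LineFiber K₁ K₂ x) = 1 :=
  Module.finrank_self ℂ

variable [T2Space X] [LocallyCompactSpace X]

/-- An intertwiner whose value at `x` is a unit vector. -/
def frame (x : X) : Intertwiner K₁ K₂ := (Intertwiner.exists_coef_self_eq_one K₁ K₂ x).choose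

lemma coef_frame_frame (x : X) : (frame K₁ K₂ x).coef (frame K₁ K₂ x) x = 1 :=
  (Intertwiner.exists_coef_self_eq_one K₁ K₂ x).choose_spec

namespace Intertwiner

variable {K₁ K₂}

lemma coef_mul_coef_frame (S T : Intertwiner K₁ K₂) (x : X) :
    coef S (frame K₁ K₂ x) x * coef (frame K₁ K₂ x) T x = coef S T x := by
  rw [coef_mul_coef, coef_frame_frame, one_mul]

/-- The value at `x` of an intertwiner, as a vector in the line over `x`. -/
def toLine (S : Intertwiner K₁ K₂) (x : X) : LineFiber K₁ K₂ x :=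
  (lineCoord K₁ K₂ x).symm (coef (frame K₁ K₂ x) S x)

lemma inner_toLine (S T : Intertwiner K₁ K₂) (x : X) :
    inner ℂ (S.toLine x) (T.toLine x) = coef S T x := by
  rw [toLine, toLine, LinearIsometryEquiv.inner_map_map, RCLike.inner_apply',
    starRingEnd_apply, star_coef, coef_mul_coef_frame]

lemma toLine_smul (z : ℂ) (S : Intertwiner K₁ K₂) (x : X) : (z • S).toLine x = z • S.toLine x := by
  have h : coef (frame K₁ K₂ x) (z • S) x = z * coef (frame K₁ K₂ x) S x :=
    coef_eq fun m n => by
      rw [smul_apply, K₂.rinner_smul_apply, rinner_apply, smul_smul]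
  rw [toLine, h, ← smul_eq_mul, map_smul, toLine]

lemma exists_toLine_eq {x : X} (v : LineFiber K₁ K₂ x) :
    ∃ S : Intertwiner K₁ K₂, S.sign = (frame K₁ K₂ x).sign ∧ S.toLine x = v := by
  refine ⟨lineCoord K₁ K₂ x v • frame K₁ K₂ x, rfl, (lineCoord K₁ K₂ x).injective ?_⟩
  rw [toLine_smul, map_smul, toLine, LinearIsometryEquiv.apply_symm_apply, coef_frame_frame,
    smul_eq_mul, mul_one]

lemma sign_eq_of_toLine_ne_zero {S : Intertwiner K₁ K₂} {x : X} (h : S.toLine x ≠ 0) :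
    S.sign = (frame K₁ K₂ x).sign := by
  by_contra hne
  exact h (by rw [toLine, coef_of_sign_ne (Ne.symm hne), map_zero])

lemma sign_smul_toLine (S : Intertwiner K₁ K₂) (x : X) :
    (frame K₁ K₂ x).sign • S.toLine x = S.sign • S.toLine x := by
  by_cases h : S.toLine x = 0
  · rw [h, smul_zero, smul_zero]
  · rw [sign_eq_of_toLine_ne_zero h]

lemma coef_self_ne_zero_iff (S : Intertwiner K₁ K₂) (x : X) : coef S S x ≠ 0 ↔ S.toLine x ≠ 0 := by
  rw [← inner_toLine, inner_self_ne_zero]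

lemma continuous_norm_toLine (S : Intertwiner K₁ K₂) : Continuous fun x => ‖S.toLine x‖ := by
  refine (Complex.continuous_re.comp (continuous_coef S S)).sqrt.congr fun x => ?_
  rw [norm_eq_sqrt_re_inner (𝕜 := ℂ), inner_toLine]
  rfl

/-- The inner product of the value of an intertwiner with a vector in the line bundle. -/
def pairing (S : Intertwiner K₁ K₂) (p : TotalSpace Unit (LineFiber K₁ K₂)) : ℂ :=
  inner ℂ (S.toLine p.proj) p.snd

lemma pairing_mk (S : Intertwiner K₁ K₂) (x : X) (v : LineFiber K₁ K₂ x) :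
    pairing S ⟨x, v⟩ = inner ℂ (S.toLine x) v := rfl

end Intertwiner

open Intertwiner

/-- With this topology, continuity into the line bundle is tested by pairing with intertwiners. -/
instance : TopologicalSpace (TotalSpace Unit (LineFiber K₁ K₂)) :=
  .induced TotalSpace.proj inferInstance ⊓
    ⨅ S : Intertwiner K₁ K₂, .induced (pairing S) inferInstance

section

variable {K₁ K₂}

lemma continuous_totalSpace_lineFiber_iff {Y : Type*} [TopologicalSpace Y]
    {f : Y → TotalSpace Unit (LineFiber K₁ K₂)} :
    Continuous f ↔ Continuous (fun y => (f y).proj) ∧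
      ∀ S : Intertwiner K₁ K₂, Continuous fun y => pairing S (f y) :=
  continuous_inf_rng.trans (and_congr continuous_induced_rng
    (continuous_iInf_rng.trans (forall_congr' fun _ => continuous_induced_rng)))

lemma continuous_proj_lineFiber :
    Continuous (TotalSpace.proj : TotalSpace Unit (LineFiber K₁ K₂) → X) :=
  (continuous_totalSpace_lineFiber_iff.1 continuous_id).1

lemma Intertwiner.continuous_pairing (S : Intertwiner K₁ K₂) : Continuous (pairing S) :=
  (continuous_totalSpace_lineFiber_iff.1 continuous_id).2 S

lemma totalSpace_lineFiber_ext {p q : TotalSpace Unit (LineFiber K₁ K₂)} (hproj : p.proj = q.proj)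
    (h : ∀ S : Intertwiner K₁ K₂, pairing S p = pairing S q) : p = q := by
  obtain ⟨x, v⟩ := p
  obtain ⟨y, w⟩ := q
  obtain rfl : x = y := hproj
  have hvw : v = w := by
    refine ext_inner_left ℂ fun u => ?_
    obtain ⟨S, -, rfl⟩ := exists_toLine_eq u
    exact h S
  rw [hvw]

lemma Intertwiner.continuous_toLine (S : Intertwiner K₁ K₂) :
    Continuous fun x => (⟨x, S.toLine x⟩ : TotalSpace Unit (LineFiber K₁ K₂)) :=
  continuous_totalSpace_lineFiber_iff.2 ⟨continuous_id, fun T =>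
    (continuous_coef T S).congr fun x => (inner_toLine T S x).symm⟩

/-- The trivialisation of the line bundle given by a nonvanishing intertwiner. -/
def lineTriv (S : Intertwiner K₁ K₂) : IsometricTriv ℂ (LineFiber K₁ K₂) 1 where
  baseSet := {x | coef S S x ≠ 0}
  isOpen_baseSet := isOpen_ne_fun (continuous_coef S S) continuous_const
  coord x := (unitEquiv (finrank_lineFiber K₁ K₂ x.1) ((‖S.toLine x‖ : ℂ)⁻¹ • S.toLine x)
    (norm_smul_inv_norm ((coef_self_ne_zero_iff S x).1 x.2))).symm.trans
    (OrthonormalBasis.singleton (Fin 1) ℂ).repr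
  continuous_coord := by
    refine (OrthonormalBasis.singleton (Fin 1) ℂ).repr.continuous.comp ?_
    have hinv : Continuous fun p : {p : TotalSpace Unit (LineFiber K₁ K₂) //
        p.proj ∈ {x | coef S S x ≠ 0}} => (‖S.toLine p.1.proj‖ : ℂ)⁻¹ :=
      (Complex.continuous_ofReal.comp ((continuous_norm_toLine S).comp
        (continuous_proj_lineFiber.comp continuous_subtype_val))).inv₀ fun p =>
          Complex.ofReal_ne_zero.2 (norm_ne_zero_iff.2 ((coef_self_ne_zero_iff S _).1 p.2))
    refine (hinv.mul ((continuous_pairing S).comp continuous_subtype_val)).congr fun p => ?_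
    refine Eq.trans ?_ (unitEquiv_symm_apply _ _ _ _).symm
    rw [inner_smul_left, map_inv₀, Complex.conj_ofReal]
    rfl
  continuous_coord_symm := by
    refine continuous_totalSpace_lineFiber_iff.2
      ⟨continuous_subtype_val.comp continuous_fst, fun T => ?_⟩
    have hinv : Continuous fun q : {x | coef S S x ≠ 0} × EuclideanSpace ℂ (Fin 1) =>
        (‖S.toLine q.1‖ : ℂ)⁻¹ :=
      (Complex.continuous_ofReal.comp ((continuous_norm_toLine S).comp
        (continuous_subtype_val.comp continuous_fst))).inv₀ fun q =>
          Complex.ofReal_ne_zero.2 (norm_ne_zero_iff.2 ((coef_self_ne_zero_iff S _).1 q.1.2))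
    refine ((((OrthonormalBasis.singleton (Fin 1) ℂ).repr.symm.continuous.comp
      continuous_snd).mul hinv).mul ((continuous_coef T S).comp
        (continuous_subtype_val.comp continuous_fst))).congr fun q => ?_
    change _ = inner ℂ (T.toLine q.1) ((OrthonormalBasis.singleton (Fin 1) ℂ).repr.symm q.2 •
      (‖S.toLine q.1‖ : ℂ)⁻¹ • S.toLine q.1)
    rw [inner_smul_right, inner_smul_right, inner_toLine, mul_assoc]
    rfl

end

instance : IsMetricBundle ℂ (LineFiber K₁ K₂) where
  continuous_proj := continuous_proj_lineFiber
  exists_triv x := ⟨1, lineTriv (frame K₁ K₂ x), by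
    change coef (frame K₁ K₂ x) (frame K₁ K₂ x) x ≠ 0
    rw [coef_frame_frame]
    exact one_ne_zero⟩

/-- The grading of the line over `x`, by the parity of intertwiners. -/
def lineGrade (x : X) : LineFiber K₁ K₂ x ≃ₗᵢ[ℂ] LineFiber K₁ K₂ x :=
  signIsometry _ (frame K₁ K₂ x).sign

section

variable {K₁ K₂}

lemma lineGrade_toLine (S : Intertwiner K₁ K₂) (x : X) :
    lineGrade K₁ K₂ x (S.toLine x) = S.sign • S.toLine x :=
  sign_smul_toLine S x

lemma pairing_lineGrade (S : Intertwiner K₁ K₂) (x : X) (v : LineFiber K₁ K₂ x) :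
    pairing S ⟨x, lineGrade K₁ K₂ x v⟩ = S.sign • pairing S ⟨x, v⟩ := by
  obtain ⟨T, -, rfl⟩ := exists_toLine_eq v
  rw [lineGrade_toLine, pairing_mk, pairing_mk, Units.smul_def, ← Int.cast_smul_eq_zsmul ℂ,
    inner_smul_right, inner_toLine]
  by_cases h : S.sign = T.sign
  · rw [h, Units.smul_def, zsmul_eq_mul]
  · rw [coef_of_sign_ne h, mul_zero, smul_zero]

lemma norm_toLine_conj_frame (x : X) : ‖(frame K₁ K₂ x).conj.toLine (r x)‖ = 1 := by
  rw [norm_eq_sqrt_re_inner (𝕜 := ℂ), inner_toLine, coef_conj_conj, r.involutive,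
    coef_frame_frame, star_one, RCLike.one_re, Real.sqrt_one]

end

/-- The "real" structure of the line bundle, given by conjugation of intertwiners. -/
def lineConj (x : X) : LineFiber K₁ K₂ x ≃ₛₗᵢ[starRingEnd ℂ] LineFiber K₁ K₂ (r x) :=
  ((lineCoord K₁ K₂ x).trans (starₗᵢ ℂ : ℂ ≃ₗᵢ⋆[ℂ] ℂ)).trans
    (unitEquiv (finrank_lineFiber K₁ K₂ (r x)) _ (norm_toLine_conj_frame x))

section

variable {K₁ K₂}

lemma pairing_lineConj (S : Intertwiner K₁ K₂) (x : X) (v : LineFiber K₁ K₂ x) :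
    pairing S ⟨r x, lineConj K₁ K₂ x v⟩ = star (pairing S.conj ⟨x, v⟩) := by
  obtain ⟨T, -, rfl⟩ := exists_toLine_eq v
  change inner ℂ (S.toLine (r x)) (star (coef (frame K₁ K₂ x) T x) •
    (frame K₁ K₂ x).conj.toLine (r x)) = star (inner ℂ (S.conj.toLine x) (T.toLine x))
  rw [inner_smul_right, inner_toLine, inner_toLine, ← coef_mul_coef_frame S.conj T, star_mul',
    coef_conj_left, star_star, mul_comm]

lemma lineConj_toLine (T : Intertwiner K₁ K₂) (x : X) :
    lineConj K₁ K₂ x (T.toLine x) = T.conj.toLine (r x) := by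
  refine ext_inner_left ℂ fun u => ?_
  obtain ⟨S, -, rfl⟩ := exists_toLine_eq u
  rw [← pairing_mk, pairing_lineConj, pairing_mk, inner_toLine, inner_toLine, coef_conj_left,
    star_star]

lemma pairing_conj_conj (S : Intertwiner K₁ K₂) : pairing S.conj.conj = pairing S := by
  funext p
  obtain ⟨x, v⟩ := p
  obtain ⟨T, -, rfl⟩ := exists_toLine_eq v
  rw [pairing_mk, pairing_mk, inner_toLine, inner_toLine]
  exact coef_eq fun m n => by rw [conj_conj_apply, rinner_apply]

end

/-- The line bundle of fibrewise intertwiners. -/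
def lineBundle : RealLineBundle r where
  fiber := LineFiber K₁ K₂
  finrank_fiber := finrank_lineFiber K₁ K₂
  grade := lineGrade K₁ K₂
  grade_grade x v := (signIsometry _ (frame K₁ K₂ x).sign).symm_apply_apply v
  continuous_grade := continuous_totalSpace_lineFiber_iff.2 ⟨continuous_proj_lineFiber, fun S =>
    ((continuous_pairing S).const_smul S.sign).congr fun p => (pairing_lineGrade S _ _).symm⟩
  conj := lineConj K₁ K₂
  conj_conj p := totalSpace_lineFiber_ext (r.involutive p.proj) fun S => by
    rw [pairing_lineConj, pairing_lineConj, star_star, pairing_conj_conj]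
  continuous_conj := continuous_totalSpace_lineFiber_iff.2
    ⟨r.continuous_toFun.comp continuous_proj_lineFiber, fun S =>
      (continuous_pairing S.conj).star.congr fun p => (pairing_lineConj S _ _).symm⟩
  conj_grade x v := by
    obtain ⟨S, -, rfl⟩ := exists_toLine_eq v
    rw [lineGrade_toLine, lineConj_toLine, lineGrade_toLine, Units.smul_def, map_zsmul,
      lineConj_toLine, Units.smul_def]
    rfl

/-- The action of the line over `x` on the fibre of `M₁`, with values in the fibre of `M₂`. -/
def lineAct (x : X) : LineFiber K₁ K₂ x →ₗ[ℂ] M₁ →ₗ[ℂ] M₂ →ₗ⋆[ℂ] ClAB a b :=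
  (lineCoord K₁ K₂ x).toLinearMap.smulRight (K₂.eval x ∘ₗ (frame K₁ K₂ x).toFun)

section

variable {K₁ K₂}

lemma lineAct_toLine (S : Intertwiner K₁ K₂) (x : X) (m : M₁) :
    lineAct K₁ K₂ x (S.toLine x) m = K₂.eval x (S m) := by
  have h := coef_smul_eval (frame K₁ K₂ x) S x m
  rw [coef_frame_frame, one_smul] at h
  exact h.symm

lemma lineAct_injective (x : X) : Function.Injective (lineAct K₁ K₂ x) := by
  refine (injective_iff_map_eq_zero _).2 fun v hv => ?_
  obtain ⟨S, -, rfl⟩ := exists_toLine_eq v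
  obtain ⟨m, hm⟩ := K₁.exists_tr_rinner_self_pos x
  have h : coef S S x • K₁.rinner m m x = 0 := by
    rw [← rinner_apply, ← K₂.eval_apply, ← lineAct_toLine, hv]
    rfl
  rcases smul_eq_zero.1 h with h | h
  · rwa [← inner_toLine, inner_self_eq_zero] at h
  · rw [h, map_zero] at hm
    exact absurd hm (lt_irrefl 0)

variable {x : X} {v v' : LineFiber K₁ K₂ x} {m m' : M₁} {n n' : M₂}

lemma rinner_of_eval_eq_lineAct (h : K₂.eval x n = lineAct K₁ K₂ x v m)
    (h' : K₂.eval x n' = lineAct K₁ K₂ x v' m') :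
    K₂.rinner n n' x = inner ℂ v v' • K₁.rinner m m' x := by
  obtain ⟨S, -, rfl⟩ := exists_toLine_eq v
  obtain ⟨T, -, rfl⟩ := exists_toLine_eq v'
  rw [lineAct_toLine] at h h'
  rw [KROrientation.rinner_congr h h', rinner_apply, inner_toLine]

lemma eval_ract_of_eval_eq_lineAct (h : K₂.eval x n = lineAct K₁ K₂ x v m) (g : TrivCl X a b) :
    K₂.eval x (K₂.ract g n) = lineAct K₁ K₂ x v (K₁.ract g m) := by
  obtain ⟨S, -, rfl⟩ := exists_toLine_eq v
  rw [lineAct_toLine] at h ⊢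
  rw [K₂.eval_ract_congr h rfl, S.map_ract]

lemma eval_lact_of_eval_eq_lineAct (h : K₂.eval x n = lineAct K₁ K₂ x v m) (f : E.ClSection) :
    K₂.eval x (K₂.lact f n) =
      lineAct K₁ K₂ x v (K₁.lact (E.twistCl (frame K₁ K₂ x).sign f) m) := by
  obtain ⟨S, hS, rfl⟩ := exists_toLine_eq v
  rw [lineAct_toLine] at h ⊢
  rw [K₂.eval_lact_congr rfl h, S.lact_apply, hS]

lemma eval_lact_of_eval_eq_lineAct_of_even {f : E.ClSection} (hf : E.gradeCl f = f)
    (h : K₂.eval x n = lineAct K₁ K₂ x v m) :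
    K₂.eval x (K₂.lact f n) = lineAct K₁ K₂ x v (K₁.lact f m) := by
  rw [eval_lact_of_eval_eq_lineAct h, E.twistCl_of_even hf]

lemma eval_lact_of_eval_eq_lineAct_of_odd {f : E.ClSection} (hf : E.gradeCl f = -f)
    (h : K₂.eval x n = lineAct K₁ K₂ x v m) :
    K₂.eval x (K₂.lact f n) = lineAct K₁ K₂ x (lineGrade K₁ K₂ x v) (K₁.lact f m) := by
  obtain ⟨S, -, rfl⟩ := exists_toLine_eq v
  rw [lineAct_toLine] at h
  rw [K₂.eval_lact_congr rfl h, S.lact_apply, E.twistCl_of_odd hf, lineGrade_toLine,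
    Units.smul_def, Units.smul_def, map_zsmul, map_zsmul, LinearMap.smul_apply,
    LinearMap.smul_apply, lineAct_toLine, map_zsmul, map_zsmul]

lemma eval_grade_of_eval_eq_lineAct (h : K₂.eval x n = lineAct K₁ K₂ x v m) :
    K₂.eval x (K₂.grade n) = lineAct K₁ K₂ x (lineGrade K₁ K₂ x v) (K₁.grade m) := by
  obtain ⟨S, -, rfl⟩ := exists_toLine_eq v
  rw [lineAct_toLine] at h
  rw [K₂.eval_grade_congr h, lineGrade_toLine, S.grade_apply, Units.smul_def, Units.smul_def,
    map_zsmul, map_zsmul, LinearMap.smul_apply, lineAct_toLine]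

lemma eval_conj_of_eval_eq_lineAct {v : LineFiber K₁ K₂ (r x)}
    (h : K₂.eval (r x) n = lineAct K₁ K₂ (r x) v m) {w : LineFiber K₁ K₂ x}
    (hw : lineConj K₁ K₂ x w = v) :
    K₂.eval x (K₂.conj n) = lineAct K₁ K₂ x w (K₁.conj m) := by
  obtain ⟨S, -, rfl⟩ := exists_toLine_eq w
  rw [← hw, lineConj_toLine, lineAct_toLine] at h
  rw [lineAct_toLine, K₂.eval_conj_congr h, conj_apply, K₂.conj_conj]

end

end LineBundle

/-! ### The tensor product with the line bundle -/

section TensorProduct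

variable {X : Type*} [TopologicalSpace X] {r : RealStructure X} {E : EquivariantBundle r} {a b : ℕ}
  {M₁ : Type*} [NormedAddCommGroup M₁] [NormedSpace ℂ M₁] [CompleteSpace M₁]
  {M₂ : Type*} [NormedAddCommGroup M₂] [NormedSpace ℂ M₂] [CompleteSpace M₂]
  {K₁ : KROrientation E a b M₁} {K₂ : KROrientation E a b M₂}

/-- The product of a compactly supported real function and a continuous complex function, as a
function vanishing at infinity. -/
def mulC0 (χ : C_c(X, ℝ)) (f : C(X, ℂ)) : C₀(X, ℂ) where
  toFun x := χ x * f x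
  continuous_toFun := (Complex.continuous_ofReal.comp χ.continuous).mul f.continuous
  zero_at_infty' :=
    (χ.hasCompactSupport.comp_left Complex.ofReal_zero).mul_right.is_zero_at_infty

lemma KROrientation.continuous_ract (g : TrivCl X a b) : Continuous (K₁.ract g) :=
  AddMonoidHomClass.continuous_of_bound (K₁.ract g) ‖g‖ fun m =>
    (K₁.norm_ract_le g m).trans_eq (mul_comm _ _)

lemma KROrientation.continuous_ract_left (m : M₁) : Continuous fun g => K₁.ract g m :=
  AddMonoidHomClass.continuous_of_bound (K₁.ract.flip m) ‖m‖ fun g => K₁.norm_ract_le g m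

variable [T2Space X] [LocallyCompactSpace X]

lemma KROrientation.mem_of_forall_ract_mem {D : Submodule ℂ M₁} (hD : IsClosed (D : Set M₁))
    {n : M₁} (h : ∀ χ : C_c(X, ℝ), K₁.ract (scalarTriv a b (ofRealC0 χ)) n ∈ D) : n ∈ D := by
  refine hD.closure_subset (Metric.mem_closure_iff.2 fun ε hε => ?_)
  obtain ⟨χ, hχ, hle⟩ := exists_cutoff_mul_le (f := fun x => √‖K₁.rinner n n x‖) (by
    simpa only [norm_zero, Real.sqrt_zero] using (zero_at_infty (K₁.rinner n n)).norm.sqrt)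
    (half_pos hε)
  refine ⟨_, h χ, ?_⟩
  rw [dist_eq_norm]
  refine (K₁.norm_le_of_rinner (half_pos hε).le fun x => ?_).trans_lt (half_lt_self hε)
  have heval : K₁.eval x (n - K₁.ract (scalarTriv a b (ofRealC0 χ)) n) =
      K₁.eval x (((1 - χ x : ℝ) : ℂ) • n) := by
    rw [map_sub, K₁.eval_ract_scalar, map_smul, Complex.ofReal_sub, sub_smul, Complex.ofReal_one,
      one_smul, ofRealC0_apply]
  have h0 : 0 ≤ 1 - χ x := sub_nonneg.2 (hχ x).2
  calc ‖K₁.rinner (n - K₁.ract (scalarTriv a b (ofRealC0 χ)) n)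
          (n - K₁.ract (scalarTriv a b (ofRealC0 χ)) n) x‖
      = ((1 - χ x) * √‖K₁.rinner n n x‖) ^ 2 := by
        rw [KROrientation.rinner_congr heval heval, K₁.rinner_smul_left_apply,
          K₁.rinner_smul_apply, norm_smul, norm_smul, norm_star, Complex.norm_real,
          Real.norm_of_nonneg h0, mul_pow, Real.sq_sqrt (norm_nonneg _), sq, mul_assoc]
    _ ≤ (ε / 2) ^ 2 := pow_le_pow_left₀ (by positivity) (hle x) 2

/-- `n` is the product `l m` of a section `l` of the line bundle and `m`, computed fibrewise. -/
def IsTensor (l : ∀ x, LineFiber K₁ K₂ x) (m : M₁) (n : M₂) : Prop :=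
  ∀ x, K₂.eval x n = lineAct K₁ K₂ x (l x) m

namespace IsTensor

variable {l l' : ∀ x, LineFiber K₁ K₂ x} {m m' : M₁} {n n' : M₂}

lemma unique (h : IsTensor l m n) (h' : IsTensor l m n') : n = n' :=
  K₂.ext_eval fun x => (h x).trans (h' x).symm

lemma add_left (h : IsTensor l m n) (h' : IsTensor l' m n') : IsTensor (l + l') m (n + n') :=
  fun x => by rw [map_add, h x, h' x, Pi.add_apply, map_add, LinearMap.add_apply]

lemma smul_left (h : IsTensor l m n) (z : ℂ) : IsTensor (z • l) m (z • n) :=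
  fun x => by rw [map_smul, h x, Pi.smul_apply, map_smul, LinearMap.smul_apply]

lemma sub_left (h : IsTensor l m n) (h' : IsTensor l' m n') : IsTensor (l - l') m (n - n') :=
  fun x => by rw [map_sub, h x, h' x, Pi.sub_apply, map_sub, LinearMap.sub_apply]

lemma add_right (h : IsTensor l m n) (h' : IsTensor l m' n') : IsTensor l (m + m') (n + n') :=
  fun x => by rw [map_add, h x, h' x, map_add]

lemma smul_right (h : IsTensor l m n) (z : ℂ) : IsTensor l (z • m) (z • n) :=
  fun x => by rw [map_smul, h x, map_smul]

lemma norm_le (h : IsTensor l m n) {C : ℝ} (hC : 0 ≤ C) (hl : ∀ x, ‖l x‖ ≤ C) :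
    ‖n‖ ≤ C * ‖m‖ := by
  refine K₂.norm_le_of_rinner (by positivity) fun x => ?_
  rw [rinner_of_eval_eq_lineAct (h x) (h x), norm_smul, mul_pow, inner_self_eq_norm_sq_to_K,
    norm_pow, RCLike.norm_ofReal, abs_norm]
  gcongr
  · exact hl x
  · exact K₁.norm_rinner_apply_le m x

lemma of_tendsto {ι : Type*} {F : Filter ι} [F.NeBot] {k : ι → ∀ x, LineFiber K₁ K₂ x}
    {u : ι → M₂} (h : ∀ i, IsTensor (k i) m (u i)) (hk : ∀ x, Tendsto (k · x) F (𝓝 (l x)))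
    (hu : Tendsto u F (𝓝 n)) : IsTensor l m n := fun x => by
  obtain ⟨S, -, hS⟩ := Intertwiner.exists_toLine_eq (l x)
  rw [← hS, lineAct_toLine]
  refine K₂.eval_eq_of_tr fun p => ?_
  have hact : Continuous fun v => Cl.tr (lineAct K₁ K₂ x v m p) :=
    LinearMap.continuous_of_finiteDimensional
      { toFun := fun v => Cl.tr (lineAct K₁ K₂ x v m p)
        map_add' := fun v w => by
          rw [map_add, LinearMap.add_apply, LinearMap.add_apply, map_add]
        map_smul' := fun z v => by
          rw [map_smul, LinearMap.smul_apply, LinearMap.smul_apply, map_smul, RingHom.id_apply] }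
  rw [← K₂.eval_apply x p (S m), ← lineAct_toLine, hS]
  refine tendsto_nhds_unique ((K₂.continuous_tr_rinner p x).continuousAt.tendsto.comp hu)
    ((hact.continuousAt.tendsto.comp (hk x)).congr fun i => ?_)
  rw [Function.comp_apply, Function.comp_apply, ← h i x, K₂.eval_apply]

end IsTensor

variable (K₁ K₂) in
lemma exists_sum_mul_coef_frame (χ : C_c(X, ℝ)) :
    ∃ (t : Finset X) (g : C_c(X, ℝ)),
      ∀ x, ∑ i ∈ t, (g x : ℂ) * (frame K₁ K₂ i).coef (frame K₁ K₂ i) x = χ x := by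
  have hre : ∀ (S : Intertwiner K₁ K₂) x, S.coef S x = ((S.coef S x).re : ℂ) := fun S x =>
    Complex.eq_re_of_ofReal_le (r := 0) (by simpa using S.coef_self_nonneg x)
  obtain ⟨t, g, hg⟩ := exists_finset_sum_mul_eq
    (f := fun i x => ((frame K₁ K₂ i).coef (frame K₁ K₂ i) x).re)
    (fun i => Complex.continuous_re.comp (Intertwiner.continuous_coef _ _))
    (fun i x => (Complex.nonneg_iff.1 (Intertwiner.coef_self_nonneg _ x)).1)
    (fun x => ⟨x, by rw [coef_frame_frame]; exact one_pos⟩) χ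
  refine ⟨t, g, fun x => ?_⟩
  rw [← hg x, Complex.ofReal_sum]
  exact Finset.sum_congr rfl fun i _ => by rw [Complex.ofReal_mul, ← hre]

lemma exists_isTensor_cutoff {l : ∀ x, LineFiber K₁ K₂ x} (hl : ContinuousSection l)
    (χ : C_c(X, ℝ)) (m : M₁) : ∃ n : M₂, IsTensor (fun x => (χ x : ℂ) • l x) m n := by
  obtain ⟨t, g, hg⟩ := exists_sum_mul_coef_frame K₁ K₂ χ
  let f (i : X) : C(X, ℂ) := ⟨_, (frame K₁ K₂ i).continuous_pairing.comp hl⟩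
  refine ⟨∑ i ∈ t, K₂.ract (scalarTriv a b (mulC0 g (f i))) (frame K₁ K₂ i m), fun x => ?_⟩
  obtain ⟨T, -, hT⟩ := Intertwiner.exists_toLine_eq (l x)
  have hf : ∀ i, f i x = (frame K₁ K₂ i).coef T x := fun i => by
    rw [← Intertwiner.inner_toLine, hT]
    rfl
  have hterm : ∀ i, K₂.eval x (K₂.ract (scalarTriv a b (mulC0 g (f i))) (frame K₁ K₂ i m)) =
      ((g x : ℂ) * (frame K₁ K₂ i).coef (frame K₁ K₂ i) x) • K₂.eval x (T m) := fun i => by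
    rw [K₂.eval_ract_scalar, mul_smul, Intertwiner.coef_smul_eval, ← hf, ← mul_smul]
    rfl
  change _ = lineAct K₁ K₂ x ((χ x : ℂ) • l x) m
  rw [map_sum, Finset.sum_congr rfl fun i _ => hterm i, ← Finset.sum_smul, hg, ← hT, map_smul,
    LinearMap.smul_apply, lineAct_toLine]

lemma exists_isTensor (l : C0Section ℂ (LineFiber K₁ K₂)) (m : M₁) :
    ∃ n : M₂, IsTensor l.1 m n := by
  choose χ hχ hle using fun i : ℕ =>
    exists_cutoff_mul_le l.2.2 (Nat.one_div_pos_of_nat (α := ℝ) (n := i))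
  choose u hu using fun i => exists_isTensor_cutoff l.2.1 (χ i) m
  have hdist : ∀ i x, ‖l.1 x - (χ i x : ℂ) • l.1 x‖ ≤ 1 / ((i : ℝ) + 1) := fun i x => by
    have h : l.1 x - (χ i x : ℂ) • l.1 x = ((1 - χ i x : ℝ) : ℂ) • l.1 x := by
      rw [Complex.ofReal_sub, Complex.ofReal_one, sub_smul, one_smul]
    rw [h, norm_smul, Complex.norm_real, Real.norm_of_nonneg (sub_nonneg.2 (hχ i x).2)]
    exact hle i x
  have hcauchy : CauchySeq u := by
    refine cauchySeq_of_le_tendsto_0 (fun N : ℕ => (2 * (1 / ((N : ℝ) + 1))) * ‖m‖)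
      (fun i j N hi hj => ?_) ?_
    · rw [dist_eq_norm]
      refine ((hu i).sub_left (hu j)).norm_le (by positivity) fun x => ?_
      calc ‖(χ i x : ℂ) • l.1 x - (χ j x : ℂ) • l.1 x‖
          ≤ ‖l.1 x - (χ j x : ℂ) • l.1 x‖ + ‖l.1 x - (χ i x : ℂ) • l.1 x‖ := by
            rw [← sub_sub_sub_cancel_left _ _ (l.1 x)]
            exact norm_sub_le _ _
        _ ≤ 2 * (1 / ((N : ℝ) + 1)) := by
            rw [two_mul]
            exact add_le_add ((hdist j x).trans (Nat.one_div_le_one_div hj))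
              ((hdist i x).trans (Nat.one_div_le_one_div hi))
    · simpa using (tendsto_one_div_add_atTop_nhds_zero_nat.const_mul (2 : ℝ)).mul_const ‖m‖
  obtain ⟨n, hn⟩ := cauchySeq_tendsto_of_complete hcauchy
  refine ⟨n, .of_tendsto hu (fun x => ?_) hn⟩
  refine tendsto_iff_norm_sub_tendsto_zero.2 (squeeze_zero (fun _ => norm_nonneg _) (fun i => ?_)
    tendsto_one_div_add_atTop_nhds_zero_nat)
  rw [norm_sub_rev]
  exact hdist i x

variable (K₁ K₂) in
/-- The product of sections of the line bundle and elements of `M₁`. -/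
def lineTmul : C0Section ℂ (LineFiber K₁ K₂) →ₗ[ℂ] M₁ →ₗ[ℂ] M₂ :=
  have hspec (l : C0Section ℂ (LineFiber K₁ K₂)) (m : M₁) := (exists_isTensor l m).choose_spec
  LinearMap.mk₂ ℂ (fun l m => (exists_isTensor l m).choose)
    (fun l l' m => (hspec (l + l') m).unique ((hspec l m).add_left (hspec l' m)))
    (fun z l m => (hspec (z • l) m).unique ((hspec l m).smul_left z))
    (fun l m m' => (hspec l (m + m')).unique ((hspec l m).add_right (hspec l m')))
    (fun z l m => (hspec l (z • m)).unique ((hspec l m).smul_right z))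

lemma isTensor_lineTmul (l : C0Section ℂ (LineFiber K₁ K₂)) (m : M₁) :
    IsTensor l.1 m (lineTmul K₁ K₂ l m) := (exists_isTensor l m).choose_spec

/-- The product of an intertwiner and a compactly supported function, as a section of the line
bundle. -/
def Intertwiner.toSection (S : Intertwiner K₁ K₂) (g : C_c(X, ℝ)) :
    C0Section ℂ (LineFiber K₁ K₂) :=
  ⟨fun x => (g x : ℂ) • S.toLine x, continuous_totalSpace_lineFiber_iff.2
    ⟨continuous_id, fun T => ((Complex.continuous_ofReal.comp g.continuous).mul
      (continuous_coef T S)).congr fun x => by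
        rw [pairing_mk, inner_smul_right, inner_toLine]
        rfl⟩,
    (g.hasCompactSupport.comp_left Complex.ofReal_zero).smul_right.norm.is_zero_at_infty⟩

lemma eval_lineTmul_toSection (S : Intertwiner K₁ K₂) (g : C_c(X, ℝ)) (m : M₁) (x : X) :
    K₂.eval x (lineTmul K₁ K₂ (S.toSection g) m) = (g x : ℂ) • K₂.eval x (S m) := by
  rw [isTensor_lineTmul, ← lineAct_toLine, ← LinearMap.smul_apply, ← map_smul]
  rfl

lemma eval_ract_rinner (S : Intertwiner K₁ K₂) (m m' : M₁) (n : M₂) (x : X) :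
    K₂.eval x (K₂.ract (K₂.rinner (S m) (S m')) n) =
      S.coef S x • K₂.eval x (K₂.ract (K₁.rinner m m') n) :=
  LinearMap.ext fun p => by
    rw [LinearMap.smul_apply, K₂.eval_apply, K₂.eval_apply, K₂.rinner_ract_apply,
      K₂.rinner_ract_apply, S.rinner_apply, mul_smul_comm]

/-- Uses `n ⟪S m, S m'⟫ = ⟪n, S m⟫ (S m')` for the intertwiners `S = frame K₁ K₂ i`. -/
lemma ract_ract_rinner_mem_span (χ : C_c(X, ℝ)) (m m' : M₁) (n : M₂) :
    K₂.ract (scalarTriv a b (ofRealC0 χ)) (K₂.ract (K₁.rinner m m') n) ∈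
      Submodule.span ℂ (Set.range fun p : C0Section ℂ (LineFiber K₁ K₂) × M₁ =>
        lineTmul K₁ K₂ p.1 p.2) := by
  obtain ⟨t, g, hg⟩ := exists_sum_mul_coef_frame K₁ K₂ χ
  let p (i : X) : M₁ := K₁.lact
    (E.twistCl (frame K₁ K₂ i).sign (K₂.linner n (frame K₁ K₂ i m))) m'
  have hp : ∀ i x, K₂.eval x (frame K₁ K₂ i (p i)) =
      (frame K₁ K₂ i).coef (frame K₁ K₂ i) x • K₂.eval x (K₂.ract (K₁.rinner m m') n) :=
    fun i x => by rw [← Intertwiner.lact_apply, K₂.linner_rinner, eval_ract_rinner]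
  have hsum : K₂.ract (scalarTriv a b (ofRealC0 χ)) (K₂.ract (K₁.rinner m m') n) =
      ∑ i ∈ t, lineTmul K₁ K₂ ((frame K₁ K₂ i).toSection g) (p i) :=
    K₂.ext_eval fun x => by
      simp only [map_sum, eval_lineTmul_toSection, hp, smul_smul, ← Finset.sum_smul, hg]
      exact K₂.eval_ract_scalar x _ _
  rw [hsum]
  exact sum_mem fun i _ => Submodule.subset_span ⟨(_, _), rfl⟩

variable (K₁ K₂) in
lemma dense_span_lineTmul : Dense (Submodule.span ℂ (Set.range
    fun p : C0Section ℂ (LineFiber K₁ K₂) × M₁ => lineTmul K₁ K₂ p.1 p.2) : Set M₂) := by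
  set D := Submodule.span ℂ (Set.range
    fun p : C0Section ℂ (LineFiber K₁ K₂) × M₁ => lineTmul K₁ K₂ p.1 p.2)
  have hD : IsClosed (D.topologicalClosure : Set M₂) := D.isClosed_topologicalClosure
  have hract : ∀ (χ : C_c(X, ℝ)) (c : TrivCl X a b) (n : M₂),
      K₂.ract (scalarTriv a b (ofRealC0 χ)) (K₂.ract c n) ∈ D.topologicalClosure := fun χ c n => by
    have hspan : Submodule.span ℂ (Set.range fun p : M₁ × M₁ => K₁.rinner p.1 p.2) ≤
        D.topologicalClosure.comap (K₂.ract (scalarTriv a b (ofRealC0 χ)) ∘ₗ K₂.ract.flip n) := by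
      rw [Submodule.span_le]
      rintro _ ⟨p, rfl⟩
      exact D.le_topologicalClosure (ract_ract_rinner_mem_span χ p.1 p.2 n)
    have hclosed := hD.preimage ((K₂.continuous_ract (scalarTriv a b (ofRealC0 χ))).comp
      (K₂.continuous_ract_left n))
    exact hclosed.closure_subset_iff.2 hspan (K₁.rinner_full c)
  intro n
  rw [← Submodule.topologicalClosure_coe]
  exact KROrientation.mem_of_forall_ract_mem hD fun χ =>
    KROrientation.mem_of_forall_ract_mem hD fun χ' => hract χ' _ n

variable (K₁ K₂) in
/-- Evaluation of sections of the line bundle of intertwiners. -/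
def lineBundleTensorIso : TensorIso (lineBundle K₁ K₂) K₁ K₂ where
  tmul := lineTmul K₁ K₂
  rinner_tmul l l' m m' x :=
    rinner_of_eval_eq_lineAct (isTensor_lineTmul l m x) (isTensor_lineTmul l' m' x)
  dense := dense_span_lineTmul K₁ K₂
  ract_tmul g l m := IsTensor.unique
    (fun x => eval_ract_of_eval_eq_lineAct (isTensor_lineTmul l m x) g) (isTensor_lineTmul _ _)
  lact_tmul_of_even _ hf l m := IsTensor.unique
    (fun x => eval_lact_of_eval_eq_lineAct_of_even hf (isTensor_lineTmul l m x))
    (isTensor_lineTmul _ _)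
  lact_tmul_of_odd _ hf l m := IsTensor.unique
    (fun x => eval_lact_of_eval_eq_lineAct_of_odd hf (isTensor_lineTmul l m x))
    (isTensor_lineTmul _ _)
  grade_tmul l m := IsTensor.unique
    (fun x => eval_grade_of_eval_eq_lineAct (isTensor_lineTmul l m x)) (isTensor_lineTmul _ _)
  conj_tmul l m := IsTensor.unique
    (fun x => eval_conj_of_eval_eq_lineAct (isTensor_lineTmul l m (r x))
      ((lineConj K₁ K₂ x).apply_symm_apply _)) (isTensor_lineTmul _ _)

end TensorProduct

/-! ### Uniqueness -/

section MetricBundle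

variable {X : Type*} [TopologicalSpace X]
  {V : X → Type*} [∀ x, NormedAddCommGroup (V x)] [∀ x, InnerProductSpace ℂ (V x)]
  [TopologicalSpace (TotalSpace Unit V)] [IsMetricBundle ℂ V]

lemma ContinuousSection.continuous_inner {s : ∀ x, V x} (hs : ContinuousSection s) :
    Continuous fun p : TotalSpace Unit V => inner ℂ (s p.proj) p.snd := by
  refine continuous_iff_continuousAt.2 fun p => ?_
  obtain ⟨n, e, hp⟩ := IsMetricBundle.exists_triv (𝕜 := ℂ) (V := V) p.proj
  have hproj : Continuous (TotalSpace.proj : TotalSpace Unit V → X) :=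
    IsMetricBundle.continuous_proj (𝕜 := ℂ)
  have hs' : Continuous fun p : {p : TotalSpace Unit V // p.proj ∈ e.baseSet} =>
      e.coord ⟨p.1.proj, p.2⟩ (s p.1.proj) :=
    ((continuousSection_iff ℂ).1 hs n e).comp
      ((hproj.comp continuous_subtype_val).subtype_mk fun p => p.2)
  have hinner : Continuous fun p : {p : TotalSpace Unit V // p.proj ∈ e.baseSet} =>
      inner ℂ (s p.1.proj) p.1.snd :=
    (hs'.inner (𝕜 := ℂ) e.continuous_coord).congr fun p => LinearIsometryEquiv.inner_map_map ..
  exact ((e.isOpen_baseSet.preimage hproj).isOpenEmbedding_subtypeVal.continuousAt_iff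
    (x := ⟨p, hp⟩)).1 hinner.continuousAt

lemma ContinuousSection.continuousAt_smul {s : ∀ x, V x} (hs : ContinuousSection s)
    {Y : Type*} [TopologicalSpace Y] {f : Y → X} {c : Y → ℂ} {y : Y} (hf : Continuous f)
    (hc : ContinuousAt c y) :
    ContinuousAt (fun y => (⟨f y, c y • s (f y)⟩ : TotalSpace Unit V)) y := by
  obtain ⟨n, e, hy⟩ := IsMetricBundle.exists_triv (𝕜 := ℂ) (V := V) (f y)
  have hf' : Continuous fun y : f ⁻¹' e.baseSet => (⟨f y, y.2⟩ : e.baseSet) :=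
    (hf.comp continuous_subtype_val).subtype_mk fun y => y.2
  have hs' : Continuous fun y : f ⁻¹' e.baseSet => e.coord ⟨f y, y.2⟩ (s (f y)) :=
    ((continuousSection_iff ℂ).1 hs n e).comp hf'
  have hc' : ContinuousAt (fun y : f ⁻¹' e.baseSet => c y) ⟨y, hy⟩ :=
    ContinuousAt.comp (f := Subtype.val) (g := c) hc continuous_subtype_val.continuousAt
  refine ((e.isOpen_baseSet.preimage hf).isOpenEmbedding_subtypeVal.continuousAt_iff
    (x := ⟨y, hy⟩)).1 ((e.continuous_coord_symm.continuousAt.comp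
      (hf'.continuousAt.prodMk (hc'.smul hs'.continuousAt))).congr (.of_forall fun y => ?_))
  refine congrArg (TotalSpace.mk (f y)) ?_
  change (e.coord ⟨f y, y.2⟩).symm (c y • e.coord ⟨f y, y.2⟩ (s (f y))) = c y • s (f y)
  rw [map_smul, LinearIsometryEquiv.symm_apply_apply]

lemma continuous_totalSpace_map_of_finrank_eq_one {W : X → Type*} [∀ x, NormedAddCommGroup (W x)]
    [∀ x, InnerProductSpace ℂ (W x)] [TopologicalSpace (TotalSpace Unit W)] [IsMetricBundle ℂ W]
    (hV : ∀ x, Module.finrank ℂ (V x) = 1) {φ : ∀ x, V x →ₗ[ℂ] W x}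
    (hφ : ∀ x, ∃ s : ∀ y, V y, ContinuousSection s ∧ s x ≠ 0 ∧
      ContinuousSection fun y => φ y (s y)) :
    Continuous fun p : TotalSpace Unit V => (⟨p.proj, φ p.proj p.snd⟩ : TotalSpace Unit W) := by
  refine continuous_iff_continuousAt.2 fun p => ?_
  obtain ⟨s, hs, hsp, hφs⟩ := hφ p.proj
  have hproj : Continuous (TotalSpace.proj : TotalSpace Unit V → X) :=
    IsMetricBundle.continuous_proj (𝕜 := ℂ)
  have hss : Continuous fun p : TotalSpace Unit V => inner ℂ (s p.proj) (s p.proj) :=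
    hs.continuous_inner.comp (hs.comp hproj)
  have hne : inner ℂ (s p.proj) (s p.proj) ≠ 0 := inner_self_ne_zero.2 hsp
  refine (hφs.continuousAt_smul hproj
    (hs.continuous_inner.continuousAt.div hss.continuousAt hne)).congr ?_
  filter_upwards [hss.continuousAt.eventually_ne hne] with q hq
  refine congrArg (TotalSpace.mk q.proj) ?_
  conv_rhs => rw [eq_inner_div_inner_smul (hV q.proj) (inner_self_ne_zero.1 hq) q.snd, map_smul]
  rfl

end MetricBundle

section Uniqueness

variable {X : Type*} [TopologicalSpace X] {r : RealStructure X} {L : RealLineBundle r}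

namespace RealLineBundle

lemma exists_grade_eq_smul (x : X) (v : L.fiber x) : ∃ ε : ℤˣ, L.grade x v = ε • v := by
  rcases eq_or_ne v 0 with rfl | hv
  · exact ⟨1, by rw [map_zero, smul_zero]⟩
  obtain ⟨z, hz⟩ := exists_smul_eq_of_finrank_eq_one (L.finrank_fiber x) hv (L.grade x v)
  have hzz : (z * z) • v = (1 : ℂ) • v := by
    rw [mul_smul, hz, ← map_smul, hz, L.grade_grade, one_smul]
  rcases mul_self_eq_one_iff.1 (smul_left_injective ℂ hv hzz) with rfl | rfl
  · exact ⟨1, by rw [← hz, one_smul, one_smul]⟩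
  · exact ⟨-1, by rw [← hz, Units.neg_smul, neg_smul, one_smul, one_smul]⟩

lemma exists_homogeneous_section_apply_eq [T2Space X] [LocallyCompactSpace X] (x : X)
    (v : L.fiber x) :
    ∃ (l : L.Sections) (ε : ℤˣ), L.gradeSection l = ε • l ∧ l.1 x = v := by
  obtain ⟨s, hs⟩ := exists_section_apply_eq ℂ x v
  obtain ⟨ε, hε⟩ := L.exists_grade_eq_smul x v
  refine ⟨(2⁻¹ : ℂ) • (s + ε • L.gradeSection s), ε, Subtype.ext (funext fun y => ?_), ?_⟩
  · change L.grade y ((2⁻¹ : ℂ) • (s.1 y + ε • L.grade y (s.1 y))) =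
      ε • (2⁻¹ : ℂ) • (s.1 y + ε • L.grade y (s.1 y))
    rw [smul_comm ε, smul_add ε, smul_smul ε, Int.units_mul_self, one_smul, Units.smul_def,
      map_smul, map_add, map_zsmul, L.grade_grade, add_comm, ← Units.smul_def]
  · change (2⁻¹ : ℂ) • (s.1 x + ε • L.grade x (s.1 x)) = v
    rw [hs, hε, smul_smul, Int.units_mul_self, one_smul]
    module

end RealLineBundle

variable {E : EquivariantBundle r} {a b : ℕ}
  {M₁ : Type*} [NormedAddCommGroup M₁] [NormedSpace ℂ M₁] [CompleteSpace M₁]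
  {M₂ : Type*} [NormedAddCommGroup M₂] [NormedSpace ℂ M₂] [CompleteSpace M₂]
  {K₁ : KROrientation E a b M₁} {K₂ : KROrientation E a b M₂}

namespace TensorIso

variable (I : TensorIso L K₁ K₂)

lemma lact_tmul {l : L.Sections} {ε : ℤˣ} (hl : L.gradeSection l = ε • l) (f : E.ClSection)
    (m : M₁) : K₂.lact f (I.tmul l m) = I.tmul l (K₁.lact (E.twistCl ε f) m) := by
  obtain ⟨f₀, f₁, hf₀, hf₁, rfl⟩ := E.exists_even_add_odd f
  have hodd : K₂.lact f₁ (I.tmul l m) = I.tmul l (K₁.lact (E.twistCl ε f₁) m) := by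
    rw [I.lact_tmul_of_odd f₁ hf₁, hl, E.twistCl_of_odd hf₁, Units.smul_def, Units.smul_def,
      map_zsmul, map_zsmul, LinearMap.smul_apply, LinearMap.smul_apply, map_zsmul]
  rw [map_add, LinearMap.add_apply, I.lact_tmul_of_even f₀ hf₀, hodd, map_add,
    E.twistCl_of_even hf₀, map_add, LinearMap.add_apply, map_add]

/-- The intertwiner `m ↦ l ⊗ m` for a homogeneous section `l`. -/
def intertwiner {l : L.Sections} {ε : ℤˣ} (hl : L.gradeSection l = ε • l) :
    Intertwiner K₁ K₂ where
  toFun := I.tmul l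
  sign := ε
  map_ract g m := (I.ract_tmul g l m).symm
  map_lact f m := by rw [I.lact_tmul hl, E.twistCl_twistCl]
  map_grade m := by
    rw [I.grade_tmul, hl, Units.smul_def ε (l : L.Sections), map_zsmul, LinearMap.smul_apply,
      ← Units.smul_def, smul_smul, Int.units_mul_self, one_smul]

variable [T2Space X] [LocallyCompactSpace X]

open Intertwiner

lemma norm_toLine_intertwiner {l : L.Sections} {ε : ℤˣ} (hl : L.gradeSection l = ε • l) (x : X) :
    ‖(I.intertwiner hl).toLine x‖ = ‖l.1 x‖ := by
  rw [norm_eq_sqrt_re_inner (𝕜 := ℂ), inner_toLine, norm_eq_sqrt_re_inner (𝕜 := ℂ),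
    coef_eq fun m n => I.rinner_tmul l l m n x]

lemma eval_tmul_congr {l l' : L.Sections} {x : X} (h : l.1 x = l'.1 x) (m : M₁) :
    K₂.eval x (I.tmul l m) = K₂.eval x (I.tmul l' m) := by
  rw [← sub_eq_zero, ← map_sub, ← LinearMap.sub_apply, ← map_sub]
  refine K₂.eval_eq_zero_of_rinner_self ?_
  rw [I.rinner_tmul, show (l - l').1 x = 0 from sub_eq_zero.2 h, inner_zero_left, zero_smul]

lemma exists_lineEquiv (x : X) : ∃ φ : L.fiber x ≃ₗᵢ[ℂ] LineFiber K₁ K₂ x,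
    ∀ (l : L.Sections) (m : M₁), K₂.eval x (I.tmul l m) = lineAct K₁ K₂ x (φ (l.1 x)) m := by
  have := Module.nontrivial_of_finrank_pos (R := ℂ) ((L.finrank_fiber x).symm ▸ one_pos)
  obtain ⟨v, hv⟩ := exists_norm_eq (L.fiber x) zero_le_one
  obtain ⟨l₀, ε, hl₀, rfl⟩ := L.exists_homogeneous_section_apply_eq x v
  refine ⟨(unitEquiv (L.finrank_fiber x) _ hv).symm.trans (unitEquiv (finrank_lineFiber K₁ K₂ x)
    ((I.intertwiner hl₀).toLine x) ((I.norm_toLine_intertwiner hl₀ x).trans hv)), fun l m => ?_⟩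
  obtain ⟨z, hz⟩ := (unitEquiv (L.finrank_fiber x) _ hv).surjective (l.1 x)
  rw [I.eval_tmul_congr (l' := z • l₀) hz.symm, LinearIsometryEquiv.trans_apply, ← hz,
    LinearIsometryEquiv.symm_apply_apply, unitEquiv_apply, map_smul, map_smul,
    LinearMap.smul_apply, LinearMap.smul_apply, map_smul, lineAct_toLine]
  rfl

/-- The identification of the fibre of `L` with the line of intertwiners: `v` acts as `m ↦ l ⊗ m`
for every section `l` with value `v`. -/
def lineEquiv (x : X) : L.fiber x ≃ₗᵢ[ℂ] LineFiber K₁ K₂ x := (I.exists_lineEquiv x).choose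

lemma eval_tmul (x : X) (l : L.Sections) (m : M₁) :
    K₂.eval x (I.tmul l m) = lineAct K₁ K₂ x (I.lineEquiv x (l.1 x)) m :=
  (I.exists_lineEquiv x).choose_spec l m

lemma lineEquiv_apply_section {l : L.Sections} {ε : ℤˣ} (hl : L.gradeSection l = ε • l) (x : X) :
    I.lineEquiv x (l.1 x) = (I.intertwiner hl).toLine x := by
  refine lineAct_injective x (LinearMap.ext fun m => ?_)
  rw [← I.eval_tmul, lineAct_toLine]
  rfl

lemma lineEquiv_grade (x : X) (v : L.fiber x) :
    I.lineEquiv x (L.grade x v) = lineGrade K₁ K₂ x (I.lineEquiv x v) := by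
  obtain ⟨l, rfl⟩ := exists_section_apply_eq ℂ x v
  refine lineAct_injective x (LinearMap.ext fun m => ?_)
  have h := eval_grade_of_eval_eq_lineAct (I.eval_tmul x l (K₁.grade m))
  rw [I.grade_tmul, K₁.grade_grade] at h
  exact (I.eval_tmul x (L.gradeSection l) m).symm.trans h

lemma lineEquiv_conj (x : X) (v : L.fiber x) :
    I.lineEquiv (r x) (L.conj x v) = lineConj K₁ K₂ x (I.lineEquiv x v) := by
  obtain ⟨l, hl⟩ := exists_section_apply_eq ℂ (r x) (L.conj x v)
  have hlv : (L.conjSection l).1 x = v := (L.conj x).symm_apply_eq.2 hl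
  rw [← (lineConj K₁ K₂ x).symm_apply_eq]
  refine lineAct_injective x (LinearMap.ext fun m => ?_)
  have h := eval_conj_of_eval_eq_lineAct (I.eval_tmul (r x) l (K₁.conj m))
    ((lineConj K₁ K₂ x).apply_symm_apply _)
  rw [I.conj_tmul, K₁.conj_conj, I.eval_tmul, hlv, hl] at h
  exact h.symm

lemma exists_continuousSection_lineEquiv (x : X) : ∃ s : ∀ y, L.fiber y,
    ContinuousSection s ∧ s x ≠ 0 ∧ ContinuousSection fun y => I.lineEquiv y (s y) := by
  have := Module.nontrivial_of_finrank_pos (R := ℂ) ((L.finrank_fiber x).symm ▸ one_pos)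
  obtain ⟨v, hv⟩ := exists_ne (0 : L.fiber x)
  obtain ⟨l, ε, hl, rfl⟩ := L.exists_homogeneous_section_apply_eq x v
  refine ⟨l.1, l.2.1, hv, ?_⟩
  simp only [I.lineEquiv_apply_section hl]
  exact continuous_toLine _

/-- A line bundle that transforms `K₁` into `K₂` is isomorphic to the line bundle of
intertwiners. -/
def lineBundleIso : RealLineBundle.Iso (lineBundle K₁ K₂) L where
  toFun x := (I.lineEquiv x).symm
  continuous_toFun := by
    refine continuous_totalSpace_map_of_finrank_eq_one (finrank_lineFiber K₁ K₂)
      (φ := fun x => (I.lineEquiv x).symm.toLinearEquiv.toLinearMap) fun x => ?_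
    obtain ⟨s, hs, hsx, hφs⟩ := I.exists_continuousSection_lineEquiv x
    refine ⟨_, hφs, (map_ne_zero_iff _ (I.lineEquiv x).injective).2 hsx,
      hs.congr fun y => congrArg (TotalSpace.mk y) ((I.lineEquiv y).symm_apply_apply _).symm⟩
  continuous_symm := continuous_totalSpace_map_of_finrank_eq_one L.finrank_fiber
    (φ := fun x => (I.lineEquiv x).toLinearEquiv.toLinearMap) I.exists_continuousSection_lineEquiv
  map_grade x v := (I.lineEquiv x).symm_apply_eq.2
    ((I.lineEquiv_grade x _).trans (congrArg _ ((I.lineEquiv x).apply_symm_apply v))).symm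
  map_conj x v := (I.lineEquiv (r x)).symm_apply_eq.2
    ((I.lineEquiv_conj x _).trans (congrArg _ ((I.lineEquiv x).apply_symm_apply v))).symm

end TensorIso

end Uniqueness

end KR

end

theorem mainTheorem8 {X : Type*} [TopologicalSpace X] [T2Space X] [LocallyCompactSpace X]
    (r : KR.RealStructure X) (E : KR.EquivariantBundle r) (a b : ℕ)
    {M₁ : Type*} [NormedAddCommGroup M₁] [NormedSpace ℂ M₁] [CompleteSpace M₁]
    {M₂ : Type*} [NormedAddCommGroup M₂] [NormedSpace ℂ M₂] [CompleteSpace M₂]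
    (K₁ : KR.KROrientation E a b M₁) (K₂ : KR.KROrientation E a b M₂) :
    ∃ L : KR.RealLineBundle.{_, 0} r, Nonempty (KR.TensorIso L K₁ K₂) ∧
      ∀ L' : KR.RealLineBundle r, Nonempty (KR.TensorIso L' K₁ K₂) →
        Nonempty (KR.RealLineBundle.Iso L L') :=
  ⟨KR.lineBundle K₁ K₂, ⟨KR.lineBundleTensorIso K₁ K₂⟩, fun _ ⟨I⟩ => ⟨I.lineBundleIso⟩⟩
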